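/- All manifolds are smooth, finite-dimensional, Hausdorff, second countable and without boundary; vector bundles have finite rank. **Conventions.** A *Lie algebroid* $A\to M$ is a smooth vector bundle with a vector bundle morphism $\rho_A\colon A\to TM$ over the identity (the anchor) and an $\mathbb R$-Lie bracket on $\Gamma(A)$ such that $[a,ha']=h[a,a']+(\rho_A(a)h)\,a'$ for $a,a'\in\Gamma(A)$, $h\in C^\infty(M)$; for example $TM$ with $\rho=\mathrm{id}$ and the bracket of vector fields. An *LA-morphism* from $A\to M$ to $B\to N$ is a smooth vector bundle morphism $\Phi\colon A\to B$ over a smooth map $\phi\colon M\to N$ with $\rho_B\circ\Phi=T\phi\circ\rho_A$ and such that, whenever $\Phi\circ a_1=\sum_i h_i\,(b_i\circ\phi)$ and $\Phi\circ a_2=\sum_j g_j\,(c_j\circ\phi)$ near a point (finite sums, $a_1,a_2\in\Gamma(A)$, $b_i,c_j\in\Gamma(B)$, $h_i,g_j\in C^\infty(M)$), one has at that point $$\Phi\circ[a_1,a_2]=\sum_{i,j}h_ig_j\,([b_i,c_j]\circ\phi)+\sum_j(\rho_A(a_1)g_j)\,(c_j\circ\phi)-\sum_i(\rho_A(a_2)h_i)\,(b_i\circ\phi).$$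 An *LA-isomorphism over the identity* is an isomorphism of smooth vector bundles over the identity that preserves the anchors and the brackets. Let $B\to N$ be a Lie algebroid and $f\colon M\to N$ smooth. The *pullback* $f^{!!}B$ has the fibres $$(f^{!!}B)_m=\{(v,b)\in T_mM\times B_{f(m)}\mid T_mf(v)=\rho_B(b)\};$$ it is said to *exist* if these have constant dimension. It is then a smooth subbundle of $TM\oplus f^!B$ (where $f^!B\to M$ is the pullback vector bundle) and a Lie algebroid with anchor $(v,b)\mapsto v$ and bracket given by $[(X,\beta),(Y,\gamma)]=([X,Y],\delta)$, where, if $\beta=\sum_ih_i\,(b_i\circ f)$ and $\gamma=\sum_jg_j\,(c_j\circ f)$ near a point, then there $$\delta=\sum_{i,j}h_ig_j\,([b_i,c_j]\circ f)+\sum_j(Xg_j)\,(c_j\circ f)-\sum_i(Yh_i)\,(b_i\circ f).$$ Put $p_{B,f}\colon f^{!!}B\to B$, $(v,b)\mapsto b$, a map over $f$. Let $I\subseteq\mathbb R$ be an open interval containing $0$ and $1$. For a Lie algebroid $A\to M$, $TI\times A\to I\times M$ carries the product Lie algebroid structure, and $\mathcal I_t\colon A\to TI\times A$, $a\mapsto(0_t,a)$,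 is a map over $m\mapsto(t,m)$, for $t\in I$. An *LA-homotopy* between two LA-morphisms $\Phi_0,\Phi_1\colon A\to B$ is an LA-morphism $\Phi\colon TI\times A\to B$ with $\Phi_j=\Phi\circ\mathcal I_j$ for $j=0,1$. **Corollary.** Let $B\to N$ be a Lie algebroid, $M$ a manifold, and $\phi\colon I\times M\to N$, $(t,m)\mapsto\phi_t(m)$, a smooth map such that $\phi^{!!}B$ exists. Suppose that $\phi^{!!}B$ has a smooth section of the form $$(s,m)\mapsto\bigl(\partial_t|_s,\,0_m,\,y(s,m)\bigr)\in(T_sI\times T_mM)\times_{TN}B_{\phi(s,m)}.$$ Then $\phi_0^{!!}B$ exists, and the following hold. 1. There exists an LA-isomorphism $\Pi\colon TI\times\phi_0^{!!}B\to\phi^{!!}B$ over the identity on $I\times M$. 2. For every such $\Pi$, the composition $p_{B,\phi}\circ\Pi\colon TI\times\phi_0^{!!}B\to B$, over $\phi\colon I\times M\to N$, is an LA-homotopy between the LA-morphisms $p_{B,\phi}\circ\Pi\circ\mathcal I_0\colon\phi_0^{!!}B\to B$, over $\phi_0$, and $p_{B,\phi}\circ\Pi\circ\mathcal I_1\colon\phi_0^{!!}B\to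 B$, over $\phi_1$. -/

import Mathlib

open Bundle
open scoped ContDiff Manifold Topology

section Subbundle

variable {E : Type*} [NormedAddCommGroup E] [NormedSpace ℝ E]
  {H : Type*} [TopologicalSpace H] (I : ModelWithCorners ℝ E H)
  {M : Type*} [TopologicalSpace M] [ChartedSpace H M]
  (F : Type*) [NormedAddCommGroup F] [NormedSpace ℝ F]
  {V : M → Type*} [TopologicalSpace (TotalSpace F V)] [∀ x, AddCommGroup (V x)]
  [∀ x, Module ℝ (V x)] [∀ x, TopologicalSpace (V x)] [FiberBundle F V] [VectorBundle ℝ F V]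

/-- A smooth local frame for a family of subspaces `S x ⊆ V x` near `x₀`, written in the
trivialization of `V` at `x₀`: linear isomorphisms `q x` of `ℝ^r` onto the subspace of `F`
corresponding to `S x`, with left inverses `p x`, both depending smoothly on `x ∈ U`. -/
structure Straightening (S : ∀ x, Submodule ℝ (V x)) (r : ℕ) (x₀ : M) where
  U : Set M
  p : M → F →L[ℝ] EuclideanSpace ℝ (Fin r)
  q : M → EuclideanSpace ℝ (Fin r) →L[ℝ] F
  isOpen : IsOpen U
  mem : x₀ ∈ U
  subset : U ⊆ (trivializationAt F V x₀).baseSet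
  contMDiffOn_p : ContMDiffOn I 𝓘(ℝ, F →L[ℝ] EuclideanSpace ℝ (Fin r)) ∞ p U
  contMDiffOn_q : ContMDiffOn I 𝓘(ℝ, EuclideanSpace ℝ (Fin r) →L[ℝ] F) ∞ q U
  p_q : ∀ x ∈ U, ∀ k, p x (q x k) = k
  symm_q_mem : ∀ x ∈ U, ∀ k, (trivializationAt F V x₀).symm x (q x k) ∈ S x
  q_p : ∀ x ∈ U, ∀ v ∈ S x, q x (p x (trivializationAt F V x₀ ⟨x, v⟩).2) =
    (trivializationAt F V x₀ ⟨x, v⟩).2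

/-- The subspaces `S x ⊆ V x` form a smooth subbundle of rank `r`. -/
def IsSmoothSubbundle (S : ∀ x, Submodule ℝ (V x)) (r : ℕ) : Prop :=
  ∀ x₀, Nonempty (Straightening I F S r x₀)

variable {I F} {S : ∀ x, Submodule ℝ (V x)} {r : ℕ}

/-- The fibres of a smooth subbundle, considered as a vector bundle in its own right. -/
def Subbundle (_hS : IsSmoothSubbundle I F S r) (x : M) : Type _ := S x

namespace Subbundle

variable (hS : IsSmoothSubbundle I F S r)

noncomputable instance (x : M) : AddCommGroup (Subbundle hS x) := inferInstanceAs (AddCommGroup (S x))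
noncomputable instance (x : M) : Module ℝ (Subbundle hS x) := inferInstanceAs (Module ℝ (S x))
instance (x : M) : TopologicalSpace (Subbundle hS x) := inferInstanceAs (TopologicalSpace (S x))

/-- The inclusion of a subbundle. -/
def incl (x : M) : Subbundle hS x →ₗ[ℝ] V x := (S x).subtype

/-- An element of the subspace, as an element of the subbundle. -/
def mk (x : M) (v : V x) (hv : v ∈ S x) : Subbundle hS x := (⟨v, hv⟩ : S x)

theorem incl_mem (x : M) (v : Subbundle hS x) : incl hS x v ∈ S x := Subtype.property (p := (· ∈ S x)) v

open Classical in
/-- The inverse of the local trivialization `pretriv` below on the fibre over `x`. -/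
noncomputable def invFiber {x₀ : M} (d : Straightening I F S r x₀) (x : M)
    (k : EuclideanSpace ℝ (Fin r)) : Subbundle hS x :=
  if h : x ∈ d.U then
    mk hS x ((trivializationAt F V x₀).symm x (d.q x k)) (d.symm_q_mem x h k)
  else 0

theorem incl_invFiber {x₀ : M} (d : Straightening I F S r x₀) {x : M} (hx : x ∈ d.U)
    (k : EuclideanSpace ℝ (Fin r)) :
    incl hS x (invFiber hS d x k) = (trivializationAt F V x₀).symm x (d.q x k) := by
  rw [invFiber, dif_pos hx]; rfl

/-- The local trivialization of the subbundle defined by a smooth local frame. -/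
noncomputable def pretriv {x₀ : M} (d : Straightening I F S r x₀) :
    Pretrivialization (EuclideanSpace ℝ (Fin r))
      (π (EuclideanSpace ℝ (Fin r)) (Subbundle hS)) where
  toFun v := (v.1, d.p v.1 (trivializationAt F V x₀ ⟨v.1, incl hS v.1 v.2⟩).2)
  invFun y := ⟨y.1, invFiber hS d y.1 y.2⟩
  source := π (EuclideanSpace ℝ (Fin r)) (Subbundle hS) ⁻¹' d.U
  target := d.U ×ˢ Set.univ
  map_source' v hv := ⟨hv, trivial⟩
  map_target' y hy := hy.1
  left_inv' := by
    rintro ⟨x, v⟩ (hx : x ∈ d.U)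
    refine congrArg (TotalSpace.mk x) (Subtype.ext ?_)
    refine (incl_invFiber hS d hx _).trans ?_
    refine (congrArg _ (d.q_p x hx _ v.2)).trans ?_
    exact (trivializationAt F V x₀).symm_apply_apply_mk (d.subset hx) _
  right_inv' := by
    rintro ⟨x, k⟩ ⟨hx : x ∈ d.U, -⟩
    refine Prod.ext rfl ?_
    change d.p x (trivializationAt F V x₀ ⟨x, incl hS x (invFiber hS d x k)⟩).2 = k
    rw [incl_invFiber hS d hx, (trivializationAt F V x₀).apply_mk_symm (d.subset hx)]
    exact d.p_q x hx k
  open_target := d.isOpen.prod isOpen_univ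
  baseSet := d.U
  open_baseSet := d.isOpen
  source_eq := rfl
  target_eq := rfl
  proj_toFun _ _ := rfl

theorem pretriv_symm {x₀ : M} (d : Straightening I F S r x₀) {x : M} (hx : x ∈ d.U)
    (k : EuclideanSpace ℝ (Fin r)) :
    incl hS x ((pretriv hS d).symm x k) = (trivializationAt F V x₀).symm x (d.q x k) := by
  have h := (pretriv hS d).mk_symm (b := x) hx k
  rw [← incl_invFiber hS d hx]
  exact congrArg _ (TotalSpace.mk_inj.mp h)

theorem coordChange {x₀ x₁ : M} (d : Straightening I F S r x₀) (d' : Straightening I F S r x₁) 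
    {x : M} (hx : x ∈ d.U ∩ d'.U) (k : EuclideanSpace ℝ (Fin r)) :
    ((d'.p x).comp (((trivializationAt F V x₀).coordChangeL ℝ (trivializationAt F V x₁) x :
      F →L[ℝ] F).comp (d.q x))) k = (pretriv hS d' ⟨x, (pretriv hS d).symm x k⟩).2 := by
  change _ = d'.p x (trivializationAt F V x₁ ⟨x, incl hS x ((pretriv hS d).symm x k)⟩).2
  rw [pretriv_symm hS d hx.1]
  simp only [ContinuousLinearMap.comp_apply, ContinuousLinearEquiv.coe_coe]
  rw [Trivialization.coordChangeL_apply _ _ ⟨d.subset hx.1, d'.subset hx.2⟩]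

theorem contMDiffOn_coordChange [ContMDiffVectorBundle ∞ F V I] {x₀ x₁ : M}
    (d : Straightening I F S r x₀) (d' : Straightening I F S r x₁) :
    ContMDiffOn I 𝓘(ℝ, EuclideanSpace ℝ (Fin r) →L[ℝ] EuclideanSpace ℝ (Fin r)) ∞
      (fun x ↦ (d'.p x).comp (((trivializationAt F V x₀).coordChangeL ℝ (trivializationAt F V x₁) x :
      F →L[ℝ] F).comp (d.q x))) (d.U ∩ d'.U) :=
  (d'.contMDiffOn_p.mono Set.inter_subset_right).clm_comp
    (((contMDiffOn_coordChangeL (n := ∞) (IB := I) (trivializationAt F V x₀)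
      (trivializationAt F V x₁)).mono (Set.inter_subset_inter d.subset d'.subset)).clm_comp
      (d.contMDiffOn_q.mono Set.inter_subset_left))

theorem isInducing_pretriv {x₀ : M} (d : Straightening I F S r x₀) {x : M} (hx : x ∈ d.U) :
    Topology.IsInducing (fun v : Subbundle hS x ↦ pretriv hS d ⟨x, v⟩) := by
  have hb := d.subset hx
  have hc : Continuous (fun v : V x ↦ ((trivializationAt F V x₀) ⟨x, v⟩).2) := by
    have := ((trivializationAt F V x₀).continuousLinearEquivAt ℝ x hb).continuous
    simpa using! this
  have hc' : Continuous (fun v : F ↦ (trivializationAt F V x₀).symm x v) := by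
    have := ((trivializationAt F V x₀).continuousLinearEquivAt ℝ x hb).symm.continuous
    simpa using! this
  have hi : Continuous (fun v : Subbundle hS x ↦ incl hS x v) := continuous_subtype_val
  have h1 : Continuous (fun v : Subbundle hS x ↦ pretriv hS d ⟨x, v⟩) :=
    continuous_const.prodMk ((d.p x).continuous.comp (hc.comp hi))
  have h2 : Continuous (fun y : M × EuclideanSpace ℝ (Fin r) ↦
      (⟨(trivializationAt F V x₀).symm x (d.q x y.2), d.symm_q_mem x hx y.2⟩ : S x)) :=
    Continuous.subtype_mk (hc'.comp ((d.q x).continuous.comp continuous_snd)) _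
  refine Topology.IsInducing.of_comp h1 h2 ?_
  have h3 : ((fun y : M × EuclideanSpace ℝ (Fin r) ↦
      (⟨(trivializationAt F V x₀).symm x (d.q x y.2), d.symm_q_mem x hx y.2⟩ : S x)) ∘
      (fun v : Subbundle hS x ↦ pretriv hS d ⟨x, v⟩)) = fun v : Subbundle hS x ↦ (v : S x) := by
    funext v
    apply Subtype.ext
    change (trivializationAt F V x₀).symm x
      (d.q x (d.p x (trivializationAt F V x₀ ⟨x, incl hS x v⟩).2)) = incl hS x v
    rw [d.q_p x hx _ (incl_mem hS x v)]
    exact (trivializationAt F V x₀).symm_apply_apply_mk hb _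
  rw [h3]
  exact Topology.IsInducing.id

variable [ContMDiffVectorBundle ∞ F V I]

/-- The vector bundle structure of a smooth subbundle, with the topology and the smooth structure
for which the smooth local frames are local trivializations. -/
noncomputable def prebundle : VectorPrebundle ℝ (EuclideanSpace ℝ (Fin r)) (Subbundle hS) where
  pretrivializationAtlas := {e | ∃ (x₀ : M) (d : Straightening I F S r x₀), e = pretriv hS d}
  pretrivialization_linear' := by
    rintro _ ⟨x₀, d, rfl⟩
    refine ⟨fun x (hx : x ∈ d.U) ↦ ?_⟩
    have h := (trivializationAt F V x₀).linear ℝ (d.subset hx)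
    refine ⟨fun v w ↦ ?_, fun c v ↦ ?_⟩
    · change d.p x _ = d.p x _ + d.p x _
      rw [← map_add]
      exact congrArg (d.p x) (h.1 v.1 w.1)
    · change d.p x _ = c • d.p x _
      rw [← map_smul]
      exact congrArg (d.p x) (h.2 c v.1)
  pretrivializationAt x := pretriv hS (hS x).some
  mem_base_pretrivializationAt x := (hS x).some.mem
  pretrivialization_mem_atlas x := ⟨x, _, rfl⟩
  exists_coordChange := by
    rintro _ ⟨x₀, d, rfl⟩ _ ⟨x₁, d', rfl⟩
    exact ⟨_, (contMDiffOn_coordChange d d').continuousOn, fun x hx k ↦ coordChange hS d d' hx k⟩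
  totalSpaceMk_isInducing x := isInducing_pretriv hS _ (hS x).some.mem

instance : (prebundle hS).IsContMDiff I ∞ where
  exists_contMDiffCoordChange := by
    rintro _ ⟨x₀, d, rfl⟩ _ ⟨x₁, d', rfl⟩
    exact ⟨_, contMDiffOn_coordChange d d', fun x hx k ↦ coordChange hS d d' hx k⟩

noncomputable instance : TopologicalSpace (TotalSpace (EuclideanSpace ℝ (Fin r)) (Subbundle hS)) :=
  (prebundle hS).totalSpaceTopology
noncomputable instance : FiberBundle (EuclideanSpace ℝ (Fin r)) (Subbundle hS) :=
  (prebundle hS).toFiberBundle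
instance : VectorBundle ℝ (EuclideanSpace ℝ (Fin r)) (Subbundle hS) :=
  (prebundle hS).toVectorBundle
instance : ContMDiffVectorBundle ∞ (EuclideanSpace ℝ (Fin r)) (Subbundle hS) I :=
  (prebundle hS).contMDiffVectorBundle I

section Kernel

variable {G : Type*} [NormedAddCommGroup G] [NormedSpace ℝ G]
  [FiniteDimensional ℝ F] [FiniteDimensional ℝ G]

/-- A family of subspaces of constant dimension which is locally the kernel of a smooth family of
linear maps has smooth local frames. -/
theorem nonempty_straightening {x₀ : M} (hr : ∀ x, Module.finrank ℝ (S x) = r)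
    (L : M → F →L[ℝ] G) {W : Set M} (hW : IsOpen W) (hx₀ : x₀ ∈ W)
    (hWe : W ⊆ (trivializationAt F V x₀).baseSet)
    (hL : ContMDiffOn I 𝓘(ℝ, F →L[ℝ] G) ∞ L W)
    (hS : ∀ x ∈ W, ∀ v : V x, v ∈ S x ↔ L x (trivializationAt F V x₀ ⟨x, v⟩).2 = 0) :
    Nonempty (Straightening I F S r x₀) := by
  set e := trivializationAt F V x₀ with he
  have hxe : x₀ ∈ e.baseSet := mem_baseSet_trivializationAt F V x₀
  -- the subspace corresponds to the kernel of `L x` in the trivialization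
  have hfin : ∀ x ∈ e.baseSet, (∀ v : V x, v ∈ S x ↔ L x (e ⟨x, v⟩).2 = 0) →
      Module.finrank ℝ (L x).ker = r := by
    intro x hx h
    rw [← hr x]
    have h1 : (S x).map ((e.continuousLinearEquivAt ℝ x hx).toLinearEquiv : V x →ₗ[ℝ] F) =
        (L x).ker := by
      ext w
      simp only [Submodule.mem_map, LinearMap.mem_ker]
      constructor
      · rintro ⟨v, hv, rfl⟩
        exact (h v).1 hv
      · intro hw
        refine ⟨(e.continuousLinearEquivAt ℝ x hx).symm w, (h _).2 ?_, ?_⟩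
        · change L x ((e.continuousLinearEquivAt ℝ x hx) ((e.continuousLinearEquivAt ℝ x hx).symm w)) = 0
          rw [ContinuousLinearEquiv.apply_symm_apply]; exact hw
        · exact (e.continuousLinearEquivAt ℝ x hx).apply_symm_apply w
    rw [← h1]
    exact LinearEquiv.finrank_map_eq _ _
  have hk0 := hfin x₀ hxe (hS x₀ hx₀)
  let φ : (L x₀).ker ≃ₗ[ℝ] EuclideanSpace ℝ (Fin r) :=
    LinearEquiv.ofFinrankEq _ _ (by simp [hk0])
  obtain ⟨P, hP⟩ := (L x₀).ker.subtype.exists_leftInverse_of_injective (Submodule.ker_subtype _)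
  obtain ⟨Q, hQ⟩ := (L x₀).range.subtype.exists_leftInverse_of_injective (Submodule.ker_subtype _)
  have hPa (v : F) (hv : L x₀ v = 0) : P v = (⟨v, hv⟩ : (L x₀).ker) :=
    LinearMap.congr_fun hP (⟨v, hv⟩ : (L x₀).ker)
  have hQa (v : F) : Q (L x₀ v) = (⟨L x₀ v, v, rfl⟩ : (L x₀).range) :=
    LinearMap.congr_fun hQ (⟨L x₀ v, v, rfl⟩ : (L x₀).range)
  let R := (L x₀).range
  let p : F →L[ℝ] EuclideanSpace ℝ (Fin r) := LinearMap.toContinuousLinearMap (φ.toLinearMap ∘ₗ P)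
  let Qc : G →L[ℝ] R := LinearMap.toContinuousLinearMap Q
  let T : M → F →L[ℝ] (EuclideanSpace ℝ (Fin r) × R) := fun x ↦ p.prod (Qc.comp (L x))
  have hTa (x : M) (v : F) : T x v = (p v, Q (L x v)) := rfl
  have hpa (v : F) : p v = φ (P v) := rfl
  have hT : ContMDiffOn I 𝓘(ℝ, F →L[ℝ] (EuclideanSpace ℝ (Fin r) × R)) ∞ T W := by
    have h1 : ContMDiffOn I 𝓘(ℝ, F →L[ℝ] R) ∞ (fun x ↦ Qc.comp (L x)) W :=
      contMDiffOn_const.clm_comp hL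
    have h1' : ContMDiffOn I 𝓘(ℝ, F →L[ℝ] (EuclideanSpace ℝ (Fin r) × R)) ∞
        (fun x ↦ (ContinuousLinearMap.inr ℝ (EuclideanSpace ℝ (Fin r)) R).comp
          (Qc.comp (L x))) W := contMDiffOn_const.clm_comp h1
    have h2 : ContMDiffOn I 𝓘(ℝ, F →L[ℝ] (EuclideanSpace ℝ (Fin r) × R)) ∞
        (fun x ↦ (ContinuousLinearMap.inl ℝ (EuclideanSpace ℝ (Fin r)) R).comp p +
          (ContinuousLinearMap.inr ℝ (EuclideanSpace ℝ (Fin r)) R).comp (Qc.comp (L x))) W :=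
      ContMDiffOn.add contMDiffOn_const h1'
    refine h2.congr fun x hx ↦ ?_
    ext v <;> simp [T]
  have hinj : Function.Injective (T x₀) := by
    refine (injective_iff_map_eq_zero (T x₀)).2 fun v hv ↦ ?_
    rw [hTa, Prod.mk_eq_zero] at hv
    obtain ⟨hv1, hv2⟩ := hv
    rw [hpa] at hv1
    have h2 : Q (L x₀ v) = (⟨L x₀ v, v, rfl⟩ : R) := hQa v
    have h3 : L x₀ v = 0 := by
      rw [h2] at hv2
      exact congrArg Subtype.val hv2
    have h4 : P v = (⟨v, h3⟩ : (L x₀).ker) := hPa v h3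
    have h5 : P v = 0 := (LinearEquiv.map_eq_zero_iff φ).1 hv1
    rw [h4] at h5
    exact congrArg Subtype.val h5
  have hrn (x : M) : Module.finrank ℝ (L x).range + Module.finrank ℝ (L x).ker =
      Module.finrank ℝ F := LinearMap.finrank_range_add_finrank_ker (L x : F →ₗ[ℝ] G)
  have hdim : Module.finrank ℝ F = Module.finrank ℝ (EuclideanSpace ℝ (Fin r) × R) := by
    rw [Module.finrank_prod, finrank_euclideanSpace, Fintype.card_fin, ← hrn x₀, hk0, add_comm]
  let T₀ : F ≃L[ℝ] (EuclideanSpace ℝ (Fin r) × R) :=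
    (LinearEquiv.ofInjectiveOfFinrankEq (T x₀ : F →ₗ[ℝ] _) hinj hdim).toContinuousLinearEquiv
  have hT₀ : (T₀ : F →L[ℝ] (EuclideanSpace ℝ (Fin r) × R)) = T x₀ :=
    ContinuousLinearMap.ext fun _ ↦ rfl
  let U : Set M := W ∩ T ⁻¹' Set.range
    ((↑) : (F ≃L[ℝ] (EuclideanSpace ℝ (Fin r) × R)) → F →L[ℝ] (EuclideanSpace ℝ (Fin r) × R))
  let q : M → EuclideanSpace ℝ (Fin r) →L[ℝ] F := fun x ↦
    (ContinuousLinearMap.inverse (T x)).comp (ContinuousLinearMap.inl ℝ _ R)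
  have hTq : ∀ x ∈ U, ∀ k, T x (q x k) = (k, 0) := by
    rintro x ⟨-, A, hA⟩ k
    simp only [q, ← hA, ContinuousLinearMap.inverse_equiv]
    simp
  have hqT : ∀ x ∈ U, ∀ v, (T x v).2 = 0 → q x (p v) = v := by
    rintro x ⟨-, A, hA⟩ v hv
    have h1 : A v = (p v, 0) := by
      change (A : F →L[ℝ] (EuclideanSpace ℝ (Fin r) × R)) v = _
      rw [hA]
      exact Prod.ext rfl hv
    simp only [q, ← hA, ContinuousLinearMap.inverse_equiv]
    change A.symm (p v, 0) = v
    rw [← h1]; simp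
  have hLq : ∀ x ∈ U, ∀ k, L x (q x k) = 0 := by
    intro x hx k
    have hle : (L x).ker ≤ (q x).range := by
      intro v hv
      exact ⟨p v, hqT x hx v (by simp [T, show L x v = 0 from hv])⟩
    have hqr : Module.finrank ℝ (q x).range ≤ r :=
      (LinearMap.finrank_range_le (q x : EuclideanSpace ℝ (Fin r) →ₗ[ℝ] F)).trans (by simp)
    have heq := Submodule.eq_of_le_of_finrank_le hle
      (hqr.trans (hfin x (hWe hx.1) (hS x hx.1)).ge)
    have : q x k ∈ (L x).ker := heq ▸ ⟨k, rfl⟩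
    exact this
  exact ⟨{
    U := U
    p := fun _ ↦ p
    q := q
    isOpen := hT.continuousOn.isOpen_inter_preimage hW ContinuousLinearEquiv.isOpen
    mem := ⟨hx₀, T₀, hT₀⟩
    subset := fun x hx ↦ hWe hx.1
    contMDiffOn_p := contMDiffOn_const
    contMDiffOn_q := by
      rintro x ⟨hx, A, hA⟩
      have h1 : ContDiffAt ℝ ∞ (ContinuousLinearMap.inverse :
          (F →L[ℝ] (EuclideanSpace ℝ (Fin r) × R)) → _) (T x) := by
        rw [← hA]; exact contDiffAt_map_inverse A
      have h2 : ContMDiffWithinAt I 𝓘(ℝ, (EuclideanSpace ℝ (Fin r) × R) →L[ℝ] F) ∞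
          (fun y ↦ ContinuousLinearMap.inverse (T y)) U x :=
        ContMDiffAt.comp_contMDiffWithinAt x h1.contMDiffAt
          ((hT x hx).mono Set.inter_subset_left)
      exact h2.clm_comp contMDiffWithinAt_const
    p_q := fun x hx k ↦ congrArg Prod.fst (hTq x hx k)
    symm_q_mem := fun x hx k ↦ by
      rw [hS x hx.1, e.apply_mk_symm (hWe hx.1)]
      exact hLq x hx k
    q_p := fun x hx v hv ↦ hqT x hx _ ((congrArg Q ((hS x hx.1 v).1 hv)).trans (map_zero Q)) }⟩

end Kernel

end Subbundle

end Subbundle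

section LieAlgebroids

variable {E : Type*} [NormedAddCommGroup E] [NormedSpace ℝ E]
  {H : Type*} [TopologicalSpace H] (I : ModelWithCorners ℝ E H)
  {M : Type*} [TopologicalSpace M] [ChartedSpace H M] [IsManifold I ∞ M]
  (F : Type*) [NormedAddCommGroup F] [NormedSpace ℝ F]
  (V : M → Type*) [TopologicalSpace (TotalSpace F V)] [∀ x, AddCommGroup (V x)]
  [∀ x, Module ℝ (V x)] [∀ x, TopologicalSpace (V x)] [FiberBundle F V] [VectorBundle ℝ F V]
  {E' : Type*} [NormedAddCommGroup E'] [NormedSpace ℝ E']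
  {H' : Type*} [TopologicalSpace H'] (I' : ModelWithCorners ℝ E' H')
  {N : Type*} [TopologicalSpace N] [ChartedSpace H' N] [IsManifold I' ∞ N]
  (G : Type*) [NormedAddCommGroup G] [NormedSpace ℝ G]
  (W : N → Type*) [TopologicalSpace (TotalSpace G W)] [∀ x, AddCommGroup (W x)]
  [∀ x, Module ℝ (W x)] [∀ x, TopologicalSpace (W x)] [FiberBundle G W] [VectorBundle ℝ G W]

/-- The fibres of a pulled back vector bundle are additive groups. -/
instance pullbackAddCommGroup {B B' : Type*} (f : B' → B) (X : B → Type*)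
    [∀ x, AddCommGroup (X x)] (x : B') : AddCommGroup ((f *ᵖ X) x) :=
  inferInstanceAs (AddCommGroup (X (f x)))

variable {I F V} in
/-- The product `g • s` of a smooth function and a smooth section. -/
noncomputable def smulSection (g : C^∞⟮I, M; 𝓘(ℝ, ℝ), ℝ⟯) (s : Cₛ^∞⟮I; F, V⟯) :
    Cₛ^∞⟮I; F, V⟯ :=
  ⟨fun x ↦ g x • s x, g.contMDiff.smul_section s.contMDiff⟩

/-- A Lie algebroid structure on the smooth real vector bundle `V → M` with fibre model `F`:
an anchor `V → TM` and a real Lie bracket on the space of smooth sections satisfying the Leibniz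
rule. -/
structure LieAlgebroid where
  anchor : ∀ x, V x →ₗ[ℝ] TangentSpace I x
  contMDiff_anchor : ContMDiff (I.prod 𝓘(ℝ, F)) I.tangent ∞
    (fun v : TotalSpace F V ↦ (⟨v.proj, anchor v.proj v.2⟩ : TangentBundle I M))
  bracket : Cₛ^∞⟮I; F, V⟯ →ₗ[ℝ] Cₛ^∞⟮I; F, V⟯ →ₗ[ℝ] Cₛ^∞⟮I; F, V⟯
  bracket_self : ∀ a, bracket a a = 0
  jacobi : ∀ a b c,
    bracket a (bracket b c) + bracket b (bracket c a) + bracket c (bracket a b) = 0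
  leibniz : ∀ (a b : Cₛ^∞⟮I; F, V⟯) (g : C^∞⟮I, M; 𝓘(ℝ, ℝ), ℝ⟯) (x : M),
    bracket a (smulSection g b) x = g x • bracket a b x + mvfderiv I g x (anchor x (a x)) • b x

namespace LieAlgebroid

/-- The Lie bracket of smooth vector fields as a bilinear map. -/
noncomputable def tangentBracket (M : Type*) [TopologicalSpace M] [ChartedSpace H M]
    [IsManifold I ∞ M] [CompleteSpace E] :
    Cₛ^∞⟮I; E, (TangentSpace I : M → Type _)⟯ →ₗ[ℝ]
      Cₛ^∞⟮I; E, (TangentSpace I : M → Type _)⟯ →ₗ[ℝ]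
        Cₛ^∞⟮I; E, (TangentSpace I : M → Type _)⟯ :=
  have : IsManifold I (minSmoothness ℝ 2) M := by
    simpa using (inferInstance : IsManifold I 2 M)
  LinearMap.mk₂ ℝ
    (fun a b ↦ ⟨VectorField.mlieBracket I a b, fun x ↦
      have : IsManifold I (((⊤ : ℕ∞) : ℕ∞ω) + 1) M := ‹IsManifold I ∞ M›
      ContMDiffAt.mlieBracket_vectorField (m := ⊤) (n := ⊤) (a.contMDiff x) (b.contMDiff x)
        (by simp)⟩)
    (fun a a' b ↦ ContMDiffSection.ext fun x ↦
      VectorField.mlieBracket_add_left a.mdifferentiableAt a'.mdifferentiableAt)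
    (fun c a b ↦ ContMDiffSection.ext fun x ↦
      VectorField.mlieBracket_const_smul_left a.mdifferentiableAt)
    (fun a b b' ↦ ContMDiffSection.ext fun x ↦
      VectorField.mlieBracket_add_right b.mdifferentiableAt b'.mdifferentiableAt)
    (fun c a b ↦ ContMDiffSection.ext fun x ↦
      VectorField.mlieBracket_const_smul_right b.mdifferentiableAt)

/-- The tangent Lie algebroid `TM`: the anchor is the identity and the bracket is the Lie bracket
of vector fields. -/
noncomputable def tangent (M : Type*) [TopologicalSpace M] [ChartedSpace H M] [IsManifold I ∞ M]
    [CompleteSpace E] : LieAlgebroid I E (TangentSpace I : M → Type _) where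
  anchor _ := LinearMap.id
  contMDiff_anchor := contMDiff_id
  bracket := tangentBracket I M
  bracket_self a := ContMDiffSection.ext fun x ↦ by
    change VectorField.mlieBracket I a a x = 0
    simp
  jacobi a b c := by
    have : IsManifold I (minSmoothness ℝ 3) M := by
      simpa using (inferInstance : IsManifold I 3 M)
    have h (s : Cₛ^∞⟮I; E, (TangentSpace I : M → Type _)⟯) (x : M) :
        ContMDiffAt I I.tangent (minSmoothness ℝ 2)
          (fun x ↦ (⟨x, s x⟩ : TangentBundle I M)) x :=
      (s.contMDiff x).of_le (by simpa using ENat.LEInfty.out)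
    have hswap (s t : Cₛ^∞⟮I; E, (TangentSpace I : M → Type _)⟯) :
        tangentBracket I M s t = -tangentBracket I M t s :=
      ContMDiffSection.ext fun x ↦ VectorField.mlieBracket_swap_apply
    have h1 : tangentBracket I M a (tangentBracket I M b c) =
        tangentBracket I M (tangentBracket I M a b) c +
          tangentBracket I M b (tangentBracket I M a c) :=
      ContMDiffSection.ext fun x ↦
        VectorField.leibniz_identity_mlieBracket_apply (h a x) (h b x) (h c x)
    rw [h1, hswap c a, hswap c (tangentBracket I M a b), map_neg]
    abel
  leibniz a b g x := by
    have hg : MDifferentiableAt I 𝓘(ℝ, ℝ) g x := g.contMDiff.mdifferentiable (by simp) x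
    refine (VectorField.mlieBracket_smul_right (V := a) hg (b.mdifferentiableAt (x := x))).trans ?_
    exact add_comm _ _

/-! ### Products -/

/-- The product vector bundle `V × W → M × N` with fibres `V m × W n`: the Whitney sum of the
pullbacks of `V` and `W` along the two projections. -/
abbrev ProdBundle (p : M × N) : Type _ :=
  (((ContMDiffMap.fst : C^∞⟮I.prod I', M × N; I, M⟯) : M × N → M) *ᵖ V) p ×
    (((ContMDiffMap.snd : C^∞⟮I.prod I', M × N; I', N⟯) : M × N → N) *ᵖ W) p

variable {I F V I' G W}

/-- The section `(m, n) ↦ (a m, b n)` of `V × W`, for sections `a` of `V` and `b` of `W`. -/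
noncomputable def prodSection (a : Cₛ^∞⟮I; F, V⟯) (b : Cₛ^∞⟮I'; G, W⟯) :
    Cₛ^∞⟮I.prod I'; F × G, ProdBundle I V I' W⟯ :=
  ⟨fun p ↦ (a p.1, b p.2), fun p ↦ by
    rw [contMDiffAt_section]
    have h1 : ContMDiffAt I 𝓘(ℝ, F) ∞ (fun x ↦ (trivializationAt F V p.1 ⟨x, a x⟩).2) p.1 :=
      (contMDiffAt_section p.1).1 (a.contMDiff p.1)
    have h2 : ContMDiffAt I' 𝓘(ℝ, G) ∞ (fun x ↦ (trivializationAt G W p.2 ⟨x, b x⟩).2) p.2 :=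
      (contMDiffAt_section p.2).1 (b.contMDiff p.2)
    exact (h1.comp p contMDiffAt_fst).prodMk_space (h2.comp p contMDiffAt_snd)⟩

/-- `P` is the direct product Lie algebroid structure of `A` and `B` on `V × W → M × N`: the
anchor is the product of the anchors, and the bracket extends those of `A` and `B` on pulled back
sections, sections pulled back from different factors commuting. -/
structure IsProduct (A : LieAlgebroid I F V) (B : LieAlgebroid I' G W)
    (P : LieAlgebroid (I.prod I') (F × G) (ProdBundle I V I' W)) : Prop where
  anchor : ∀ (p : M × N) (v : V p.1) (w : W p.2),
    P.anchor p (v, w) = (A.anchor p.1 v, B.anchor p.2 w)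
  bracket_left : ∀ a a' : Cₛ^∞⟮I; F, V⟯,
    P.bracket (prodSection a (0 : Cₛ^∞⟮I'; G, W⟯)) (prodSection a' 0) =
      prodSection (A.bracket a a') 0
  bracket_right : ∀ b b' : Cₛ^∞⟮I'; G, W⟯,
    P.bracket (prodSection (0 : Cₛ^∞⟮I; F, V⟯) b) (prodSection 0 b') =
      prodSection 0 (B.bracket b b')
  bracket_mixed : ∀ (a : Cₛ^∞⟮I; F, V⟯) (b : Cₛ^∞⟮I'; G, W⟯),
    P.bracket (prodSection a 0) (prodSection 0 b) = 0

/-! ### Morphisms -/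

/-- Near `x`, the section `s` of the pulled back bundle `φ^! W` has the form `∑ᵢ hᵢ • φ^! bᵢ`, for
smooth functions `hᵢ` on `M` and smooth sections `bᵢ` of `W`. -/
def IsLocalExpansion (φ : M → N) (s : ∀ x, W (φ x)) (x : M) {k : ℕ}
    (h : Fin k → C^∞⟮I, M; 𝓘(ℝ, ℝ), ℝ⟯) (b : Fin k → Cₛ^∞⟮I'; G, W⟯) : Prop :=
  ∀ᶠ x' in 𝓝 x, s x' = ∑ i, h i x' • b i (φ x')

/-- The value at `x` of
`∑ᵢⱼ hᵢ gⱼ • φ^![bᵢ, cⱼ] + ∑ⱼ X(gⱼ) • φ^! cⱼ - ∑ᵢ Y(hᵢ) • φ^! bᵢ`, where `X` and `Y` are tangent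
vectors at `x`. -/
noncomputable def expandedBracket (B : LieAlgebroid I' G W) (φ : M → N) {x : M}
    (X Y : TangentSpace I x) {k l : ℕ}
    (h : Fin k → C^∞⟮I, M; 𝓘(ℝ, ℝ), ℝ⟯) (b : Fin k → Cₛ^∞⟮I'; G, W⟯)
    (g : Fin l → C^∞⟮I, M; 𝓘(ℝ, ℝ), ℝ⟯) (c : Fin l → Cₛ^∞⟮I'; G, W⟯) : W (φ x) :=
  ∑ i, ∑ j, (h i x * g j x) • B.bracket (b i) (c j) (φ x) +
    ∑ j, mvfderiv I (g j) x X • c j (φ x) - ∑ i, mvfderiv I (h i) x Y • b i (φ x)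

/-- Lie algebroid morphisms `(Φ, φ) : A → B` over different bases. -/
structure IsMorphism (A : LieAlgebroid I F V) (B : LieAlgebroid I' G W) (φ : M → N)
    (Φ : ∀ x, V x →ₗ[ℝ] W (φ x)) : Prop where
  contMDiff_base : ContMDiff I I' ∞ φ
  contMDiff : ContMDiff (I.prod 𝓘(ℝ, F)) (I'.prod 𝓘(ℝ, G)) ∞
    (fun v : TotalSpace F V ↦ (⟨φ v.proj, Φ v.proj v.2⟩ : TotalSpace G W))
  anchor : ∀ x (v : V x), B.anchor (φ x) (Φ x v) = mfderiv I I' φ x (A.anchor x v)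
  bracket : ∀ (a₁ a₂ : Cₛ^∞⟮I; F, V⟯) (x : M) {k l : ℕ}
    (h : Fin k → C^∞⟮I, M; 𝓘(ℝ, ℝ), ℝ⟯) (b : Fin k → Cₛ^∞⟮I'; G, W⟯)
    (g : Fin l → C^∞⟮I, M; 𝓘(ℝ, ℝ), ℝ⟯) (c : Fin l → Cₛ^∞⟮I'; G, W⟯),
    IsLocalExpansion φ (fun x ↦ Φ x (a₁ x)) x h b →
    IsLocalExpansion φ (fun x ↦ Φ x (a₂ x)) x g c →
    Φ x (A.bracket a₁ a₂ x) =
      expandedBracket B φ (A.anchor x (a₁ x)) (A.anchor x (a₂ x)) h b g c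

variable {V' : M → Type*} {F' : Type*} [NormedAddCommGroup F'] [NormedSpace ℝ F']
  [TopologicalSpace (TotalSpace F' V')] [∀ x, AddCommGroup (V' x)]
  [∀ x, Module ℝ (V' x)] [∀ x, TopologicalSpace (V' x)] [FiberBundle F' V'] [VectorBundle ℝ F' V']

/-- The image of a smooth section under a smooth vector bundle morphism over the identity. -/
noncomputable def mapSection (Φ : ∀ x, V x →ₗ[ℝ] V' x)
    (hΦ : ContMDiff (I.prod 𝓘(ℝ, F)) (I.prod 𝓘(ℝ, F')) ∞
      (fun v : TotalSpace F V ↦ (⟨v.proj, Φ v.proj v.2⟩ : TotalSpace F' V')))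
    (a : Cₛ^∞⟮I; F, V⟯) : Cₛ^∞⟮I; F', V'⟯ :=
  ⟨fun x ↦ Φ x (a x), hΦ.comp a.contMDiff⟩

/-- The fibrewise linear isomorphisms `Θ x : V x ≃ V' x` form an isomorphism of Lie algebroids
`A → A'` over the identity of `M`. -/
structure IsIso (A : LieAlgebroid I F V) (A' : LieAlgebroid I F' V')
    (Θ : ∀ x, V x ≃ₗ[ℝ] V' x) : Prop where
  contMDiff : ContMDiff (I.prod 𝓘(ℝ, F)) (I.prod 𝓘(ℝ, F')) ∞
    (fun v : TotalSpace F V ↦ (⟨v.proj, (Θ v.proj : V v.proj →ₗ[ℝ] V' v.proj) v.2⟩ :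
      TotalSpace F' V'))
  contMDiff_symm : ContMDiff (I.prod 𝓘(ℝ, F')) (I.prod 𝓘(ℝ, F)) ∞
    (fun v : TotalSpace F' V' ↦ (⟨v.proj, (Θ v.proj).symm v.2⟩ : TotalSpace F V))
  anchor : ∀ x (v : V x), A'.anchor x (Θ x v) = A.anchor x v
  bracket : ∀ a₁ a₂ : Cₛ^∞⟮I; F, V⟯,
    mapSection (fun x ↦ (Θ x : V x →ₗ[ℝ] V' x)) contMDiff (A.bracket a₁ a₂) =
      A'.bracket (mapSection (fun x ↦ (Θ x : V x →ₗ[ℝ] V' x)) contMDiff a₁)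
        (mapSection (fun x ↦ (Θ x : V x →ₗ[ℝ] V' x)) contMDiff a₂)

/-! ### Pullbacks -/

/-- The fibre at `x` of `f^{!!}B = TM ×_{TN} B`, as a subspace of `T_x M × B_{f x}`. -/
noncomputable def pullbackSubmodule (B : LieAlgebroid I' G W) (f : C^∞⟮I, M; I', N⟯) (x : M) :
    Submodule ℝ (TangentSpace I x × ((f : M → N) *ᵖ W) x) :=
  { carrier := {v | mfderiv I I' f x v.1 = B.anchor (f x) v.2}
    add_mem' := fun {v w} hv hw ↦ by
      have h : B.anchor (f x) (v + w).2 = B.anchor (f x) v.2 + B.anchor (f x) w.2 :=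
        (B.anchor (f x)).map_add _ _
      rw [Set.mem_ofPred_eq, h, ← hv, ← hw]
      exact map_add _ _ _
    zero_mem' := (map_zero (mfderiv I I' f x)).trans (map_zero (B.anchor (f x))).symm
    smul_mem' := fun t v hv ↦ by
      have h : B.anchor (f x) (t • v).2 = t • B.anchor (f x) v.2 :=
        (B.anchor (f x)).map_smul _ _
      rw [Set.mem_ofPred_eq, h, ← hv]
      exact map_smul (mfderiv I I' f x) _ _ }

/-- The pullback of `B` under `f` exists, with rank `r`: the family of vector spaces `f^{!!}B` has
constant rank `r`. -/
def PullbackExists (B : LieAlgebroid I' G W) (f : C^∞⟮I, M; I', N⟯) (r : ℕ) : Prop :=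
  ∀ x, Module.finrank ℝ (B.pullbackSubmodule f x) = r

/-- The local expression of a fibrewise linear map in two trivializations. -/
noncomputable def coordMap [FiniteDimensional ℝ F] {φ : M → N} (Φ : ∀ x, V x →ₗ[ℝ] W (φ x))
    (x₀ : M) (y₀ : N) (x : M) : F →L[ℝ] G :=
  LinearMap.toContinuousLinearMap
    ((trivializationAt G W y₀).linearMapAt ℝ (φ x) ∘ₗ Φ x ∘ₗ (trivializationAt F V x₀).symmₗ ℝ x)

theorem coordMap_apply [FiniteDimensional ℝ F] {φ : M → N} (Φ : ∀ x, V x →ₗ[ℝ] W (φ x))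
    (x₀ : M) (y₀ : N) {x : M} (hx : x ∈ (trivializationAt F V x₀).baseSet)
    (hy : φ x ∈ (trivializationAt G W y₀).baseSet) (v : F) :
    coordMap (F := F) (G := G) Φ x₀ y₀ x v =
      (trivializationAt G W y₀ ⟨φ x, Φ x ((trivializationAt F V x₀).symm x v)⟩).2 := by
  simp only [coordMap, LinearMap.coe_toContinuousLinearMap', LinearMap.comp_apply,
    Trivialization.coe_linearMapAt_of_mem _ hy]
  rw [Trivialization.symmₗ_apply _ hx]

theorem coordMap_apply_mk [FiniteDimensional ℝ F] {φ : M → N} (Φ : ∀ x, V x →ₗ[ℝ] W (φ x))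
    (x₀ : M) (y₀ : N) {x : M} (hx : x ∈ (trivializationAt F V x₀).baseSet)
    (hy : φ x ∈ (trivializationAt G W y₀).baseSet) (v : V x) :
    coordMap (F := F) (G := G) Φ x₀ y₀ x (trivializationAt F V x₀ ⟨x, v⟩).2 =
      (trivializationAt G W y₀ ⟨φ x, Φ x v⟩).2 := by
  rw [coordMap_apply Φ x₀ y₀ hx hy, Trivialization.symm_apply_apply_mk _ hx]

theorem contMDiffOn_coordMap [FiniteDimensional ℝ F] [ContMDiffVectorBundle ∞ F V I]
    [ContMDiffVectorBundle ∞ G W I'] {φ : M → N} {Φ : ∀ x, V x →ₗ[ℝ] W (φ x)}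
    (hΦ : ContMDiff (I.prod 𝓘(ℝ, F)) (I'.prod 𝓘(ℝ, G)) ∞
      (fun v : TotalSpace F V ↦ (⟨φ v.proj, Φ v.proj v.2⟩ : TotalSpace G W))) (x₀ : M) (y₀ : N) :
    ContMDiffOn I 𝓘(ℝ, F →L[ℝ] G) ∞ (coordMap (F := F) (G := G) Φ x₀ y₀)
      ((trivializationAt F V x₀).baseSet ∩ φ ⁻¹' (trivializationAt G W y₀).baseSet) := by
  set e := trivializationAt F V x₀
  set e' := trivializationAt G W y₀
  -- pointwise smoothness
  have h1 (v : F) : ContMDiffOn I 𝓘(ℝ, G) ∞ (fun x ↦ coordMap (F := F) (G := G) Φ x₀ y₀ x v)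
      (e.baseSet ∩ φ ⁻¹' e'.baseSet) := by
    have hs : ContMDiffOn I (I.prod 𝓘(ℝ, F)) ∞
        (fun x ↦ e.toOpenPartialHomeomorph.symm (x, v)) e.baseSet :=
      e.contMDiffOn_symm.comp (contMDiffOn_id.prodMk contMDiffOn_const)
        (fun x hx ↦ e.mem_target.2 hx)
    have hs' := (hΦ.comp_contMDiffOn hs).mono
      (Set.inter_subset_left (s := e.baseSet) (t := φ ⁻¹' e'.baseSet))
    have hp (x : M) (hx : x ∈ e.baseSet) :
        e.toOpenPartialHomeomorph.symm (x, v) = ⟨x, e.symm x v⟩ := (e.mk_symm hx v).symm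
    have hs'' := ((e'.contMDiffOn_iff (IB := I') (n := ∞) (by
      intro x hx
      rw [e'.mem_source]
      simp only [Function.comp, hp x hx.1]
      exact hx.2)).1 hs').2
    refine hs''.congr fun x hx ↦ ?_
    rw [coordMap_apply Φ x₀ y₀ hx.1 hx.2]
    exact (congrArg (fun z : TotalSpace F V ↦ (e' ⟨φ z.proj, Φ z.proj z.2⟩).2) (hp x hx.1)).symm
  let d := Module.finrank ℝ F
  let e₁ : F ≃L[ℝ] (Fin d → ℝ) := ContinuousLinearEquiv.ofFinrankEq (by simp [d])
  let e₂ : (F →L[ℝ] G) ≃L[ℝ] (Fin d → G) :=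
    (e₁.arrowCongr (1 : G ≃L[ℝ] G)).trans (ContinuousLinearEquiv.piRing (Fin d))
  have h2 : ContMDiffOn I 𝓘(ℝ, Fin d → G) ∞ (fun x ↦ e₂ (coordMap (F := F) (G := G) Φ x₀ y₀ x))
      (e.baseSet ∩ φ ⁻¹' e'.baseSet) := by
    rw [contMDiffOn_pi_space]
    intro i
    exact h1 _
  refine (e₂.symm.contDiff.contMDiff.comp_contMDiffOn h2).congr fun x hx ↦ ?_
  simp

theorem isSmoothSubbundle_pullback [FiniteDimensional ℝ E] [FiniteDimensional ℝ E']
    [FiniteDimensional ℝ G] [ContMDiffVectorBundle ∞ G W I'] (B : LieAlgebroid I' G W)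
    (f : C^∞⟮I, M; I', N⟯) {r : ℕ} (h : B.PullbackExists f r) :
    IsSmoothSubbundle I (E × G) (B.pullbackSubmodule f) r := by
  intro x₀
  have hf : ContMDiff I.tangent I'.tangent ∞ (fun v : TangentBundle I M ↦
      (⟨f v.proj, (mfderiv I I' f v.proj : TangentSpace I v.proj →ₗ[ℝ] _) v.2⟩ :
        TangentBundle I' N)) := f.contMDiff.contMDiff_tangentMap le_rfl
  let Φ₁ (x : M) : TangentSpace I x →ₗ[ℝ] TangentSpace I' (f x) := mfderiv I I' f x
  let Φ₂ (y : N) : W y →ₗ[ℝ] TangentSpace I' y := B.anchor y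
  have h1 := contMDiffOn_coordMap (Φ := Φ₁) hf x₀ (f x₀)
  have h2 := contMDiffOn_coordMap (Φ := Φ₂) B.contMDiff_anchor (f x₀) (f x₀)
  let e₁ := trivializationAt E (TangentSpace I : M → Type _) x₀
  let e₂ := trivializationAt G W (f x₀)
  let e₃ := trivializationAt E' (TangentSpace I' : N → Type _) (f x₀)
  let C₁ : M → E →L[ℝ] E' := coordMap (F := E) (G := E') Φ₁ x₀ (f x₀)
  let C₂ : N → G →L[ℝ] E' := coordMap (F := G) (G := E') Φ₂ (f x₀) (f x₀)
  let U : Set M := e₁.baseSet ∩ f ⁻¹' (e₂.baseSet ∩ e₃.baseSet)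
  refine Subbundle.nonempty_straightening h
    (fun x ↦ (C₁ x).comp (ContinuousLinearMap.fst ℝ E G) -
      (C₂ (f x)).comp (ContinuousLinearMap.snd ℝ E G)) (W := U)
    (e₁.open_baseSet.inter ((e₂.open_baseSet.inter e₃.open_baseSet).preimage
      f.contMDiff.continuous))
    ⟨mem_baseSet_trivializationAt E _ x₀, mem_baseSet_trivializationAt G W _,
      mem_baseSet_trivializationAt E' _ _⟩
    (fun x hx ↦ ⟨hx.1, hx.2.1⟩) ?_ ?_
  · have h1' : ContMDiffOn I 𝓘(ℝ, E →L[ℝ] E') ∞ C₁ U := h1.mono fun x hx ↦ ⟨hx.1, hx.2.2⟩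
    have h2' : ContMDiffOn I 𝓘(ℝ, G →L[ℝ] E') ∞ (fun x ↦ C₂ (f x)) U :=
      ContMDiffOn.comp (g := C₂) h2 f.contMDiff.contMDiffOn fun x hx ↦ hx.2
    exact (h1'.clm_comp contMDiffOn_const).sub (h2'.clm_comp contMDiffOn_const)
  · intro x hx v
    have k1 : C₁ x (e₁ ⟨x, v.1⟩).2 = (e₃ ⟨f x, Φ₁ x v.1⟩).2 :=
      coordMap_apply_mk Φ₁ x₀ (f x₀) hx.1 hx.2.2 v.1
    have k2 : C₂ (f x) (e₂ ⟨f x, v.2⟩).2 = (e₃ ⟨f x, Φ₂ (f x) v.2⟩).2 :=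
      coordMap_apply_mk Φ₂ (f x₀) (f x₀) hx.2.1 hx.2.2 v.2
    change Φ₁ x v.1 = Φ₂ (f x) v.2 ↔ C₁ x (e₁ ⟨x, v.1⟩).2 - C₂ (f x) (e₂ ⟨f x, v.2⟩).2 = 0
    rw [k1, k2, sub_eq_zero]
    refine ⟨fun h ↦ by rw [h], fun h ↦ ?_⟩
    exact (e₃.continuousLinearEquivAt ℝ (f x) hx.2.2).injective h

section PullbackBundle

variable [FiniteDimensional ℝ E] [FiniteDimensional ℝ E'] [FiniteDimensional ℝ G]
  [ContMDiffVectorBundle ∞ G W I'] (B : LieAlgebroid I' G W) (f : C^∞⟮I, M; I', N⟯) {r : ℕ}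
  (h : B.PullbackExists f r)

/-- The vector bundle `f^{!!}B → M`, a smooth subbundle of `TM ⊕ f^! B`. -/
abbrev PullbackBundle : M → Type _ :=
  Subbundle (B.isSmoothSubbundle_pullback f h)

/-- The map `f^{!!}B → TM`, `(v, b) ↦ v`. -/
noncomputable def pullbackAnchor (x : M) : B.PullbackBundle f h x →ₗ[ℝ] TangentSpace I x :=
  LinearMap.fst ℝ (TangentSpace I x) (((f : M → N) *ᵖ W) x) ∘ₗ
    Subbundle.incl (B.isSmoothSubbundle_pullback f h) x

/-- The map `p_{B,f} : f^{!!}B → B`, `(v, b) ↦ b`, over `f`. -/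
noncomputable def pullbackProj (x : M) : B.PullbackBundle f h x →ₗ[ℝ] W (f x) :=
  LinearMap.snd ℝ (TangentSpace I x) (((f : M → N) *ᵖ W) x) ∘ₗ
    Subbundle.incl (B.isSmoothSubbundle_pullback f h) x

/-- `A` is the pullback Lie algebroid structure on `f^{!!}B → M`: the anchor is `(v, b) ↦ v` and
the bracket of `(X, ∑ᵢ hᵢ • f^! bᵢ)` and `(Y, ∑ⱼ gⱼ • f^! cⱼ)` is
`([X, Y], ∑ᵢⱼ hᵢ gⱼ • f^![bᵢ, cⱼ] + ∑ⱼ X(gⱼ) • f^! cⱼ - ∑ᵢ Y(hᵢ) • f^! bᵢ)`. -/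
structure IsPullback
    (A : LieAlgebroid I (EuclideanSpace ℝ (Fin r)) (B.PullbackBundle f h)) : Prop where
  anchor : ∀ x v, A.anchor x v = B.pullbackAnchor f h x v
  bracket_fst : ∀ (σ τ : Cₛ^∞⟮I; EuclideanSpace ℝ (Fin r), B.PullbackBundle f h⟯) (x : M),
    B.pullbackAnchor f h x (A.bracket σ τ x) =
      VectorField.mlieBracket I (fun x ↦ B.pullbackAnchor f h x (σ x))
        (fun x ↦ B.pullbackAnchor f h x (τ x)) x
  bracket_snd : ∀ (σ τ : Cₛ^∞⟮I; EuclideanSpace ℝ (Fin r), B.PullbackBundle f h⟯) (x : M)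
    {k l : ℕ} (u : Fin k → C^∞⟮I, M; 𝓘(ℝ, ℝ), ℝ⟯) (b : Fin k → Cₛ^∞⟮I'; G, W⟯)
    (g : Fin l → C^∞⟮I, M; 𝓘(ℝ, ℝ), ℝ⟯) (c : Fin l → Cₛ^∞⟮I'; G, W⟯),
    IsLocalExpansion f (fun x ↦ B.pullbackProj f h x (σ x)) x u b →
    IsLocalExpansion f (fun x ↦ B.pullbackProj f h x (τ x)) x g c →
    B.pullbackProj f h x (A.bracket σ τ x) =
      expandedBracket B f (B.pullbackAnchor f h x (σ x)) (B.pullbackAnchor f h x (τ x)) u b g c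

end PullbackBundle

/-! ### Homotopies -/

variable (I) in
/-- The inclusion `ι_t : M → J × M`, `m ↦ (t, m)`. -/
def timeIncl {J : TopologicalSpace.Opens ℝ} (t : J) : C^∞⟮I, M; 𝓘(ℝ, ℝ).prod I, J × M⟯ :=
  ⟨fun m ↦ (t, m), contMDiff_const.prodMk contMDiff_id⟩

variable (I V) in
/-- The inclusion `𝓘_t : A → TJ × A`, `a ↦ (0_t, a)`, over `ι_t`. -/
noncomputable def bundleIncl {J : TopologicalSpace.Opens ℝ} (t : J) (m : M) :
    V m →ₗ[ℝ] ProdBundle 𝓘(ℝ, ℝ) (TangentSpace 𝓘(ℝ, ℝ) : J → Type) I V (t, m) :=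
  LinearMap.inr ℝ (TangentSpace 𝓘(ℝ, ℝ) t) (V m)

/-- The coordinate vector field `∂_t` on `J × M`. -/
def timeField {J : TopologicalSpace.Opens ℝ} (p : J × M) : TangentSpace (𝓘(ℝ, ℝ).prod I) p :=
  ((1 : ℝ), (0 : E))

/-- `(Φ, φ)` is an LA-homotopy between the Lie algebroid morphisms `(Φ₀, φ₀)` and `(Φ₁, φ₁)` from
`A` to `B`: a Lie algebroid morphism from the direct product Lie algebroid `P = TJ × A` to `B` such
that `Φ_j = Φ ∘ 𝓘_j` for `j = 0, 1`. -/
structure IsLAHomotopy {J : TopologicalSpace.Opens ℝ} (h0 : (0 : ℝ) ∈ J) (h1 : (1 : ℝ) ∈ J)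
    (A : LieAlgebroid I F V) (B : LieAlgebroid I' G W)
    (P : LieAlgebroid (𝓘(ℝ, ℝ).prod I) (ℝ × F)
      (ProdBundle 𝓘(ℝ, ℝ) (TangentSpace 𝓘(ℝ, ℝ) : J → Type) I V))
    (φ₀ : M → N) (Φ₀ : ∀ m, V m →ₗ[ℝ] W (φ₀ m)) (φ₁ : M → N) (Φ₁ : ∀ m, V m →ₗ[ℝ] W (φ₁ m))
    (φ : J × M → N) (Φ : ∀ p, ProdBundle 𝓘(ℝ, ℝ) (TangentSpace 𝓘(ℝ, ℝ) : J → Type) I V p →ₗ[ℝ]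
      W (φ p)) : Prop where
  isProduct : IsProduct (tangent 𝓘(ℝ, ℝ) J) A P
  isMorphism₀ : IsMorphism A B φ₀ Φ₀
  isMorphism₁ : IsMorphism A B φ₁ Φ₁
  isMorphism : IsMorphism P B φ Φ
  at_zero : ∀ m (a : V m), (⟨φ₀ m, Φ₀ m a⟩ : TotalSpace G W) =
    ⟨φ (⟨0, h0⟩, m), Φ (⟨0, h0⟩, m) (bundleIncl I V ⟨0, h0⟩ m a)⟩
  at_one : ∀ m (a : V m), (⟨φ₁ m, Φ₁ m a⟩ : TotalSpace G W) =
    ⟨φ (⟨1, h1⟩, m), Φ (⟨1, h1⟩, m) (bundleIncl I V ⟨1, h1⟩ m a)⟩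

end LieAlgebroid

end LieAlgebroids

/-!
The proof transports the fibres of `φ^{!!}B` along the section `y` over `∂_t`.

Let `A = φ^{!!}B` and `A₀ = φ₀^{!!}B`. Bracketing with `y` differentiates sections of `A` in the
direction of time, since the anchor of `y` is `∂_t`. In local frames the equation `[y, σ] = 0` is a
linear ordinary differential equation depending smoothly on a point of `M`, so every section of `A`
over `{0} × M` has a unique extension `σ` to `J × M` with `[y, σ] = 0`
(`IsTimeDerivation.exists_parallel`, `IsTimeDerivation.eq_of_eq`); as the equation is linear, the
extension exists over all of `J`. The map `(v, b) ↦ ((0, v), b)` embeds `A₀` in `A` over `{0} × M`,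
with image the kernel of the time component of the anchor, so that `φ₀^{!!}B` has constant rank, one
less than the rank of `φ^{!!}B`. Let `σ_a` be the parallel extension of the image of `a ∈ Γ(A₀)`.
Then `Π(∂_t) = y` and `Π(a) = σ_a` define the isomorphism `TJ × A₀ → A`
(`LieAlgebroid.exists_isIso_of_timeField`):

* the anchor of `σ_a` is `(0, ρ(a))`, since both vector fields commute with `∂_t` and agree at
  time `0`;
* `[σ_a, σ_b] = σ_{[a, b]}`, since the left hand side commutes with `y` by the Jacobi identity, and
  both sides agree at time `0` because the embedding of `A₀` is a morphism;
* these brackets determine all others by the Leibniz rule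
  (`LieAlgebroid.isIso_of_generators`).

For the second part, the projection `φ^{!!}B → B`, isomorphisms over the identity and the inclusions
`A₀ → TJ × A₀` are morphisms, and so are their compositions (`LieAlgebroid.IsMorphism.comp`).

The pullbacks and the product `TJ × A₀` are both treated as fibre products `TM ×_{TN} W` of a tangent
bundle and a Lie algebroid (`LieAlgebroid.IsFibreProduct`), whose bracket is constructed from local
expansions along the base map. It is well defined because the bracket of expansions only depends on
the sections which are expanded (`LieAlgebroid.expBracket_congr`), which holds for all derivations
(`IsPointDerivation.expansion_congr`).
-/

set_option linter.unusedSectionVars false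

/-! ### Linear differential equations with parameters -/

section LinearODE

universe u

open Set MeasureTheory intervalIntegral

/-- The Picard iterates of the linear equation `∂ₜ x = c(t, z) x`: the terms of the Dyson series. -/
noncomputable def dysonTerm {Z F : Type*} [NormedAddCommGroup F] [NormedSpace ℝ F]
    (c : ℝ → Z → F →L[ℝ] F) (x₀ : Z → F) : ℕ → ℝ → Z → F
  | 0, _, z => x₀ z
  | n + 1, t, z => ∫ s in (0 : ℝ)..t, c s z (dysonTerm c x₀ n s z)

theorem continuous_dysonTerm {Z F : Type*} [NormedAddCommGroup F] [NormedSpace ℝ F]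
    [TopologicalSpace Z] [FirstCountableTopology Z]
    {c : ℝ → Z → F →L[ℝ] F} (hc : Continuous ↿c) {x₀ : Z → F} (h₀ : Continuous x₀) (n : ℕ) :
    Continuous ↿(dysonTerm c x₀ n) := by
  induction n with
  | zero => exact h₀.comp continuous_snd
  | succ n ih =>
    have h : Continuous (Function.uncurry fun (p : ℝ × Z) (s : ℝ) ↦
        c s p.2 (dysonTerm c x₀ n s p.2)) := by
      have h1 : Continuous fun q : (ℝ × Z) × ℝ ↦ (q.2, q.1.2) := by fun_prop
      exact (hc.comp h1).clm_apply (ih.comp h1)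
    exact continuous_parametric_intervalIntegral_of_continuous h continuous_fst

theorem norm_dysonTerm_le {Z F : Type*} [NormedAddCommGroup F] [NormedSpace ℝ F]
    {c : ℝ → Z → F →L[ℝ] F} {x₀ : Z → F} {T C R : ℝ} {z : Z}
    (hC : ∀ s, |s| ≤ T → ‖c s z‖ ≤ C) (hR : ‖x₀ z‖ ≤ R) (n : ℕ) {t : ℝ} (ht : |t| ≤ T) :
    ‖dysonTerm c x₀ n t z‖ ≤ R * C ^ n * |t| ^ n / n.factorial := by
  have hC0 : 0 ≤ C := (norm_nonneg _).trans (hC t ht)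
  have hR0 : 0 ≤ R := (norm_nonneg _).trans hR
  induction n generalizing t with
  | zero => simpa [dysonTerm] using hR
  | succ n ih =>
    have h1 : ‖dysonTerm c x₀ (n + 1) t z‖ ≤
        |∫ s in (0 : ℝ)..t, C * (R * C ^ n * |s - 0| ^ n / n.factorial)| := by
      refine norm_integral_le_abs_of_norm_le ?_ (Continuous.intervalIntegrable (by fun_prop) _ _)
      refine (ae_restrict_iff' measurableSet_uIoc).2 (Filter.Eventually.of_forall fun s hs ↦ ?_)
      have hs' : |s| ≤ T := by
        rcases le_total 0 t with h | h
        · rw [uIoc_of_le h] at hs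
          rw [abs_of_pos hs.1]; rw [abs_of_nonneg h] at ht; exact hs.2.trans ht
        · rw [uIoc_of_ge h] at hs
          rw [abs_of_nonpos hs.2]; rw [abs_of_nonpos h] at ht; linarith [hs.1]
      rw [sub_zero]
      exact ((c s z).le_opNorm _).trans (mul_le_mul (hC s hs') (ih hs') (norm_nonneg _) hC0)
    refine h1.trans (le_of_eq ?_)
    have h2 : (fun s : ℝ ↦ C * (R * C ^ n * |s - 0| ^ n / n.factorial)) =
        fun s ↦ (R * C ^ (n + 1) / n.factorial) * |s - 0| ^ n := by
      funext s; ring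
    rw [h2, intervalIntegral.integral_const_mul, abs_mul, abs_intervalIntegral_eq,
      integral_pow_abs_sub_uIoc, abs_of_nonneg (by positivity), abs_of_nonneg (by positivity),
      Nat.factorial_succ]
    push_cast
    have : (n.factorial : ℝ) ≠ 0 := by positivity
    have : (n + 1 : ℝ) ≠ 0 := by positivity
    rw [sub_zero]
    field_simp

/-- A linear ODE depending continuously on a parameter has a global solution, continuous in time
and parameter. -/
theorem exists_linearODE_continuous {Z F : Type*} [NormedAddCommGroup F] [NormedSpace ℝ F]
    [CompleteSpace F] [TopologicalSpace Z] [FirstCountableTopology Z] [WeaklyLocallyCompactSpace Z]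
    {c : ℝ → Z → F →L[ℝ] F} (hc : Continuous ↿c) {x₀ : Z → F} (h₀ : Continuous x₀) :
    ∃ x : ℝ → Z → F, Continuous ↿x ∧ (∀ z, x 0 z = x₀ z) ∧
      ∀ t z, HasDerivAt (fun t ↦ x t z) (c t z (x t z)) t := by
  -- `c` and `x₀` are bounded on the compact sets `[-T, T] × K`
  have hbd (T : ℝ) (z : Z) : ∃ K ∈ 𝓝 z, ∃ C R : ℝ, 0 ≤ C ∧
      (∀ z ∈ K, ∀ s, |s| ≤ T → ‖c s z‖ ≤ C) ∧ ∀ z ∈ K, ‖x₀ z‖ ≤ R := by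
    obtain ⟨K, hK, hKz⟩ := exists_compact_mem_nhds z
    obtain ⟨C, hC⟩ := (isCompact_Icc (a := -T) (b := T)).prod hK |>.exists_bound_of_continuousOn
      hc.continuousOn
    obtain ⟨R, hR⟩ := hK.exists_bound_of_continuousOn h₀.continuousOn
    exact ⟨K, hKz, max C 0, R, le_max_right _ _, fun z hz s hs ↦
      (hC (s, z) ⟨abs_le.1 hs, hz⟩).trans (le_max_left _ _), hR⟩
  have hsum (R C T : ℝ) : Summable fun n : ℕ ↦ R * C ^ n * T ^ n / n.factorial := by
    have := (Real.summable_pow_div_factorial (C * T)).mul_left R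
    refine this.congr fun n ↦ ?_
    rw [mul_pow]; ring
  have hle {K : Set Z} {C R T : ℝ} (hC0 : 0 ≤ C) (hC : ∀ z ∈ K, ∀ s, |s| ≤ T → ‖c s z‖ ≤ C)
      (hR : ∀ z ∈ K, ‖x₀ z‖ ≤ R) (n : ℕ) {t : ℝ} (ht : |t| ≤ T) {z : Z} (hz : z ∈ K) :
      ‖dysonTerm c x₀ n t z‖ ≤ R * C ^ n * T ^ n / n.factorial := by
    have hR0 : 0 ≤ R := (norm_nonneg _).trans (hR z hz)
    refine (norm_dysonTerm_le (hC z hz) (hR z hz) n ht).trans ?_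
    gcongr
  refine ⟨fun t z ↦ ∑' n, dysonTerm c x₀ n t z, ?_, fun z ↦ ?_, fun t z ↦ ?_⟩
  · refine continuous_iff_continuousAt.2 fun ⟨t, z⟩ ↦ ?_
    obtain ⟨K, hKz, C, R, hC0, hC, hR⟩ := hbd (|t| + 1) z
    have hS : Icc (-(|t| + 1)) (|t| + 1) ×ˢ K ∈ 𝓝 (t, z) :=
      prod_mem_nhds (Icc_mem_nhds (by linarith [neg_abs_le t]) (by linarith [le_abs_self t])) hKz
    refine (continuousOn_tsum (fun n ↦ (continuous_dysonTerm hc h₀ n).continuousOn)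
      (hsum R C (|t| + 1)) fun n p hp ↦ ?_).continuousAt hS
    exact hle hC0 hC hR n (abs_le.2 hp.1) hp.2
  · change ∑' n, dysonTerm c x₀ n 0 z = x₀ z
    rw [tsum_eq_single 0]
    · rfl
    · intro n hn
      obtain ⟨k, rfl⟩ := Nat.exists_eq_succ_of_ne_zero hn
      simp [dysonTerm]
  · obtain ⟨K, hKz, C, R, hC0, hC, hR⟩ := hbd (|t| + 1) z
    have hz := mem_of_mem_nhds hKz
    let g' : ℕ → ℝ → F := fun n s ↦ n.casesOn 0 fun k ↦ c s z (dysonTerm c x₀ k s z)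
    let u : ℕ → ℝ := fun n ↦ n.casesOn 0 fun k ↦ C * (R * C ^ k * (|t| + 1) ^ k / k.factorial)
    have hu : Summable u := (summable_nat_add_iff 1).1 ((hsum R C (|t| + 1)).mul_left C)
    have habs {s : ℝ} (hs : s ∈ Ioo (-(|t| + 1)) (|t| + 1)) : |s| ≤ |t| + 1 :=
      abs_le.2 ⟨hs.1.le, hs.2.le⟩
    have htI : t ∈ Ioo (-(|t| + 1)) (|t| + 1) :=
      ⟨by linarith [neg_abs_le t], by linarith [le_abs_self t]⟩
    have hcont (k : ℕ) : Continuous fun s ↦ c s z (dysonTerm c x₀ k s z) := by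
      have h1 : Continuous fun s : ℝ ↦ (s, z) := by fun_prop
      exact (hc.comp h1).clm_apply ((continuous_dysonTerm hc h₀ k).comp h1)
    have hT : Summable fun n ↦ dysonTerm c x₀ n t z :=
      .of_norm_bounded (hsum R C (|t| + 1)) fun n ↦ hle hC0 hC hR n (habs htI) hz
    have hT' : Summable fun n ↦ g' n t := by
      refine .of_norm_bounded hu fun n ↦ ?_
      cases n with
      | zero => simp [g', u]
      | succ k =>
        exact ((c t z).le_opNorm _).trans (mul_le_mul (hC z hz t (habs htI))
          (hle hC0 hC hR k (habs htI) hz) (norm_nonneg _) hC0)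
    have hd := hasDerivAt_tsum_of_isPreconnected (g := fun n s ↦ dysonTerm c x₀ n s z) (g' := g')
      hu isOpen_Ioo isPreconnected_Ioo (fun n s hs ↦ ?_) (fun n s hs ↦ ?_) htI hT htI
    · convert! hd using 1
      rw [(c t z).map_tsum hT, hT'.tsum_eq_zero_add]
      simp [g']
    · cases n with
      | zero => exact hasDerivAt_const _ _
      | succ k =>
        exact integral_hasDerivAt_right ((hcont k).intervalIntegrable _ _)
          ((hcont k).stronglyMeasurableAtFilter _ _) (hcont k).continuousAt
    · cases n with
      | zero => simp [g', u]
      | succ k =>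
        exact ((c s z).le_opNorm _).trans (mul_le_mul (hC z hz s (habs hs))
          (hle hC0 hC hR k (habs hs) hz) (norm_nonneg _) hC0)

/-- A solution of a linear ODE which vanishes at one time vanishes at all nearby times. -/
theorem linearODE_eventually_eq_zero {F : Type*} [NormedAddCommGroup F] [NormedSpace ℝ F]
    {c : ℝ → F →L[ℝ] F} {x : ℝ → F} {t₀ : ℝ} (hc : ContinuousAt c t₀)
    (hx : ∀ᶠ t in 𝓝 t₀, HasDerivAt x (c t (x t)) t) (h0 : x t₀ = 0) : x =ᶠ[𝓝 t₀] 0 := by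
  have hb : ∀ᶠ t in 𝓝 t₀, ‖c t‖ ≤ ‖c t₀‖ + 1 :=
    (hc.norm.eventually (gt_mem_nhds (lt_add_one _))).mono fun _ h ↦ h.le
  refine ODE_solution_unique_of_eventually (v := fun t ↦ c t) (s := fun _ ↦ univ)
    (K := (‖c t₀‖ + 1).toNNReal) ?_ (hx.mono fun t h ↦ ⟨h, trivial⟩)
    (Filter.Eventually.of_forall fun t ↦ ⟨?_, trivial⟩) h0
  · filter_upwards [hb] with t ht
    refine ((c t).lipschitz.weaken ?_).lipschitzOnWith
    rw [← NNReal.coe_le_coe, coe_nnnorm, Real.coe_toNNReal _ (by positivity)]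
    exact ht
  · simp

theorem linearODE_eq_zero {F : Type*} [NormedAddCommGroup F] [NormedSpace ℝ F]
    {c : ℝ → F →L[ℝ] F} {x : ℝ → F} (hc : Continuous c)
    (hx : ∀ t, HasDerivAt x (c t (x t)) t) (h0 : x 0 = 0) : x = 0 := by
  have hcl : IsClosed {t | x t = 0} := isClosed_eq
    (continuous_iff_continuousAt.2 fun t ↦ (hx t).continuousAt) continuous_const
  have hop : IsOpen {t | x t = 0} := isOpen_iff_mem_nhds.2 fun t ht ↦
    linearODE_eventually_eq_zero hc.continuousAt (Filter.Eventually.of_forall hx) ht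
  have := IsClopen.eq_univ ⟨hcl, hop⟩ ⟨0, h0⟩
  exact funext fun t ↦ (this ▸ mem_univ t : t ∈ {t | x t = 0})

/-- The averaged differential of `g` along the segment from `z` to `z'`; it is a continuous
divided difference of `g` if `g` is `C¹`. -/
noncomputable def segmentFDeriv {E F : Type*} [NormedAddCommGroup E] [NormedSpace ℝ E]
    [NormedAddCommGroup F] [NormedSpace ℝ F] (g' : E → E →L[ℝ] F) (z z' : E) : E →L[ℝ] F :=
  ∫ θ in (0 : ℝ)..1, g' (z + θ • (z' - z))

theorem segmentFDeriv_apply {E F : Type*} [NormedAddCommGroup E] [NormedSpace ℝ E]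
    [NormedAddCommGroup F] [NormedSpace ℝ F] [CompleteSpace F] {g : E → F} {g' : E → E →L[ℝ] F}
    (hg : ∀ z, HasFDerivAt g (g' z) z) (hg' : Continuous g') (z z' : E) :
    segmentFDeriv g' z z' (z' - z) = g z' - g z := by
  have hc : Continuous fun θ : ℝ ↦ g' (z + θ • (z' - z)) := hg'.comp (by fun_prop)
  have h1 (θ : ℝ) : HasDerivAt (fun θ : ℝ ↦ g (z + θ • (z' - z)))
      (g' (z + θ • (z' - z)) (z' - z)) θ := by
    have h2 : HasDerivAt (fun θ : ℝ ↦ z + θ • (z' - z)) (z' - z) θ := by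
      simpa using ((hasDerivAt_id θ).smul_const (z' - z)).const_add z
    exact (hg _).comp_hasDerivAt θ h2
  rw [segmentFDeriv, ContinuousLinearMap.intervalIntegral_apply (hc.intervalIntegrable _ _),
    integral_eq_sub_of_hasDerivAt (fun θ _ ↦ h1 θ)
      ((hc.clm_apply continuous_const).intervalIntegrable _ _)]
  simp

theorem segmentFDeriv_self {E F : Type*} [NormedAddCommGroup E] [NormedSpace ℝ E]
    [NormedAddCommGroup F] [NormedSpace ℝ F] [CompleteSpace F] (g' : E → E →L[ℝ] F) (z : E) :
    segmentFDeriv g' z z = g' z := by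
  simp [segmentFDeriv]

/-- The coefficients of the linear ODE satisfied by a solution `x` of `∂ₜ x = c x` together with
its divided difference or its derivative with respect to a parameter. -/
noncomputable def augmentedCoeff {E F : Type*} [NormedAddCommGroup E] [NormedSpace ℝ E]
    [NormedAddCommGroup F] [NormedSpace ℝ F] (c c' : F →L[ℝ] F) (d : E →L[ℝ] F →L[ℝ] F) :
    (F × (E →L[ℝ] F)) →L[ℝ] (F × (E →L[ℝ] F)) :=
  (c.comp (.fst ℝ F (E →L[ℝ] F))).prod
    ((ContinuousLinearMap.compL ℝ E F F c').comp (.snd ℝ F (E →L[ℝ] F)) +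
      d.flip.comp (.fst ℝ F (E →L[ℝ] F)))

set_option synthInstance.maxHeartbeats 400000 in
theorem contDiff_augmentedCoeff {P E F : Type*} [NormedAddCommGroup P] [NormedSpace ℝ P]
    [NormedAddCommGroup E] [NormedSpace ℝ E]
    [NormedAddCommGroup F] [NormedSpace ℝ F] {n : ℕ∞ω} {c c' : P → F →L[ℝ] F}
    {d : P → E →L[ℝ] F →L[ℝ] F} (hc : ContDiff ℝ n c) (hc' : ContDiff ℝ n c')
    (hd : ContDiff ℝ n d) : ContDiff ℝ n fun p ↦ augmentedCoeff (c p) (c' p) (d p) := by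
  have h1 : ContDiff ℝ n fun p ↦ (c p).comp (.fst ℝ F (E →L[ℝ] F)) := hc.clm_comp contDiff_const
  have h2 : ContDiff ℝ n fun p ↦
      (ContinuousLinearMap.compL ℝ E F F (c' p)).comp (.snd ℝ F (E →L[ℝ] F)) := by
    have h' : ContDiff ℝ n fun A : F →L[ℝ] F ↦ ContinuousLinearMap.compL ℝ E F F A := by
      fun_prop
    have h : ContDiff ℝ n fun p ↦ ContinuousLinearMap.compL ℝ E F F (c' p) := h'.comp hc'
    exact h.clm_comp contDiff_const
  have h3 : ContDiff ℝ n fun p ↦ (d p).flip.comp (.fst ℝ F (E →L[ℝ] F)) := by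
    have h' : ContDiff ℝ n fun A : E →L[ℝ] F →L[ℝ] F ↦ A.flip :=
      IsBoundedLinearMap.contDiff
        { map_add := fun _ _ ↦ rfl
          map_smul := fun _ _ ↦ rfl
          bound := ⟨1, one_pos, fun A ↦ by rw [ContinuousLinearMap.opNorm_flip, one_mul]⟩ }
    have h : ContDiff ℝ n fun p ↦ (d p).flip := h'.comp hd
    exact h.clm_comp contDiff_const
  have h4 : ContDiff ℝ n fun p ↦
      (ContinuousLinearMap.inl ℝ F (E →L[ℝ] F)).comp ((c p).comp (.fst ℝ F (E →L[ℝ] F))) +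
      (ContinuousLinearMap.inr ℝ F (E →L[ℝ] F)).comp
        ((ContinuousLinearMap.compL ℝ E F F (c' p)).comp (.snd ℝ F (E →L[ℝ] F)) +
          (d p).flip.comp (.fst ℝ F (E →L[ℝ] F))) :=
    (contDiff_const.clm_comp h1).add (contDiff_const.clm_comp (h2.add h3))
  convert! h4 using 2 with p
  ext v <;> simp [augmentedCoeff]

set_option synthInstance.maxHeartbeats 400000 in
set_option maxHeartbeats 1000000 in
/-- Divided difference `Y t (z, z')` of a solution with respect to the parameter: it solves the
augmented equation, hence is continuous. -/
theorem exists_dividedDifference_linearODE {E F : Type*} [NormedAddCommGroup E] [NormedSpace ℝ E]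
    [FiniteDimensional ℝ E] [NormedAddCommGroup F] [NormedSpace ℝ F] [CompleteSpace F]
    {c : ℝ → E → F →L[ℝ] F} (hc : ContDiff ℝ 1 ↿c) {x₀ : E → F} (h₀ : ContDiff ℝ 1 x₀)
    {x : ℝ → E → F} (hx0 : ∀ z, x 0 z = x₀ z)
    (hx : ∀ t z, HasDerivAt (fun t ↦ x t z) (c t z (x t z)) t) :
    ∃ Y : ℝ → E × E → E →L[ℝ] F, Continuous ↿Y ∧
      (∀ t z z', x t z' - x t z = Y t (z, z') (z' - z)) ∧
      (∀ z, Y 0 (z, z) = fderiv ℝ x₀ z) ∧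
      ∀ t z, HasDerivAt (fun t ↦ (x t z, Y t (z, z)))
        (augmentedCoeff (c t z) (c t z) (fderiv ℝ (fun z ↦ c t z) z) (x t z, Y t (z, z))) t := by
  have hct (t : ℝ) : ContDiff ℝ 1 fun z ↦ c t z := hc.comp (contDiff_const.prodMk contDiff_id)
  have hcd (t : ℝ) (z : E) : HasFDerivAt (fun z ↦ c t z) (fderiv ℝ (fun z ↦ c t z) z) z :=
    ((hct t).differentiable one_ne_zero z).hasFDerivAt
  have hc' : Continuous fun p : ℝ × E ↦ fderiv ℝ (fun z ↦ c p.1 z) p.2 := by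
    have h1 : ContDiff ℝ 1 (Function.uncurry fun (p : ℝ × E) (z : E) ↦ c p.1 z) :=
      hc.comp ((contDiff_fst.comp contDiff_fst).prodMk contDiff_snd)
    exact (h1.fderiv (n := 0) contDiff_snd (by simp)).continuous
  have h₀d (z : E) : HasFDerivAt x₀ (fderiv ℝ x₀ z) z :=
    (h₀.differentiable one_ne_zero z).hasFDerivAt
  have h₀c : Continuous (fderiv ℝ x₀) := h₀.continuous_fderiv one_ne_zero
  let d : ℝ → E × E → E →L[ℝ] F →L[ℝ] F :=
    fun t p ↦ segmentFDeriv (fderiv ℝ fun z ↦ c t z) p.1 p.2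
  have hd : Continuous ↿d := by
    refine intervalIntegral.continuous_parametric_intervalIntegral_of_continuous' (μ := volume)
      (f := fun (q : ℝ × (E × E)) (θ : ℝ) ↦
        fderiv ℝ (fun z ↦ c q.1 z) (q.2.1 + θ • (q.2.2 - q.2.1))) ?_ _ _
    have h1 : Continuous fun q : (ℝ × (E × E)) × ℝ ↦
        (q.1.1, q.1.2.1 + q.2 • (q.1.2.2 - q.1.2.1)) := by fun_prop
    exact hc'.comp h1
  let x₁ : E × E → E →L[ℝ] F := fun p ↦ segmentFDeriv (fderiv ℝ x₀) p.1 p.2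
  have hx₁ : Continuous x₁ := by
    refine intervalIntegral.continuous_parametric_intervalIntegral_of_continuous' (μ := volume)
      (f := fun (q : E × E) (θ : ℝ) ↦ fderiv ℝ x₀ (q.1 + θ • (q.2 - q.1))) ?_ _ _
    have h1 : Continuous fun q : (E × E) × ℝ ↦ q.1.1 + q.2 • (q.1.2 - q.1.1) := by fun_prop
    exact h₀c.comp h1
  have hcL : Continuous fun q : ℝ × (E × E) ↦ c q.1 q.2.1 := by
    have h1 : Continuous fun q : ℝ × (E × E) ↦ (q.1, q.2.1) := by fun_prop
    exact hc.continuous.comp h1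
  have hcR : Continuous fun q : ℝ × (E × E) ↦ c q.1 q.2.2 := by
    have h1 : Continuous fun q : ℝ × (E × E) ↦ (q.1, q.2.2) := by fun_prop
    exact hc.continuous.comp h1
  have ha : Continuous ↿(fun (t : ℝ) (p : E × E) ↦
      augmentedCoeff (c t p.1) (c t p.2) (d t p)) :=
    (contDiff_augmentedCoeff (contDiff_zero.2 hcL) (contDiff_zero.2 hcR)
      (contDiff_zero.2 hd)).continuous
  obtain ⟨w, hw, hw0, hw'⟩ := exists_linearODE_continuous ha
    (x₀ := fun p : E × E ↦ (x₀ p.1, x₁ p)) ((h₀.continuous.comp continuous_fst).prodMk hx₁)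
  have hw1 (t : ℝ) (p : E × E) : HasDerivAt (fun t ↦ (w t p).1) (c t p.1 (w t p).1) t := by
    convert! ((hw' t p).hasFDerivAt.fst).hasDerivAt using 1
    simp [augmentedCoeff]
  have hw2 (t : ℝ) (p : E × E) : HasDerivAt (fun t ↦ (w t p).2)
      ((c t p.2).comp (w t p).2 + (d t p).flip (w t p).1) t := by
    convert! ((hw' t p).hasFDerivAt.snd).hasDerivAt using 1
    simp [augmentedCoeff]
  have hctc (z : E) : Continuous fun t ↦ c t z := by
    have h1 : Continuous fun t : ℝ ↦ (t, z) := by fun_prop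
    exact hc.continuous.comp h1
  -- the first component is `x` itself
  have hwx (p : E × E) : (fun t ↦ (w t p).1 - x t p.1) = 0 := by
    refine linearODE_eq_zero (hctc p.1) (fun t ↦ ?_) ?_
    · simpa using! (hw1 t p).sub (hx t p.1)
    · simp [hw0, hx0]
  have hwx' (t : ℝ) (p : E × E) : (w t p).1 = x t p.1 := sub_eq_zero.1 (congrFun (hwx p) t)
  refine ⟨fun t p ↦ (w t p).2, continuous_snd.comp hw, fun t z z' ↦ ?_, fun z ↦ ?_, fun t z ↦ ?_⟩
  · have h1 : (fun t ↦ x t z' - x t z - (w t (z, z')).2 (z' - z)) = 0 := by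
      refine linearODE_eq_zero (hctc z') (fun t ↦ ?_) ?_
      · have h2 := (hw2 t (z, z')).clm_apply (hasDerivAt_const t (z' - z))
        convert! ((hx t z').sub (hx t z)).sub h2 using 1
        have h3 : d t (z, z') (z' - z) = c t z' - c t z := segmentFDeriv_apply (hcd t)
          ((hct t).continuous_fderiv one_ne_zero) z z'
        simp [hwx', h3]
        abel
      · simp only [hw0, hx0]
        rw [segmentFDeriv_apply h₀d h₀c, sub_self]
    exact sub_eq_zero.1 (congrFun h1 t)
  · simp [hw0, x₁, segmentFDeriv_self]
  · have h1 : fderiv ℝ (fun z ↦ c t z) z = d t (z, z) := (segmentFDeriv_self _ _).symm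
    have h2 (t : ℝ) : (x t z, (w t (z, z)).2) = w t (z, z) := Prod.ext (hwx' t (z, z)).symm rfl
    simp only [h1, h2]
    exact hw' t (z, z)

/-- A solution of a linear ODE whose coefficients and initial value are `C^n` in time and a
parameter is `C^n` in time and the parameter. -/
theorem contDiff_linearODE {E : Type u} [NormedAddCommGroup E] [NormedSpace ℝ E]
    [FiniteDimensional ℝ E] (n : ℕ) {F : Type u} [NormedAddCommGroup F] [NormedSpace ℝ F]
    [CompleteSpace F] {c : ℝ → E → F →L[ℝ] F} (hc : ContDiff ℝ n ↿c) {x₀ : E → F}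
    (h₀ : ContDiff ℝ n x₀) {x : ℝ → E → F} (hx0 : ∀ z, x 0 z = x₀ z)
    (hx : ∀ t z, HasDerivAt (fun t ↦ x t z) (c t z (x t z)) t) : ContDiff ℝ n ↿x := by
  induction n generalizing F with
  | zero =>
    obtain ⟨x', hx', hx'0, hx'd⟩ := exists_linearODE_continuous hc.continuous h₀.continuous
    have h1 (z : E) : (fun t ↦ x t z - x' t z) = 0 := by
      refine linearODE_eq_zero (c := fun t ↦ c t z) ?_ (fun t ↦ ?_) ?_
      · have h1 : Continuous fun t : ℝ ↦ (t, z) := by fun_prop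
        exact hc.continuous.comp h1
      · simpa using! (hx t z).sub (hx'd t z)
      · simp [hx'0, hx0]
    have h2 : x = x' := funext fun t ↦ funext fun z ↦ sub_eq_zero.1 (congrFun (h1 z) t)
    exact contDiff_zero.2 (h2 ▸ hx')
  | succ n ih =>
    push_cast at hc h₀ ⊢
    obtain ⟨Y, hY, hYx, hY0, hYd⟩ := exists_dividedDifference_linearODE (hc.of_le (by simp))
      (h₀.of_le (by simp)) hx0 hx
    have hcn : ContDiff ℝ n ↿c := hc.of_le (by exact_mod_cast Nat.le_succ n)
    have hd : ContDiff ℝ n fun p : ℝ × E ↦ fderiv ℝ (fun z ↦ c p.1 z) p.2 := by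
      have h1 : ContDiff ℝ (n + 1) (Function.uncurry fun (p : ℝ × E) (z : E) ↦ c p.1 z) :=
        hc.comp ((contDiff_fst.comp contDiff_fst).prodMk contDiff_snd)
      exact h1.fderiv contDiff_snd le_rfl
    have hxY : ContDiff ℝ n ↿(fun (t : ℝ) (z : E) ↦ (x t z, Y t (z, z))) :=
      ih (c := fun t z ↦ augmentedCoeff (c t z) (c t z) (fderiv ℝ (fun z ↦ c t z) z))
        (contDiff_augmentedCoeff hcn hcn hd)
        (x₀ := fun z ↦ (x₀ z, fderiv ℝ x₀ z))
        ((h₀.of_le (by exact_mod_cast Nat.le_succ n)).prodMk (h₀.fderiv_right le_rfl))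
        (fun z ↦ by rw [hx0, hY0]) hYd
    have hxn : ContDiff ℝ n fun p : ℝ × E ↦ x p.1 p.2 := hxY.fst
    have hYn : ContDiff ℝ n fun p : ℝ × E ↦ Y p.1 (p.2, p.2) := hxY.snd
    let f₁ : ℝ → E → ℝ →L[ℝ] F := fun t z ↦ .toSpanSingleton ℝ (c t z (x t z))
    let f₂ : ℝ → E → E →L[ℝ] F := fun t z ↦ Y t (z, z)
    have hf₁ : ContDiff ℝ n ↿f₁ := by
      have h1 : ContDiff ℝ n fun p : ℝ × E ↦ c p.1 p.2 (x p.1 p.2) := hcn.clm_apply hxn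
      exact (ContinuousLinearMap.toSpanSingletonCLE (𝕜 := ℝ) (E := F)).contDiff.comp h1
    have hf₂ (t : ℝ) (z : E) : HasFDerivAt (fun z ↦ x t z) (Y t (z, z)) z := by
      have hYz : ContinuousAt (fun z' ↦ Y t (z, z')) z := by
        have h1 : Continuous fun z' : E ↦ (t, (z, z')) := by fun_prop
        exact (hY.comp h1).continuousAt
      rw [hasFDerivAt_iff_isLittleO, Asymptotics.isLittleO_iff]
      intro ε hε
      filter_upwards [Metric.continuousAt_iff'.1 hYz ε hε] with z' hz'
      rw [hYx, ← sub_apply]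
      refine (ContinuousLinearMap.le_opNorm _ _).trans ?_
      rw [dist_eq_norm] at hz'
      gcongr
    refine contDiff_succ_iff_hasFDerivAt.2 ⟨fun p ↦ (↿f₁ p).coprod (↿f₂ p), ?_, fun p ↦ ?_⟩
    · have h2 : ContDiff ℝ n fun p ↦ (↿f₁ p).comp (.fst ℝ ℝ E) + (↿f₂ p).comp (.snd ℝ ℝ E) :=
        (hf₁.clm_comp contDiff_const).add (ContDiff.clm_comp hYn contDiff_const)
      convert! h2 using 2 with p
    · refine (hasStrictFDerivAt_uncurry_coprod (.of_forall fun p ↦ (hx p.1 p.2).hasFDerivAt)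
        (.of_forall fun p ↦ hf₂ p.1 p.2) hf₁.continuous.continuousAt
        hYn.continuous.continuousAt).hasFDerivAt

/-- A linear ODE whose coefficients and initial value depend smoothly on a parameter has a global
solution which is smooth in time and the parameter. -/
theorem exists_linearODE_contDiff {E : Type u} [NormedAddCommGroup E] [NormedSpace ℝ E]
    [FiniteDimensional ℝ E] {F : Type u} [NormedAddCommGroup F] [NormedSpace ℝ F]
    [CompleteSpace F] {c : ℝ → E → F →L[ℝ] F} (hc : ContDiff ℝ ∞ ↿c) {x₀ : E → F}
    (h₀ : ContDiff ℝ ∞ x₀) :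
    ∃ x : ℝ → E → F, ContDiff ℝ ∞ ↿x ∧ (∀ z, x 0 z = x₀ z) ∧
      ∀ t z, HasDerivAt (fun t ↦ x t z) (c t z (x t z)) t := by
  obtain ⟨x, -, hx0, hx⟩ := exists_linearODE_continuous hc.continuous h₀.continuous
  exact ⟨x, contDiff_infty.2 fun n ↦ contDiff_linearODE n (contDiff_infty.1 hc n)
    (contDiff_infty.1 h₀ n) hx0 hx, hx0, hx⟩

end LinearODE

/-! ### Sections along a map -/

section VectorBundles

variable {E : Type*} [NormedAddCommGroup E] [NormedSpace ℝ E]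
  {H : Type*} [TopologicalSpace H] {I : ModelWithCorners ℝ E H}
  {M : Type*} [TopologicalSpace M] [ChartedSpace H M]
  {F : Type*} [NormedAddCommGroup F] [NormedSpace ℝ F]
  {V : M → Type*} [TopologicalSpace (TotalSpace F V)] [∀ x, AddCommGroup (V x)]
  [∀ x, Module ℝ (V x)] [∀ x, TopologicalSpace (V x)] [FiberBundle F V] [VectorBundle ℝ F V]
  {E' : Type*} [NormedAddCommGroup E'] [NormedSpace ℝ E']
  {H' : Type*} [TopologicalSpace H'] {I' : ModelWithCorners ℝ E' H'}
  {N : Type*} [TopologicalSpace N] [ChartedSpace H' N]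
  {G : Type*} [NormedAddCommGroup G] [NormedSpace ℝ G]
  {W : N → Type*} [TopologicalSpace (TotalSpace G W)] [∀ x, AddCommGroup (W x)]
  [∀ x, Module ℝ (W x)] [∀ x, TopologicalSpace (W x)] [FiberBundle G W] [VectorBundle ℝ G W]

section Along

variable {f : M → N} {s t : ∀ x, W (f x)} {x₀ : M}

theorem contMDiffAt_along_iff :
    ContMDiffAt I (I'.prod 𝓘(ℝ, G)) ∞ (fun x ↦ (⟨f x, s x⟩ : TotalSpace G W)) x₀ ↔
      ContMDiffAt I I' ∞ f x₀ ∧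
        ContMDiffAt I 𝓘(ℝ, G) ∞ (fun x ↦ (trivializationAt G W (f x₀) ⟨f x, s x⟩).2) x₀ :=
  contMDiffAt_totalSpace

theorem eventually_mem_baseSet (hf : ContMDiffAt I I' ∞ f x₀) :
    ∀ᶠ x in 𝓝 x₀, f x ∈ (trivializationAt G W (f x₀)).baseSet :=
  hf.continuousAt.eventually ((trivializationAt G W (f x₀)).open_baseSet.mem_nhds
    (mem_baseSet_trivializationAt G W (f x₀)))

theorem ContMDiffAt.add_along
    (hs : ContMDiffAt I (I'.prod 𝓘(ℝ, G)) ∞ (fun x ↦ (⟨f x, s x⟩ : TotalSpace G W)) x₀)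
    (ht : ContMDiffAt I (I'.prod 𝓘(ℝ, G)) ∞ (fun x ↦ (⟨f x, t x⟩ : TotalSpace G W)) x₀) :
    ContMDiffAt I (I'.prod 𝓘(ℝ, G)) ∞ (fun x ↦ (⟨f x, s x + t x⟩ : TotalSpace G W)) x₀ := by
  rw [contMDiffAt_along_iff] at hs ht ⊢
  refine ⟨hs.1, (hs.2.add ht.2).congr_of_eventuallyEq ?_⟩
  filter_upwards [eventually_mem_baseSet (G := G) (W := W) hs.1] with x hx
  exact ((trivializationAt G W (f x₀)).linear ℝ hx).1 _ _

theorem ContMDiffAt.smul_along {g : M → ℝ} (hg : ContMDiffAt I 𝓘(ℝ, ℝ) ∞ g x₀)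
    (hs : ContMDiffAt I (I'.prod 𝓘(ℝ, G)) ∞ (fun x ↦ (⟨f x, s x⟩ : TotalSpace G W)) x₀) :
    ContMDiffAt I (I'.prod 𝓘(ℝ, G)) ∞ (fun x ↦ (⟨f x, g x • s x⟩ : TotalSpace G W)) x₀ := by
  rw [contMDiffAt_along_iff] at hs ⊢
  refine ⟨hs.1, (hg.smul hs.2).congr_of_eventuallyEq ?_⟩
  filter_upwards [eventually_mem_baseSet (G := G) (W := W) hs.1] with x hx
  exact ((trivializationAt G W (f x₀)).linear ℝ hx).2 _ _

theorem ContMDiffAt.zero_along (hf : ContMDiffAt I I' ∞ f x₀) :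
    ContMDiffAt I (I'.prod 𝓘(ℝ, G)) ∞ (fun x ↦ (⟨f x, 0⟩ : TotalSpace G W)) x₀ := by
  refine contMDiffAt_along_iff.2 ⟨hf, contMDiffAt_const (c := (0 : G)) |>.congr_of_eventuallyEq ?_⟩
  filter_upwards [eventually_mem_baseSet (G := G) (W := W) hf] with x hx
  exact ((trivializationAt G W (f x₀)).linear ℝ hx).map_zero

theorem ContMDiffAt.sum_along {ι : Type*} {σ : ι → ∀ x, W (f x)} (S : Finset ι)
    (hf : ContMDiffAt I I' ∞ f x₀)
    (hs : ∀ i, ContMDiffAt I (I'.prod 𝓘(ℝ, G)) ∞ (fun x ↦ (⟨f x, σ i x⟩ : TotalSpace G W)) x₀) :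
    ContMDiffAt I (I'.prod 𝓘(ℝ, G)) ∞ (fun x ↦ (⟨f x, ∑ i ∈ S, σ i x⟩ : TotalSpace G W)) x₀ := by
  classical
  induction S using Finset.induction_on with
  | empty => simpa using ContMDiffAt.zero_along (W := W) hf
  | insert i S hi ih => simpa [Finset.sum_insert hi] using (hs i).add_along ih

theorem ContMDiffSection.contMDiffAt_along (b : Cₛ^∞⟮I'; G, W⟯) (hf : ContMDiffAt I I' ∞ f x₀) :
    ContMDiffAt I (I'.prod 𝓘(ℝ, G)) ∞ (fun x ↦ (⟨f x, b (f x)⟩ : TotalSpace G W)) x₀ :=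
  (b.contMDiff (f x₀)).comp x₀ hf

end Along

/-! ### Extension of germs -/

section Germs

variable [FiniteDimensional ℝ E] [T2Space M] [IsManifold I ∞ M]

/-- A smooth function which is `1` near a point and supported in a given neighbourhood. -/
theorem exists_cutoff {U : Set M} {x₀ : M} (hU : U ∈ 𝓝 x₀) :
    ∃ χ : C^∞⟮I, M; 𝓘(ℝ, ℝ), ℝ⟯, χ =ᶠ[𝓝 x₀] 1 ∧ tsupport χ ⊆ U := by
  obtain ⟨χ, -, hχ⟩ := (SmoothBumpFunction.nhds_basis_tsupport (I := I) x₀).mem_iff.1 hU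
  exact ⟨⟨χ, χ.contMDiff⟩, χ.eventuallyEq_one, hχ⟩

theorem exists_contMDiffMap_eventuallyEq {U : Set M} {x₀ : M} (hU : IsOpen U) (hx : x₀ ∈ U)
    {g : M → ℝ} (hg : ContMDiffOn I 𝓘(ℝ, ℝ) ∞ g U) :
    ∃ g' : C^∞⟮I, M; 𝓘(ℝ, ℝ), ℝ⟯, g' =ᶠ[𝓝 x₀] g := by
  obtain ⟨χ, hχ1, hχ⟩ := exists_cutoff (I := I) (hU.mem_nhds hx)
  refine ⟨⟨fun x ↦ χ x • g x, contMDiff_of_tsupport fun x hx ↦ ?_⟩, ?_⟩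
  · have hxU : x ∈ U := hχ (closure_mono (Function.support_smul_subset_left _ _) hx)
    exact (χ.contMDiff x).smul (hg.contMDiffAt (hU.mem_nhds hxU))
  · filter_upwards [hχ1] with x hx
    simp [hx]

theorem exists_contMDiffSection_eventuallyEq {U : Set M} {x₀ : M} (hU : IsOpen U) (hx : x₀ ∈ U)
    {s : ∀ x, V x}
    (hs : ContMDiffOn I (I.prod 𝓘(ℝ, F)) ∞ (fun x ↦ (⟨x, s x⟩ : TotalSpace F V)) U) :
    ∃ b : Cₛ^∞⟮I; F, V⟯, ∀ᶠ x in 𝓝 x₀, b x = s x := by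
  obtain ⟨χ, hχ1, hχ⟩ := exists_cutoff (I := I) (hU.mem_nhds hx)
  refine ⟨⟨fun x ↦ χ x • s x, χ.contMDiff.contMDiffOn.smul_section_of_tsupport hU hχ hs⟩, ?_⟩
  filter_upwards [hχ1] with x hx
  simp [hx]

end Germs

/-! ### Frames by global sections -/

/-- Global smooth sections which form a frame of `V` over the neighbourhood `U` of `x₀`, together
with the coordinates with respect to this frame. -/
structure GlobalFrame (I : ModelWithCorners ℝ E H) (F : Type*) [NormedAddCommGroup F]
    [NormedSpace ℝ F] (V : M → Type*) [TopologicalSpace (TotalSpace F V)]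
    [∀ x, AddCommGroup (V x)] [∀ x, Module ℝ (V x)] [∀ x, TopologicalSpace (V x)]
    [FiberBundle F V] [VectorBundle ℝ F V] (x₀ : M) where
  n : ℕ
  U : Set M
  sec : Fin n → Cₛ^∞⟮I; F, V⟯
  coord : Fin n → ∀ x, V x →ₗ[ℝ] ℝ
  isOpen : IsOpen U
  mem : x₀ ∈ U
  sum_coord : ∀ x ∈ U, ∀ v : V x, ∑ i, coord i x v • sec i x = v
  coord_sec : ∀ x ∈ U, ∀ i j, coord i x (sec j x) = if i = j then 1 else 0
  contMDiffAt_coord : ∀ i, ∀ v : TotalSpace F V, v.1 ∈ U →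
    ContMDiffAt (I.prod 𝓘(ℝ, F)) 𝓘(ℝ, ℝ) ∞ (fun v : TotalSpace F V ↦ coord i v.1 v.2) v

variable (I F V) in
theorem nonempty_globalFrame [FiniteDimensional ℝ E] [FiniteDimensional ℝ F] [T2Space M]
    [IsManifold I ∞ M] [ContMDiffVectorBundle ∞ F V I] (x₀ : M) :
    Nonempty (GlobalFrame I F V x₀) := by
  let e := trivializationAt F V x₀
  let b := Module.finBasis ℝ F
  have hx₀ : x₀ ∈ e.baseSet := mem_baseSet_trivializationAt F V x₀
  have h1 (i) : ∃ s : Cₛ^∞⟮I; F, V⟯, ∀ᶠ x in 𝓝 x₀, s x = e.symm x (b i) := by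
    refine exists_contMDiffSection_eventuallyEq e.open_baseSet hx₀ ?_
    rw [e.contMDiffOn_section_baseSet_iff]
    refine (contMDiffOn_const (c := b i)).congr fun x hx ↦ ?_
    rw [e.apply_mk_symm hx]
  choose s hs using h1
  obtain ⟨U, hU, hUo, hxU⟩ := eventually_nhds_iff.1
    ((Filter.eventually_all.2 hs).and (e.open_baseSet.mem_nhds hx₀))
  refine ⟨⟨Module.finrank ℝ F, U, s, fun i x ↦ b.coord i ∘ₗ e.linearMapAt ℝ x, hUo, hxU,
    fun x hx v ↦ ?_, fun x hx i j ↦ ?_, fun i v hv ↦ ?_⟩⟩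
  · obtain ⟨hsx, (hxe : x ∈ e.baseSet)⟩ := hU x hx
    have hL : ⇑(e.linearMapAt ℝ x) = fun v ↦ (e ⟨x, v⟩).2 := e.coe_linearMapAt_of_mem hxe
    refine (e.continuousLinearEquivAt ℝ x hxe).injective ?_
    have h2 (i) : e.continuousLinearEquivAt ℝ x hxe (s i x) = b i := by
      rw [hsx i]
      change (e ⟨x, e.symm x (b i)⟩).2 = b i
      rw [e.apply_mk_symm hxe]
    simp only [map_sum, map_smul, h2, LinearMap.comp_apply, Module.Basis.coord_apply,
      hL]
    exact b.sum_repr _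
  · obtain ⟨hsx, (hxe : x ∈ e.baseSet)⟩ := hU x hx
    have hL : ⇑(e.linearMapAt ℝ x) = fun v ↦ (e ⟨x, v⟩).2 := e.coe_linearMapAt_of_mem hxe
    simp only [LinearMap.comp_apply, Module.Basis.coord_apply, hL, hsx j, e.apply_mk_symm hxe,
      Module.Basis.repr_self, Finsupp.single_apply, @eq_comm _ j]
  · have hve : v ∈ e.source := e.mem_source.2 (hU v.1 hv).2
    have h2 := (contMDiffAt_id (I := I.prod 𝓘(ℝ, F)) (x := v) (n := ∞))
    have h3 := ((e.contMDiffAt_iff (IB := I) hve).1 h2).2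
    have h4 : ContDiff ℝ ∞ (b.coord i).toContinuousLinearMap :=
      ContinuousLinearMap.contDiff _
    refine (h4.contMDiff.contMDiffAt.comp v h3).congr_of_eventuallyEq ?_
    have : ∀ᶠ w : TotalSpace F V in 𝓝 v, w.1 ∈ e.baseSet :=
      (FiberBundle.continuous_proj F V).continuousAt.eventually
        (e.open_baseSet.mem_nhds (hU v.1 hv).2)
    filter_upwards [this] with w hw
    simp [Trivialization.coe_linearMapAt_of_mem _ hw]

theorem GlobalFrame.contMDiffAt_coord_along {y₀ : N} (e : GlobalFrame I' G W y₀) {f : M → N}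
    {s : ∀ x, W (f x)} {x : M} (hx : f x ∈ e.U)
    (hs : ContMDiffAt I (I'.prod 𝓘(ℝ, G)) ∞ (fun x ↦ (⟨f x, s x⟩ : TotalSpace G W)) x) (i) :
    ContMDiffAt I 𝓘(ℝ, ℝ) ∞ (fun x ↦ e.coord i (f x) (s x)) x :=
  ContMDiffAt.comp x (e.contMDiffAt_coord i ⟨f x, s x⟩ hx) hs

/-- Two combinations of the frame with equal values have equal coefficients. -/
theorem GlobalFrame.coeff_eq {x₀ x : M} (e : GlobalFrame I F V x₀) (hx : x ∈ e.U)
    {a b : Fin e.n → ℝ} (h : ∑ i, a i • e.sec i x = ∑ i, b i • e.sec i x) : a = b := by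
  funext i
  have h1 (a : Fin e.n → ℝ) : e.coord i x (∑ j, a j • e.sec j x) = a i := by
    simp [map_sum, e.coord_sec x hx]
  rw [← h1 a, h, h1 b]

/-- Every smooth section along `f` is locally a combination of pulled back sections. -/
theorem exists_isLocalExpansion [FiniteDimensional ℝ E] [T2Space M] [IsManifold I ∞ M]
    [FiniteDimensional ℝ E'] [T2Space N] [IsManifold I' ∞ N] [FiniteDimensional ℝ G]
    [ContMDiffVectorBundle ∞ G W I'] {f : M → N} {s : ∀ x, W (f x)} {U : Set M} {x₀ : M}
    (hU : IsOpen U) (hx₀ : x₀ ∈ U)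
    (hs : ContMDiffOn I (I'.prod 𝓘(ℝ, G)) ∞ (fun x ↦ (⟨f x, s x⟩ : TotalSpace G W)) U) :
    ∃ (k : ℕ) (h : Fin k → C^∞⟮I, M; 𝓘(ℝ, ℝ), ℝ⟯) (b : Fin k → Cₛ^∞⟮I'; G, W⟯),
      LieAlgebroid.IsLocalExpansion f s x₀ h b := by
  obtain ⟨e⟩ := nonempty_globalFrame I' G W (f x₀)
  have hsA (x) (hx : x ∈ U) := hs.contMDiffAt (hU.mem_nhds hx)
  have hf : ContinuousOn f U := fun x hx ↦
    (contMDiffAt_along_iff.1 (hsA x hx)).1.continuousAt.continuousWithinAt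
  have hO : IsOpen (U ∩ f ⁻¹' e.U) := hf.isOpen_inter_preimage hU e.isOpen
  have h1 (i) : ∃ h : C^∞⟮I, M; 𝓘(ℝ, ℝ), ℝ⟯, h =ᶠ[𝓝 x₀] fun x ↦ e.coord i (f x) (s x) :=
    exists_contMDiffMap_eventuallyEq hO ⟨hx₀, e.mem⟩ fun x hx ↦
      (e.contMDiffAt_coord_along hx.2 (hsA x hx.1) i).contMDiffWithinAt
  choose h hh using h1
  refine ⟨e.n, h, e.sec, ?_⟩
  filter_upwards [Filter.eventually_all.2 hh, hO.mem_nhds ⟨hx₀, e.mem⟩] with x hx hxO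
  simp only [hx]
  exact (e.sum_coord _ hxO.2 _).symm

/-- There is a global smooth section through every point of a vector bundle. -/
theorem exists_contMDiffSection_apply_eq [FiniteDimensional ℝ E] [FiniteDimensional ℝ F]
    [T2Space M] [IsManifold I ∞ M] [ContMDiffVectorBundle ∞ F V I] (x : M) (v : V x) :
    ∃ s : Cₛ^∞⟮I; F, V⟯, s x = v := by
  obtain ⟨e⟩ := nonempty_globalFrame I F V x
  refine ⟨∑ i, e.coord i x v • e.sec i, ?_⟩
  have h1 (S : Finset (Fin e.n)) (c : Fin e.n → ℝ) :
      (∑ i ∈ S, c i • e.sec i : Cₛ^∞⟮I; F, V⟯) x = ∑ i ∈ S, c i • e.sec i x := by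
    have := map_sum (ContMDiffSection.coeAddHom I F ∞ V) (fun i ↦ c i • e.sec i) S
    exact (congrFun this x).trans (by simp)
  rw [h1]
  exact e.sum_coord x e.mem v

/-! ### Bundle morphisms -/

/-- A fibrewise linear map which maps smooth sections to smooth sections along `f` is smooth. -/
theorem contMDiff_of_map_section [FiniteDimensional ℝ E] [FiniteDimensional ℝ F]
    [T2Space M] [IsManifold I ∞ M] [ContMDiffVectorBundle ∞ F V I]
    {f : M → N} (hf : ContMDiff I I' ∞ f) (Θ : ∀ x, V x →ₗ[ℝ] W (f x))
    (h : ∀ s : Cₛ^∞⟮I; F, V⟯, ContMDiff I (I'.prod 𝓘(ℝ, G)) ∞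
      (fun x ↦ (⟨f x, Θ x (s x)⟩ : TotalSpace G W))) :
    ContMDiff (I.prod 𝓘(ℝ, F)) (I'.prod 𝓘(ℝ, G)) ∞
      (fun v : TotalSpace F V ↦ (⟨f v.proj, Θ v.proj v.2⟩ : TotalSpace G W)) := by
  intro v
  obtain ⟨e⟩ := nonempty_globalFrame I F V v.proj
  have hp : ContMDiff (I.prod 𝓘(ℝ, F)) I ∞ (π F V) := contMDiff_proj V
  have h1 : ContMDiffAt (I.prod 𝓘(ℝ, F)) (I'.prod 𝓘(ℝ, G)) ∞ (fun w : TotalSpace F V ↦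
      (⟨f w.proj, ∑ i, e.coord i w.proj w.2 • Θ w.proj (e.sec i w.proj)⟩ : TotalSpace G W)) v :=
    ContMDiffAt.sum_along (f := fun w : TotalSpace F V ↦ f w.proj)
      (σ := fun i w ↦ e.coord i w.proj w.2 • Θ w.proj (e.sec i w.proj)) _
      ((hf.comp hp) v) fun i ↦ (e.contMDiffAt_coord i v e.mem).smul_along
        (f := fun w : TotalSpace F V ↦ f w.proj) (s := fun w ↦ Θ w.proj (e.sec i w.proj))
        (((h (e.sec i)).comp hp) v)
  refine h1.congr_of_eventuallyEq ?_
  filter_upwards [(FiberBundle.continuous_proj F V).continuousAt.eventually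
    (e.isOpen.mem_nhds e.mem)] with w hw
  have h2 := congrArg (Θ w.proj) (e.sum_coord w.proj hw w.2)
  rw [map_sum] at h2
  simp only [map_smul] at h2
  rw [h2]

section Reflect

variable {E₂ : Type*} [NormedAddCommGroup E₂] [NormedSpace ℝ E₂]
  {H₂ : Type*} [TopologicalSpace H₂] {I₂ : ModelWithCorners ℝ E₂ H₂}
  {N₂ : Type*} [TopologicalSpace N₂] [ChartedSpace H₂ N₂]
  {G₂ : Type*} [NormedAddCommGroup G₂] [NormedSpace ℝ G₂]
  {W₂ : N₂ → Type*} [TopologicalSpace (TotalSpace G₂ W₂)] [∀ x, AddCommGroup (W₂ x)]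
  [∀ x, Module ℝ (W₂ x)] [∀ x, TopologicalSpace (W₂ x)] [FiberBundle G₂ W₂] [VectorBundle ℝ G₂ W₂]
  {E₃ : Type*} [NormedAddCommGroup E₃] [NormedSpace ℝ E₃]
  {H₃ : Type*} [TopologicalSpace H₃] {I₃ : ModelWithCorners ℝ E₃ H₃}
  {P : Type*} [TopologicalSpace P] [ChartedSpace H₃ P]

/-- Two smooth vector bundle morphisms which are jointly injective on fibres reflect smoothness of
sections along a map. -/
theorem contMDiffAt_along_of_injective [FiniteDimensional ℝ F] [FiniteDimensional ℝ G]
    [FiniteDimensional ℝ G₂] [IsManifold I ∞ M] [IsManifold I' ∞ N] [IsManifold I₂ ∞ N₂]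
    [ContMDiffVectorBundle ∞ F V I] [ContMDiffVectorBundle ∞ G W I']
    [ContMDiffVectorBundle ∞ G₂ W₂ I₂] {f₁ : M → N} {f₂ : M → N₂}
    {Ψ₁ : ∀ x, V x →ₗ[ℝ] W (f₁ x)} {Ψ₂ : ∀ x, V x →ₗ[ℝ] W₂ (f₂ x)}
    (hf₁ : Continuous f₁) (hf₂ : Continuous f₂)
    (hΨ₁ : ContMDiff (I.prod 𝓘(ℝ, F)) (I'.prod 𝓘(ℝ, G)) ∞
      (fun v : TotalSpace F V ↦ (⟨f₁ v.proj, Ψ₁ v.proj v.2⟩ : TotalSpace G W)))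
    (hΨ₂ : ContMDiff (I.prod 𝓘(ℝ, F)) (I₂.prod 𝓘(ℝ, G₂)) ∞
      (fun v : TotalSpace F V ↦ (⟨f₂ v.proj, Ψ₂ v.proj v.2⟩ : TotalSpace G₂ W₂)))
    (hinj : ∀ x (v : V x), Ψ₁ x v = 0 → Ψ₂ x v = 0 → v = 0)
    {g : P → M} {p₀ : P} (hg : ContMDiffAt I₃ I ∞ g p₀) {s : ∀ p, V (g p)}
    (h₁ : ContMDiffAt I₃ (I'.prod 𝓘(ℝ, G)) ∞
      (fun p ↦ (⟨f₁ (g p), Ψ₁ (g p) (s p)⟩ : TotalSpace G W)) p₀)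
    (h₂ : ContMDiffAt I₃ (I₂.prod 𝓘(ℝ, G₂)) ∞
      (fun p ↦ (⟨f₂ (g p), Ψ₂ (g p) (s p)⟩ : TotalSpace G₂ W₂)) p₀) :
    ContMDiffAt I₃ (I.prod 𝓘(ℝ, F)) ∞ (fun p ↦ (⟨g p, s p⟩ : TotalSpace F V)) p₀ := by
  refine contMDiffAt_along_iff.2 ⟨hg, ?_⟩
  rw [contMDiffAt_along_iff] at h₁ h₂
  set x₀ := g p₀
  let e := trivializationAt F V x₀
  let e₁ := trivializationAt G W (f₁ x₀)
  let e₂ := trivializationAt G₂ W₂ (f₂ x₀)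
  let C₁ : M → F →L[ℝ] G := LieAlgebroid.coordMap (F := F) (G := G) Ψ₁ x₀ (f₁ x₀)
  let C₂ : M → F →L[ℝ] G₂ := LieAlgebroid.coordMap (F := F) (G := G₂) Ψ₂ x₀ (f₂ x₀)
  let U : Set M := e.baseSet ∩ (f₁ ⁻¹' e₁.baseSet ∩ f₂ ⁻¹' e₂.baseSet)
  have hU : IsOpen U := e.open_baseSet.inter
    ((e₁.open_baseSet.preimage hf₁).inter (e₂.open_baseSet.preimage hf₂))
  have hx₀ : x₀ ∈ U := ⟨mem_baseSet_trivializationAt F V x₀, mem_baseSet_trivializationAt G W _,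
    mem_baseSet_trivializationAt G₂ W₂ _⟩
  have hC₁ : ContMDiffAt I 𝓘(ℝ, F →L[ℝ] G) ∞ C₁ x₀ :=
    ((LieAlgebroid.contMDiffOn_coordMap hΨ₁ x₀ (f₁ x₀)).mono fun x hx ↦ ⟨hx.1, hx.2.1⟩).contMDiffAt
      (hU.mem_nhds hx₀)
  have hC₂ : ContMDiffAt I 𝓘(ℝ, F →L[ℝ] G₂) ∞ C₂ x₀ :=
    ((LieAlgebroid.contMDiffOn_coordMap hΨ₂ x₀ (f₂ x₀)).mono fun x hx ↦ ⟨hx.1, hx.2.2⟩).contMDiffAt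
      (hU.mem_nhds hx₀)
  have k₁ (x) (hx : x ∈ U) (v : V x) : C₁ x (e ⟨x, v⟩).2 = (e₁ ⟨f₁ x, Ψ₁ x v⟩).2 :=
    LieAlgebroid.coordMap_apply_mk Ψ₁ x₀ (f₁ x₀) hx.1 hx.2.1 v
  have k₂ (x) (hx : x ∈ U) (v : V x) : C₂ x (e ⟨x, v⟩).2 = (e₂ ⟨f₂ x, Ψ₂ x v⟩).2 :=
    LieAlgebroid.coordMap_apply_mk Ψ₂ x₀ (f₂ x₀) hx.1 hx.2.2 v
  -- a left inverse of the coordinate expression of `(Ψ₁, Ψ₂)` at `x₀`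
  have hL : Function.Injective ((C₁ x₀).prod (C₂ x₀) : F →ₗ[ℝ] G × G₂) := by
    refine (injective_iff_map_eq_zero _).2 fun w hw ↦ ?_
    obtain ⟨v, rfl⟩ : ∃ v : V x₀, (e ⟨x₀, v⟩).2 = w :=
      ⟨e.symm x₀ w, by rw [e.apply_mk_symm hx₀.1]⟩
    have hw1 : C₁ x₀ (e ⟨x₀, v⟩).2 = 0 := congrArg Prod.fst hw
    have hw2 : C₂ x₀ (e ⟨x₀, v⟩).2 = 0 := congrArg Prod.snd hw
    rw [k₁ x₀ hx₀] at hw1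
    rw [k₂ x₀ hx₀] at hw2
    have hv : v = 0 := by
      refine hinj x₀ v ?_ ?_
      · exact (e₁.continuousLinearEquivAt ℝ _ hx₀.2.1).injective
          (hw1.trans (map_zero (e₁.continuousLinearEquivAt ℝ _ hx₀.2.1)).symm)
      · exact (e₂.continuousLinearEquivAt ℝ _ hx₀.2.2).injective
          (hw2.trans (map_zero (e₂.continuousLinearEquivAt ℝ _ hx₀.2.2)).symm)
    rw [hv]
    exact map_zero (e.continuousLinearEquivAt ℝ _ hx₀.1)
  obtain ⟨R, hR⟩ := LinearMap.exists_leftInverse_of_injective _ (LinearMap.ker_eq_bot.2 hL)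
  let R₁ : G →L[ℝ] F := LinearMap.toContinuousLinearMap (R ∘ₗ LinearMap.inl ℝ G G₂)
  let R₂ : G₂ →L[ℝ] F := LinearMap.toContinuousLinearMap (R ∘ₗ LinearMap.inr ℝ G G₂)
  have hR₁₂ (a : G) (b : G₂) : R₁ a + R₂ b = R (a, b) := by
    simp [R₁, R₂, ← map_add]
  let T : M → F →L[ℝ] F := fun x ↦ R₁.comp (C₁ x) + R₂.comp (C₂ x)
  have hT : ContMDiffAt I 𝓘(ℝ, F →L[ℝ] F) ∞ T x₀ :=
    (contMDiffAt_const.clm_comp hC₁).add (contMDiffAt_const.clm_comp hC₂)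
  have hT₀ : T x₀ = (ContinuousLinearEquiv.refl ℝ F : F →L[ℝ] F) := by
    ext w
    refine (hR₁₂ _ _).trans ?_
    exact LinearMap.congr_fun hR w
  have hinv : ContMDiffAt I₃ 𝓘(ℝ, F →L[ℝ] F) ∞
      (fun p ↦ ContinuousLinearMap.inverse (T (g p))) p₀ := by
    have h3 : ContDiffAt ℝ ∞ (ContinuousLinearMap.inverse : (F →L[ℝ] F) → _) (T x₀) := by
      rw [hT₀]; exact contDiffAt_map_inverse _
    exact h3.contMDiffAt.comp p₀ (hT.comp p₀ hg)
  have hnear : ∀ᶠ x in 𝓝 x₀, x ∈ U ∧ T x ∈ Set.range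
      ((↑) : (F ≃L[ℝ] F) → F →L[ℝ] F) :=
    Filter.inter_mem (hU.mem_nhds hx₀) (hT.continuousAt.preimage_mem_nhds
      (ContinuousLinearEquiv.isOpen.mem_nhds ⟨_, hT₀.symm⟩))
  have hrhs : ContMDiffAt I₃ 𝓘(ℝ, F) ∞ (fun p ↦ ContinuousLinearMap.inverse (T (g p))
      (R₁ (e₁ ⟨f₁ (g p), Ψ₁ (g p) (s p)⟩).2 + R₂ (e₂ ⟨f₂ (g p), Ψ₂ (g p) (s p)⟩).2)) p₀ :=
    hinv.clm_apply ((contMDiffAt_const.clm_apply h₁.2).add (contMDiffAt_const.clm_apply h₂.2))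
  refine hrhs.congr_of_eventuallyEq ?_
  filter_upwards [hg.continuousAt.eventually hnear] with p ⟨hpU, A, hA⟩
  rw [← k₁ _ hpU, ← k₂ _ hpU]
  change _ = ContinuousLinearMap.inverse (T (g p)) (T (g p) (e ⟨g p, s p⟩).2)
  rw [← hA, ContinuousLinearMap.inverse_equiv]
  simp [e]

end Reflect

/-- The inverse of a smooth fibrewise linear isomorphism over the identity is smooth. -/
theorem contMDiff_bundle_symm [FiniteDimensional ℝ E] [T2Space M] [IsManifold I ∞ M]
    [FiniteDimensional ℝ F] [ContMDiffVectorBundle ∞ F V I]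
    {F' : Type*} [NormedAddCommGroup F'] [NormedSpace ℝ F'] [FiniteDimensional ℝ F']
    {V' : M → Type*} [TopologicalSpace (TotalSpace F' V')] [∀ x, AddCommGroup (V' x)]
    [∀ x, Module ℝ (V' x)] [∀ x, TopologicalSpace (V' x)] [FiberBundle F' V']
    [VectorBundle ℝ F' V'] [ContMDiffVectorBundle ∞ F' V' I] (Θ : ∀ x, V x ≃ₗ[ℝ] V' x)
    (hΘ : ContMDiff (I.prod 𝓘(ℝ, F)) (I.prod 𝓘(ℝ, F')) ∞
      (fun v : TotalSpace F V ↦ (⟨v.proj, (Θ v.proj : V v.proj →ₗ[ℝ] V' v.proj) v.2⟩ :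
        TotalSpace F' V'))) :
    ContMDiff (I.prod 𝓘(ℝ, F')) (I.prod 𝓘(ℝ, F)) ∞
      (fun v : TotalSpace F' V' ↦ (⟨v.proj, (Θ v.proj).symm v.2⟩ : TotalSpace F V)) := by
  refine contMDiff_of_map_section (f := fun x : M ↦ x) (W := V) contMDiff_id
    (fun x ↦ ((Θ x).symm : V' x →ₗ[ℝ] V x)) fun s x ↦ ?_
  refine contMDiffAt_along_of_injective (W := V') (W₂ := V') (f₁ := fun x : M ↦ x)
    (f₂ := fun x : M ↦ x) (Ψ₁ := fun x ↦ (Θ x : V x →ₗ[ℝ] V' x))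
    (Ψ₂ := fun x ↦ (Θ x : V x →ₗ[ℝ] V' x)) (g := fun x : M ↦ x)
    (s := fun x ↦ (Θ x).symm (s x)) continuous_id continuous_id hΘ hΘ
    (fun x v hv _ ↦ (Θ x).map_eq_zero_iff.1 hv) contMDiffAt_id ?_ ?_ <;>
  · simpa using s.contMDiff x

end VectorBundles

/-! ### Derivatives of functions along vector fields -/

section Derivatives

variable {E : Type*} [NormedAddCommGroup E] [NormedSpace ℝ E]
  {H : Type*} [TopologicalSpace H] {I : ModelWithCorners ℝ E H}
  {M : Type*} [TopologicalSpace M] [ChartedSpace H M] [IsManifold I ∞ M]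
  {F : Type*} [NormedAddCommGroup F] [NormedSpace ℝ F]
  {V : M → Type*} [TopologicalSpace (TotalSpace F V)] [∀ x, AddCommGroup (V x)]
  [∀ x, Module ℝ (V x)] [∀ x, TopologicalSpace (V x)] [FiberBundle F V] [VectorBundle ℝ F V]
  {E' : Type*} [NormedAddCommGroup E'] [NormedSpace ℝ E']
  {H' : Type*} [TopologicalSpace H'] {I' : ModelWithCorners ℝ E' H'}
  {N : Type*} [TopologicalSpace N] [ChartedSpace H' N] [IsManifold I' ∞ N]
  {G : Type*} [NormedAddCommGroup G] [NormedSpace ℝ G]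
  {W : N → Type*} [TopologicalSpace (TotalSpace G W)] [∀ x, AddCommGroup (W x)]
  [∀ x, Module ℝ (W x)] [∀ x, TopologicalSpace (W x)] [FiberBundle G W] [VectorBundle ℝ G W]

theorem mvfderiv_congr {g g' : M → ℝ} {x : M} (h : g =ᶠ[𝓝 x] g') :
    mvfderiv I g x = mvfderiv I g' x := by
  ext v
  exact congrArg (fun L : E →L[ℝ] ℝ ↦ L v) (h.mfderiv_eq (I := I) (I' := 𝓘(ℝ, ℝ)))

theorem mvfderiv_sum_apply {ι : Type*} (S : Finset ι) {g : ι → M → ℝ} {x : M}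
    (hg : ∀ i, MDifferentiableAt I 𝓘(ℝ, ℝ) (g i) x) (v : TangentSpace I x) :
    mvfderiv I (fun x ↦ ∑ i ∈ S, g i x) x v = ∑ i ∈ S, mvfderiv I (g i) x v := by
  have h : MDifferentiableAt I 𝓘(ℝ, ℝ) (fun x ↦ ∑ i ∈ S, g i x) x ∧
      mvfderiv I (fun x ↦ ∑ i ∈ S, g i x) x v = ∑ i ∈ S, mvfderiv I (g i) x v := by
    classical
    induction S using Finset.induction_on with
    | empty => simpa using ⟨mdifferentiableAt_const, by rw [mvfderiv_const]; rfl⟩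
    | insert i S hi ih =>
      simp only [Finset.sum_insert hi]
      refine ⟨(hg i).add ih.1, ?_⟩
      rw [mvfderiv_fun_add (hg i) ih.1, add_apply, ih.2]
  exact h.2

theorem mvfderiv_mul_apply {g g' : M → ℝ} {x : M} (hg : MDifferentiableAt I 𝓘(ℝ, ℝ) g x)
    (hg' : MDifferentiableAt I 𝓘(ℝ, ℝ) g' x) (v : TangentSpace I x) :
    mvfderiv I (fun x ↦ g x * g' x) x v = g x * mvfderiv I g' x v + g' x * mvfderiv I g x v := by
  rw [mvfderiv_fun_mul hg hg']; rfl

theorem contMDiff_mvfderiv {X : ∀ x : M, TangentSpace I x} {x : M}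
    (hX : ContMDiffAt I I.tangent ∞ (fun x ↦ (⟨x, X x⟩ : TangentBundle I M)) x)
    (g : C^∞⟮I, M; 𝓘(ℝ, ℝ), ℝ⟯) :
    ContMDiffAt I 𝓘(ℝ, ℝ) ∞ (fun x ↦ mvfderiv I g x (X x)) x := by
  have h1 := (g.contMDiff.contMDiff_tangentMap (m := ∞) le_rfl)
  have h2 := (contMDiff_snd_tangentBundle_modelSpace ℝ 𝓘(ℝ, ℝ) (n := ∞)).comp h1
  exact ContMDiffAt.comp x (h2 _) hX

/-- The derivative `X g` of a smooth function along a smooth vector field. -/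
noncomputable def dirDeriv (X : Cₛ^∞⟮I; E, (TangentSpace I : M → Type _)⟯)
    (g : C^∞⟮I, M; 𝓘(ℝ, ℝ), ℝ⟯) : C^∞⟮I, M; 𝓘(ℝ, ℝ), ℝ⟯ :=
  ⟨fun x ↦ mvfderiv I g x (X x), fun x ↦ contMDiff_mvfderiv (X.contMDiff x) g⟩

theorem dirDeriv_apply (X : Cₛ^∞⟮I; E, (TangentSpace I : M → Type _)⟯)
    (g : C^∞⟮I, M; 𝓘(ℝ, ℝ), ℝ⟯) (x : M) : dirDeriv X g x = mvfderiv I g x (X x) := rfl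

theorem smulSection_apply (g : C^∞⟮I, M; 𝓘(ℝ, ℝ), ℝ⟯) (s : Cₛ^∞⟮I; F, V⟯) (x : M) :
    smulSection g s x = g x • s x := rfl

theorem ContMDiffSection.sum_apply {ι : Type*} (S : Finset ι) (s : ι → Cₛ^∞⟮I; F, V⟯) (x : M) :
    (∑ i ∈ S, s i) x = ∑ i ∈ S, s i x := by
  have := map_sum (ContMDiffSection.coeAddHom I F ∞ V) s S
  exact (congrFun this x).trans (by simp)

/-- A tangent vector is zero if it annihilates all smooth functions. -/
theorem tangent_eq_zero_of_forall_mvfderiv [FiniteDimensional ℝ E] [T2Space M] {x : M}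
    {v : TangentSpace I x} (h : ∀ g : C^∞⟮I, M; 𝓘(ℝ, ℝ), ℝ⟯, mvfderiv I g x v = 0) : v = 0 := by
  have hinv := isInvertible_mfderiv_extChartAt (I := I) (mem_extChartAt_source (I := I) x)
  obtain ⟨L, hL⟩ := hinv
  have h1 : mfderiv I 𝓘(ℝ, E) (extChartAt I x) x v = 0 := by
    refine (SeparatingDual.eq_zero_iff_forall_dual_eq_zero (R := ℝ) (V := E) _).2 fun l ↦ ?_
    obtain ⟨g, hg⟩ := exists_contMDiffMap_eventuallyEq (I := I) (x₀ := x)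
      (chartAt H x).open_source (mem_chart_source H x)
      (l.contDiff.contMDiff.comp_contMDiffOn (contMDiffOn_extChartAt (I := I) (x := x) (n := ∞)))
    rw [← h g, mvfderiv_congr hg]
    have h2 := mfderiv_comp_apply (I := I) (I' := 𝓘(ℝ, E)) (I'' := 𝓘(ℝ, ℝ)) x (g := l)
      (f := extChartAt I x) l.mdifferentiableAt
      (mdifferentiableAt_extChartAt (mem_chart_source H x)) v
    rw [l.mfderiv_eq] at h2
    exact h2.symm
  rw [← hL] at h1
  exact (map_eq_zero_iff L L.injective).1 h1

theorem tangent_eq_of_forall_mvfderiv [FiniteDimensional ℝ E] [T2Space M] {x : M}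
    {v w : TangentSpace I x}
    (h : ∀ g : C^∞⟮I, M; 𝓘(ℝ, ℝ), ℝ⟯, mvfderiv I g x v = mvfderiv I g x w) : v = w := by
  refine sub_eq_zero.1 (tangent_eq_zero_of_forall_mvfderiv (I := I) fun g ↦ ?_)
  rw [map_sub, h, sub_self]

/-! ### Derivations of sections at a point -/

/-- `D` is a derivation at `y` of the sections of `W`, with symbol the tangent vector `Z`. -/
def IsPointDerivation {y : N} (Z : TangentSpace I' y) (D : Cₛ^∞⟮I'; G, W⟯ →ₗ[ℝ] W y) : Prop :=
  ∀ (h : C^∞⟮I', N; 𝓘(ℝ, ℝ), ℝ⟯) (c : Cₛ^∞⟮I'; G, W⟯),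
    D (smulSection h c) = h y • D c + mvfderiv I' h y Z • c y

namespace IsPointDerivation

variable [FiniteDimensional ℝ E'] [T2Space N]
  {y : N} {Z : TangentSpace I' y} {D : Cₛ^∞⟮I'; G, W⟯ →ₗ[ℝ] W y}

theorem congr (hD : IsPointDerivation Z D) {c c' : Cₛ^∞⟮I'; G, W⟯} (h : ∀ᶠ y' in 𝓝 y, c y' = c' y') :
    D c = D c' := by
  obtain ⟨χ, hχ1, hχ⟩ := exists_cutoff (I := I') h
  have h1 : smulSection χ (c - c') = 0 := by
    ext y'
    rw [smulSection_apply]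
    by_cases hy : y' ∈ tsupport χ
    · have : c y' = c' y' := hχ hy
      simp [this]
    · simp [image_eq_zero_of_notMem_tsupport hy]
  have h2 := hD χ (c - c')
  have h3 : (c - c') y = 0 := by simp [h.self_of_nhds]
  have h4 : χ y = 1 := hχ1.self_of_nhds
  rw [h1, h3, h4] at h2
  simpa [sub_eq_zero] using h2.symm

theorem expansion [FiniteDimensional ℝ G] [ContMDiffVectorBundle ∞ G W I']
    {f : M → N} {x : M}
    {Z : TangentSpace I' (f x)} {D : Cₛ^∞⟮I'; G, W⟯ →ₗ[ℝ] W (f x)} (hD : IsPointDerivation Z D)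
    (hf : ContMDiffAt I I' ∞ f x) {X : TangentSpace I x}
    (hX : ∀ h : C^∞⟮I', N; 𝓘(ℝ, ℝ), ℝ⟯, mvfderiv I (h ∘ f) x X = mvfderiv I' h (f x) Z)
    (e : GlobalFrame I' G W (f x)) {κ : Type*} [Fintype κ] (g : κ → C^∞⟮I, M; 𝓘(ℝ, ℝ), ℝ⟯)
    (c : κ → Cₛ^∞⟮I'; G, W⟯) :
    ∑ j, g j x • D (c j) + ∑ j, mvfderiv I (g j) x X • c j (f x) =
      ∑ a, e.coord a (f x) (∑ j, g j x • c j (f x)) • D (e.sec a) +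
      ∑ a, mvfderiv I (fun x' ↦ e.coord a (f x') (∑ j, g j x' • c j (f x'))) x X • e.sec a (f x) := by
  have h1 (j : κ) (a : Fin e.n) : ∃ u : C^∞⟮I', N; 𝓘(ℝ, ℝ), ℝ⟯,
      u =ᶠ[𝓝 (f x)] fun y' ↦ e.coord a y' (c j y') :=
    exists_contMDiffMap_eventuallyEq e.isOpen e.mem fun z hz ↦
      (e.contMDiffAt_coord_along (f := fun z ↦ z) hz (c j).contMDiff.contMDiffAt
        a).contMDiffWithinAt
  choose u hu using h1
  have hc (j : κ) : ∀ᶠ y' in 𝓝 (f x), c j y' = ∑ a, u j a y' • e.sec a y' := by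
    filter_upwards [Filter.eventually_all.2 (hu j), e.isOpen.mem_nhds e.mem] with y' hy' hU
    simp only [hy']
    exact (e.sum_coord y' hU _).symm
  have hDc (j : κ) : D (c j) = ∑ a, u j a (f x) • D (e.sec a) +
      ∑ a, mvfderiv I' (u j a) (f x) Z • e.sec a (f x) := by
    rw [hD.congr (c' := ∑ a, smulSection (u j a) (e.sec a)), map_sum,
      ← Finset.sum_add_distrib]
    · exact Finset.sum_congr rfl fun a _ ↦ hD _ _
    · filter_upwards [hc j] with y' hy'
      rw [hy', ContMDiffSection.sum_apply]
      rfl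
  have hγ (a : Fin e.n) : (fun x' ↦ e.coord a (f x') (∑ j, g j x' • c j (f x'))) =ᶠ[𝓝 x]
      fun x' ↦ ∑ j, g j x' * (u j a ∘ f) x' := by
    have hu' : ∀ᶠ y' in 𝓝 (f x), ∀ j, u j a y' = e.coord a y' (c j y') :=
      Filter.eventually_all.2 fun j ↦ hu j a
    filter_upwards [hf.continuousAt.eventually hu'] with x' hx'
    rw [map_sum]
    refine Finset.sum_congr rfl fun j _ ↦ ?_
    rw [map_smul, smul_eq_mul, Function.comp_apply, hx' j]
  have hdiff (j : κ) (a : Fin e.n) : MDifferentiableAt I 𝓘(ℝ, ℝ) (u j a ∘ f) x :=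
    ((u j a).mdifferentiableAt).comp x (hf.mdifferentiableAt (by simp))
  have hdγ (a : Fin e.n) :
      mvfderiv I (fun x' ↦ e.coord a (f x') (∑ j, g j x' • c j (f x'))) x X =
        ∑ j, (g j x * mvfderiv I' (u j a) (f x) Z + u j a (f x) * mvfderiv I (g j) x X) := by
    rw [mvfderiv_congr (hγ a), mvfderiv_sum_apply (g := fun j x' ↦ g j x' * (u j a ∘ f) x') _
      fun j ↦ ((g j).mdifferentiableAt).mul (hdiff j a)]
    refine Finset.sum_congr rfl fun j _ ↦ ?_
    rw [mvfderiv_mul_apply ((g j).mdifferentiableAt) (hdiff j a), hX, Function.comp_apply]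
  have hγ0 (a : Fin e.n) : e.coord a (f x) (∑ j, g j x • c j (f x)) = ∑ j, g j x * u j a (f x) := by
    rw [map_sum]
    refine Finset.sum_congr rfl fun j _ ↦ ?_
    rw [map_smul, smul_eq_mul, (hu j a).self_of_nhds]
  simp only [hdγ, hγ0, hDc]
  have hcy (j : κ) : c j (f x) = ∑ a, u j a (f x) • e.sec a (f x) := (hc j).self_of_nhds
  simp only [hcy, Finset.smul_sum, Finset.sum_smul, add_smul, Finset.sum_add_distrib, smul_add,
    ← mul_smul]
  rw [Finset.sum_comm, Finset.sum_comm (f := fun j a ↦ (g j x * mvfderiv I' (u j a) (f x) Z) • _),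
    Finset.sum_comm (f := fun j a ↦ (mvfderiv I (g j) x X * u j a (f x)) • _)]
  simp only [mul_comm (mvfderiv I _ x X)]
  abel

/-- Let `D` be a derivation at `f x` whose symbol is the image of a tangent vector `X` at `x`. The
value of `D` on an expansion along `f`, with the coefficients differentiated along `X`, only depends
on the section along `f` which is expanded. -/
theorem expansion_congr [FiniteDimensional ℝ G] [ContMDiffVectorBundle ∞ G W I']
    {f : M → N} {x : M}
    {Z : TangentSpace I' (f x)} {D : Cₛ^∞⟮I'; G, W⟯ →ₗ[ℝ] W (f x)} (hD : IsPointDerivation Z D)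
    (hf : ContMDiffAt I I' ∞ f x) {X : TangentSpace I x}
    (hX : ∀ h : C^∞⟮I', N; 𝓘(ℝ, ℝ), ℝ⟯, mvfderiv I (h ∘ f) x X = mvfderiv I' h (f x) Z)
    {κ κ' : Type*} [Fintype κ] [Fintype κ'] {g : κ → C^∞⟮I, M; 𝓘(ℝ, ℝ), ℝ⟯}
    {c : κ → Cₛ^∞⟮I'; G, W⟯} {g' : κ' → C^∞⟮I, M; 𝓘(ℝ, ℝ), ℝ⟯} {c' : κ' → Cₛ^∞⟮I'; G, W⟯}
    (h : ∀ᶠ x' in 𝓝 x, ∑ j, g j x' • c j (f x') = ∑ j, g' j x' • c' j (f x')) :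
    ∑ j, g j x • D (c j) + ∑ j, mvfderiv I (g j) x X • c j (f x) =
      ∑ j, g' j x • D (c' j) + ∑ j, mvfderiv I (g' j) x X • c' j (f x) := by
  obtain ⟨e⟩ := nonempty_globalFrame I' G W (f x)
  rw [hD.expansion hf hX e g c, hD.expansion hf hX e g' c']
  congr 1
  · refine Finset.sum_congr rfl fun a _ ↦ ?_
    rw [h.self_of_nhds]
  · refine Finset.sum_congr rfl fun a _ ↦ ?_
    rw [mvfderiv_congr (h.mono fun x' hx' ↦ ?_)]
    exact congrArg _ hx'

end IsPointDerivation

end Derivatives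

/-! ### The anchor and the bracket of a Lie algebroid -/

section AlgebroidCalculus

variable {E : Type*} [NormedAddCommGroup E] [NormedSpace ℝ E]
  {H : Type*} [TopologicalSpace H] {I : ModelWithCorners ℝ E H}
  {M : Type*} [TopologicalSpace M] [ChartedSpace H M] [IsManifold I ∞ M]
  {F : Type*} [NormedAddCommGroup F] [NormedSpace ℝ F]
  {V : M → Type*} [TopologicalSpace (TotalSpace F V)] [∀ x, AddCommGroup (V x)]
  [∀ x, Module ℝ (V x)] [∀ x, TopologicalSpace (V x)] [FiberBundle F V] [VectorBundle ℝ F V]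
  {E' : Type*} [NormedAddCommGroup E'] [NormedSpace ℝ E']
  {H' : Type*} [TopologicalSpace H'] {I' : ModelWithCorners ℝ E' H'}
  {N : Type*} [TopologicalSpace N] [ChartedSpace H' N] [IsManifold I' ∞ N]
  {G : Type*} [NormedAddCommGroup G] [NormedSpace ℝ G]
  {W : N → Type*} [TopologicalSpace (TotalSpace G W)] [∀ x, AddCommGroup (W x)]
  [∀ x, Module ℝ (W x)] [∀ x, TopologicalSpace (W x)] [FiberBundle G W] [VectorBundle ℝ G W]

/-- Evaluation of sections at a point. -/
noncomputable def evalSection (y : N) : Cₛ^∞⟮I'; G, W⟯ →ₗ[ℝ] W y where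
  toFun c := c y
  map_add' _ _ := rfl
  map_smul' _ _ := rfl

namespace LieAlgebroid

variable (B : LieAlgebroid I' G W)

/-- The vector field `ρ ∘ a`. -/
noncomputable def anchorSection (a : Cₛ^∞⟮I'; G, W⟯) :
    Cₛ^∞⟮I'; E', (TangentSpace I' : N → Type _)⟯ :=
  ⟨fun y ↦ B.anchor y (a y), B.contMDiff_anchor.comp a.contMDiff⟩

theorem anchorSection_apply (a : Cₛ^∞⟮I'; G, W⟯) (y : N) :
    B.anchorSection a y = B.anchor y (a y) := rfl

theorem bracket_swap (a b : Cₛ^∞⟮I'; G, W⟯) : B.bracket a b = -B.bracket b a := by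
  have h := B.bracket_self (a + b)
  simp only [map_add, LinearMap.add_apply, B.bracket_self, zero_add, add_zero] at h
  exact eq_neg_of_add_eq_zero_right h

theorem bracket_smulSection (a b : Cₛ^∞⟮I'; G, W⟯) (g : C^∞⟮I', N; 𝓘(ℝ, ℝ), ℝ⟯) :
    B.bracket a (smulSection g b) =
      smulSection g (B.bracket a b) + smulSection (dirDeriv (B.anchorSection a) g) b :=
  ContMDiffSection.ext fun y ↦ B.leibniz a b g y

theorem smulSection_bracket (a b : Cₛ^∞⟮I'; G, W⟯) (g : C^∞⟮I', N; 𝓘(ℝ, ℝ), ℝ⟯) :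
    B.bracket (smulSection g a) b =
      smulSection g (B.bracket a b) - smulSection (dirDeriv (B.anchorSection b) g) a := by
  rw [bracket_swap, bracket_smulSection, B.bracket_swap b a]
  ext y
  simp [smulSection_apply, sub_eq_add_neg, add_comm]

/-- Taking brackets with `a` is a derivation at every point, with symbol the anchor of `a`. -/
theorem isPointDerivation_bracket (a : Cₛ^∞⟮I'; G, W⟯) (y : N) :
    IsPointDerivation (B.anchor y (a y)) (evalSection y ∘ₗ B.bracket a) :=
  fun h c ↦ B.leibniz a c h y

/-- The anchor maps brackets to commutators. This follows from the Jacobi identity for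
`a`, `b` and `h c`, where `c` is a section which does not vanish at the given point. -/
theorem mvfderiv_anchor_bracket [FiniteDimensional ℝ E'] [T2Space N] [FiniteDimensional ℝ G]
    [ContMDiffVectorBundle ∞ G W I'] (a b : Cₛ^∞⟮I'; G, W⟯)
    (h : C^∞⟮I', N; 𝓘(ℝ, ℝ), ℝ⟯) (y : N) :
    mvfderiv I' h y (B.anchor y (B.bracket a b y)) =
      mvfderiv I' (dirDeriv (B.anchorSection b) h) y (B.anchor y (a y)) -
        mvfderiv I' (dirDeriv (B.anchorSection a) h) y (B.anchor y (b y)) := by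
  by_cases hW : ∀ w : W y, w = 0
  · rw [hW (B.bracket a b y), hW (a y), hW (b y)]
    simp
  push Not at hW
  obtain ⟨w, hw⟩ := hW
  obtain ⟨c, rfl⟩ := exists_contMDiffSection_apply_eq (I := I') (F := G) y w
  have hJ := DFunLike.congr_fun (B.jacobi a b (smulSection h c)) y
  have hJ0 := DFunLike.congr_fun (B.jacobi a b c) y
  rw [B.smulSection_bracket, B.smulSection_bracket, B.bracket_smulSection, map_add, map_sub,
    B.bracket_smulSection, B.bracket_smulSection, B.bracket_smulSection,
    B.bracket_smulSection] at hJ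
  have hca : B.bracket c a y = -B.bracket a c y := DFunLike.congr_fun (B.bracket_swap c a) y
  simp only [ContMDiffSection.coe_add, ContMDiffSection.coe_sub, Pi.add_apply, Pi.sub_apply,
    smulSection_apply, hca, ContMDiffSection.coe_zero, Pi.zero_apply, dirDeriv_apply] at hJ hJ0
  have key : (mvfderiv I' (dirDeriv (B.anchorSection b) h) y (B.anchor y (a y)) -
      mvfderiv I' (dirDeriv (B.anchorSection a) h) y (B.anchor y (b y)) -
      mvfderiv I' h y (B.anchor y (B.bracket a b y))) • c y = 0 := by
    have h3 : h y • (B.bracket a (B.bracket b c) y + B.bracket b (B.bracket c a) y +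
      B.bracket c (B.bracket a b) y) = 0 := by rw [hJ0, smul_zero]
    have h4 := congrArg₂ (· - ·) hJ h3
    simp only [sub_zero, anchorSection_apply] at h4
    rw [← h4]
    module
  have := (smul_eq_zero.1 key).resolve_right hw
  linarith

theorem mvfderiv_mlieBracket [FiniteDimensional ℝ E] [T2Space M]
    (X Y : Cₛ^∞⟮I; E, (TangentSpace I : M → Type _)⟯) (h : C^∞⟮I, M; 𝓘(ℝ, ℝ), ℝ⟯) (x : M) :
    mvfderiv I h x (VectorField.mlieBracket I X Y x) =
      mvfderiv I (dirDeriv Y h) x (X x) - mvfderiv I (dirDeriv X h) x (Y x) :=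
  have : CompleteSpace E := FiniteDimensional.complete ℝ E
  (tangent I M).mvfderiv_anchor_bracket X Y h x

theorem anchor_bracket [FiniteDimensional ℝ E'] [T2Space N] [FiniteDimensional ℝ G]
    [ContMDiffVectorBundle ∞ G W I'] (a b : Cₛ^∞⟮I'; G, W⟯) (y : N) :
    B.anchor y (B.bracket a b y) =
      VectorField.mlieBracket I' (B.anchorSection a) (B.anchorSection b) y := by
  refine tangent_eq_of_forall_mvfderiv (I := I') fun h ↦ ?_
  rw [mvfderiv_anchor_bracket, mvfderiv_mlieBracket]
  rfl

/-! ### The bracket of expansions -/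

/-- The bracket of two sections along `f` which are given by expansions, as in
`LieAlgebroid.expandedBracket`, but with arbitrary finite index types. -/
noncomputable def expBracket (f : M → N) {x : M} (X Y : TangentSpace I x) {ι κ : Type*}
    [Fintype ι] [Fintype κ] (h : ι → C^∞⟮I, M; 𝓘(ℝ, ℝ), ℝ⟯) (b : ι → Cₛ^∞⟮I'; G, W⟯)
    (g : κ → C^∞⟮I, M; 𝓘(ℝ, ℝ), ℝ⟯) (c : κ → Cₛ^∞⟮I'; G, W⟯) : W (f x) :=
  ∑ i, ∑ j, (h i x * g j x) • B.bracket (b i) (c j) (f x) +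
    ∑ j, mvfderiv I (g j) x X • c j (f x) - ∑ i, mvfderiv I (h i) x Y • b i (f x)

theorem expandedBracket_eq (f : M → N) {x : M} (X Y : TangentSpace I x) {k l : ℕ}
    (h : Fin k → C^∞⟮I, M; 𝓘(ℝ, ℝ), ℝ⟯) (b : Fin k → Cₛ^∞⟮I'; G, W⟯)
    (g : Fin l → C^∞⟮I, M; 𝓘(ℝ, ℝ), ℝ⟯) (c : Fin l → Cₛ^∞⟮I'; G, W⟯) :
    B.expandedBracket f X Y h b g c = B.expBracket f X Y h b g c := rfl

theorem expBracket_swap (f : M → N) {x : M} (X Y : TangentSpace I x) {ι κ : Type*}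
    [Fintype ι] [Fintype κ] (h : ι → C^∞⟮I, M; 𝓘(ℝ, ℝ), ℝ⟯) (b : ι → Cₛ^∞⟮I'; G, W⟯)
    (g : κ → C^∞⟮I, M; 𝓘(ℝ, ℝ), ℝ⟯) (c : κ → Cₛ^∞⟮I'; G, W⟯) :
    B.expBracket f X Y h b g c = -B.expBracket f Y X g c h b := by
  have h1 (i : ι) (j : κ) : (h i x * g j x) • B.bracket (b i) (c j) (f x) =
      -((g j x * h i x) • B.bracket (c j) (b i) (f x)) := by
    rw [B.bracket_swap (b i), mul_comm]
    simp
  simp only [expBracket, h1, Finset.sum_neg_distrib]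
  rw [Finset.sum_comm]
  abel

section Expansion

variable [FiniteDimensional ℝ E] [T2Space M] [FiniteDimensional ℝ E'] [T2Space N]
  [FiniteDimensional ℝ G] [ContMDiffVectorBundle ∞ G W I']
  {f : M → N} {x : M} {X Y : TangentSpace I x}
  {ι κ ι' κ' : Type*} [Fintype ι] [Fintype κ] [Fintype ι'] [Fintype κ']
  {h : ι → C^∞⟮I, M; 𝓘(ℝ, ℝ), ℝ⟯} {b : ι → Cₛ^∞⟮I'; G, W⟯}
  {g : κ → C^∞⟮I, M; 𝓘(ℝ, ℝ), ℝ⟯} {c : κ → Cₛ^∞⟮I'; G, W⟯}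
  {h' : ι' → C^∞⟮I, M; 𝓘(ℝ, ℝ), ℝ⟯} {b' : ι' → Cₛ^∞⟮I'; G, W⟯}
  {g' : κ' → C^∞⟮I, M; 𝓘(ℝ, ℝ), ℝ⟯} {c' : κ' → Cₛ^∞⟮I'; G, W⟯}

theorem sum_sum_bracket_eq (h : ι → C^∞⟮I, M; 𝓘(ℝ, ℝ), ℝ⟯) (b : ι → Cₛ^∞⟮I'; G, W⟯)
    (g : κ → C^∞⟮I, M; 𝓘(ℝ, ℝ), ℝ⟯) (c : κ → Cₛ^∞⟮I'; G, W⟯) :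
    ∑ i, ∑ j, (h i x * g j x) • B.bracket (b i) (c j) (f x) =
      ∑ j, g j x • (evalSection (f x) ∘ₗ ∑ i, h i x • B.bracket (b i)) (c j) := by
  rw [Finset.sum_comm]
  refine Finset.sum_congr rfl fun j _ ↦ ?_
  simp only [LinearMap.comp_apply, LinearMap.sum_apply, LinearMap.smul_apply, map_sum, map_smul,
    Finset.smul_sum, ← mul_smul, mul_comm (g j x)]
  rfl

theorem expBracket_congr_right (hf : ContMDiffAt I I' ∞ f x)
    (hX : mfderiv I I' f x X = B.anchor (f x) (∑ i, h i x • b i (f x)))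
    (hgc : ∀ᶠ x' in 𝓝 x, ∑ j, g j x' • c j (f x') = ∑ j, g' j x' • c' j (f x')) :
    B.expBracket f X Y h b g c = B.expBracket f X Y h b g' c' := by
  have hD : IsPointDerivation (mfderiv I I' f x X)
      (evalSection (f x) ∘ₗ ∑ i, h i x • B.bracket (b i)) := by
    intro u s
    have h1 := fun i ↦ B.isPointDerivation_bracket (b i) (f x) u s
    simp only [LinearMap.comp_apply] at h1
    simp only [LinearMap.comp_apply, LinearMap.sum_apply, LinearMap.smul_apply, map_sum, map_smul,
      h1, hX, smul_add, Finset.sum_add_distrib, Finset.smul_sum, Finset.sum_smul, smul_eq_mul,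
      mul_smul]
    congr 1
    exact Finset.sum_congr rfl fun i _ ↦ smul_comm _ _ _
  have h2 := hD.expansion_congr hf (X := X)
    (fun u ↦ mvfderiv_comp_apply x u.mdifferentiableAt (hf.mdifferentiableAt (by simp)) X) hgc
  rw [expBracket, expBracket, sum_sum_bracket_eq, sum_sum_bracket_eq, h2]

/-- The bracket of expansions only depends on the sections along `f` which are expanded. -/
theorem expBracket_congr (hf : ContMDiffAt I I' ∞ f x)
    (hX : mfderiv I I' f x X = B.anchor (f x) (∑ i, h i x • b i (f x)))
    (hY : mfderiv I I' f x Y = B.anchor (f x) (∑ j, g j x • c j (f x)))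
    (hhb : ∀ᶠ x' in 𝓝 x, ∑ i, h i x' • b i (f x') = ∑ i, h' i x' • b' i (f x'))
    (hgc : ∀ᶠ x' in 𝓝 x, ∑ j, g j x' • c j (f x') = ∑ j, g' j x' • c' j (f x')) :
    B.expBracket f X Y h b g c = B.expBracket f X Y h' b' g' c' := by
  rw [B.expBracket_congr_right hf hX hgc, B.expBracket_swap, B.expBracket_swap f X Y h' b' g' c',
    B.expBracket_congr_right hf (hY.trans (congrArg _ hgc.self_of_nhds)) hhb]

theorem mvfderiv_comp_of_contMDiff (hf : ContMDiff I I' ∞ f) (w : C^∞⟮I', N; 𝓘(ℝ, ℝ), ℝ⟯)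
    (v : TangentSpace I x) :
    mvfderiv I (w ∘ f) x v = mvfderiv I' w (f x) (mfderiv I I' f x v) :=
  mvfderiv_comp_apply x w.mdifferentiableAt (hf.mdifferentiable (by simp) x) v

theorem mvfderiv_dirDeriv_comp (hf : ContMDiff I I' ∞ f) (u : C^∞⟮I', N; 𝓘(ℝ, ℝ), ℝ⟯)
    (Y : Cₛ^∞⟮I; E, (TangentSpace I : M → Type _)⟯)
    (hY : ∀ᶠ x' in 𝓝 x, mfderiv I I' f x' (Y x') = B.anchor (f x') (∑ j, g j x' • c j (f x')))
    (v : TangentSpace I x) :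
    mvfderiv I (dirDeriv Y (u.comp ⟨f, hf⟩)) x v =
      ∑ j, (g j x * mvfderiv I' (dirDeriv (B.anchorSection (c j)) u) (f x)
        (mfderiv I I' f x v) + mvfderiv I' u (f x) (B.anchor (f x) (c j (f x))) *
          mvfderiv I (g j) x v) := by
  have h1 : dirDeriv Y (u.comp ⟨f, hf⟩) =ᶠ[𝓝 x]
      fun x' ↦ ∑ j, g j x' * (dirDeriv (B.anchorSection (c j)) u ∘ f) x' := by
    filter_upwards [hY] with x' hx'
    refine (mvfderiv_comp_of_contMDiff hf u _).trans ?_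
    rw [hx', map_sum, map_sum]
    simp only [map_smul, smul_eq_mul]
    rfl
  have hd (j : κ) : MDifferentiableAt I 𝓘(ℝ, ℝ) (dirDeriv (B.anchorSection (c j)) u ∘ f) x :=
    (ContMDiffMap.mdifferentiableAt _).comp x (hf.mdifferentiable (by simp) x)
  rw [mvfderiv_congr h1, mvfderiv_sum_apply (g := fun j x' ↦
    g j x' * (dirDeriv (B.anchorSection (c j)) u ∘ f) x') _
      fun j ↦ (g j).mdifferentiableAt.mul (hd j)]
  refine Finset.sum_congr rfl fun j _ ↦ ?_
  rw [mvfderiv_mul_apply (g j).mdifferentiableAt (hd j), mvfderiv_comp_of_contMDiff hf]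
  rfl

/-- The tangent map of `f` maps the Lie bracket of `X` and `Y` to the anchor of the bracket of
the expansions of sections along `f` which cover `X` and `Y`. -/
theorem mfderiv_mlieBracket_eq_anchor_expBracket (hf : ContMDiff I I' ∞ f)
    (X Y : Cₛ^∞⟮I; E, (TangentSpace I : M → Type _)⟯)
    (hX : ∀ᶠ x' in 𝓝 x, mfderiv I I' f x' (X x') = B.anchor (f x') (∑ i, h i x' • b i (f x')))
    (hY : ∀ᶠ x' in 𝓝 x, mfderiv I I' f x' (Y x') = B.anchor (f x') (∑ j, g j x' • c j (f x'))) :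
    mfderiv I I' f x (VectorField.mlieBracket I X Y x) =
      B.anchor (f x) (B.expBracket f (X x) (Y x) h b g c) := by
  refine tangent_eq_of_forall_mvfderiv (I := I') fun u ↦ ?_
  rw [← mvfderiv_comp_of_contMDiff hf]
  refine (mvfderiv_mlieBracket X Y (u.comp ⟨f, hf⟩) x).trans ?_
  rw [B.mvfderiv_dirDeriv_comp hf u Y hY, B.mvfderiv_dirDeriv_comp hf u X hX, hX.self_of_nhds,
    hY.self_of_nhds, expBracket]
  simp only [map_sum, map_add, map_sub, map_smul, mvfderiv_anchor_bracket, smul_eq_mul,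
    Finset.sum_add_distrib, Finset.mul_sum, mul_sub, Finset.sum_sub_distrib, ← mul_assoc]
  rw [Finset.sum_comm (f := fun j i ↦ g j x * h i x * _)]
  simp only [mul_comm (g _ x) (h _ x),
    mul_comm (mvfderiv I' u (f x) _) (mvfderiv I (DFunLike.coe _) x _)]
  abel

/-- Lie brackets of `f`-related vector fields are `f`-related. -/
theorem mfderiv_mlieBracket_of_related (hf : ContMDiff I I' ∞ f)
    (X Y : Cₛ^∞⟮I; E, (TangentSpace I : M → Type _)⟯)
    (X' Y' : Cₛ^∞⟮I'; E', (TangentSpace I' : N → Type _)⟯)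
    (hX : ∀ x, mfderiv I I' f x (X x) = X' (f x)) (hY : ∀ x, mfderiv I I' f x (Y x) = Y' (f x)) :
    mfderiv I I' f x (VectorField.mlieBracket I X Y x) =
      VectorField.mlieBracket I' X' Y' (f x) := by
  have : CompleteSpace E' := FiniteDimensional.complete ℝ E'
  have h1 (v : TangentSpace I x) : mvfderiv I (1 : C^∞⟮I, M; 𝓘(ℝ, ℝ), ℝ⟯) x v = 0 := by
    rw [ContMDiffMap.coe_one]
    exact congrArg (fun L : E →L[ℝ] ℝ ↦ L v) (mvfderiv_const (I := I) (M := M) (1 : ℝ) (x := x))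
  refine ((tangent I' N).mfderiv_mlieBracket_eq_anchor_expBracket (ι := Unit) (κ := Unit)
    (h := fun _ ↦ 1) (b := fun _ ↦ X') (g := fun _ ↦ 1) (c := fun _ ↦ Y') hf X Y
    (Filter.Eventually.of_forall fun x' ↦ ?_) (Filter.Eventually.of_forall fun x' ↦ ?_)).trans ?_
  · simpa using! hX x'
  · simpa using! hY x'
  · simp only [expBracket, h1]
    simp
    rfl

/-- Lie algebroid morphisms are compatible with brackets of expansions with arbitrary finite index
types. -/
theorem _root_.LieAlgebroid.IsMorphism.map_bracket {A : LieAlgebroid I F V}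
    {Φ : ∀ x, V x →ₗ[ℝ] W (f x)} (hΦ : IsMorphism A B f Φ) (a₁ a₂ : Cₛ^∞⟮I; F, V⟯)
    (h₁ : ∀ᶠ x' in 𝓝 x, Φ x' (a₁ x') = ∑ i, h i x' • b i (f x'))
    (h₂ : ∀ᶠ x' in 𝓝 x, Φ x' (a₂ x') = ∑ j, g j x' • c j (f x')) :
    Φ x (A.bracket a₁ a₂ x) =
      B.expBracket f (A.anchor x (a₁ x)) (A.anchor x (a₂ x)) h b g c := by
  let e₁ := (Fintype.equivFin ι).symm
  let e₂ := (Fintype.equivFin κ).symm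
  have h₁' (x' : M) : ∑ i, h (e₁ i) x' • b (e₁ i) (f x') = ∑ i, h i x' • b i (f x') :=
    e₁.sum_comp fun i ↦ h i x' • b i (f x')
  have h₂' (x' : M) : ∑ i, g (e₂ i) x' • c (e₂ i) (f x') = ∑ i, g i x' • c i (f x') :=
    e₂.sum_comp fun i ↦ g i x' • c i (f x')
  rw [hΦ.bracket a₁ a₂ x (h ∘ e₁) (b ∘ e₁) (g ∘ e₂) (c ∘ e₂)
    (h₁.mono fun x' hx' ↦ hx'.trans (h₁' x').symm) (h₂.mono fun x' hx' ↦ hx'.trans (h₂' x').symm)]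
  refine B.expBracket_congr (hΦ.contMDiff_base x) ?_ ?_ (Filter.Eventually.of_forall h₁')
    (Filter.Eventually.of_forall h₂')
  · rw [← hΦ.anchor, h₁.self_of_nhds]
    exact congrArg _ (h₁' x).symm
  · rw [← hΦ.anchor, h₂.self_of_nhds]
    exact congrArg _ (h₂' x).symm

end Expansion

end LieAlgebroid

end AlgebroidCalculus

/-! ### Fibre products of Lie algebroids -/

section FibreProducts

variable {E : Type*} [NormedAddCommGroup E] [NormedSpace ℝ E]
  {H : Type*} [TopologicalSpace H] {I : ModelWithCorners ℝ E H}
  {M : Type*} [TopologicalSpace M] [ChartedSpace H M] [IsManifold I ∞ M]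
  {F : Type*} [NormedAddCommGroup F] [NormedSpace ℝ F]
  {V : M → Type*} [TopologicalSpace (TotalSpace F V)] [∀ x, AddCommGroup (V x)]
  [∀ x, Module ℝ (V x)] [∀ x, TopologicalSpace (V x)] [FiberBundle F V] [VectorBundle ℝ F V]
  {E' : Type*} [NormedAddCommGroup E'] [NormedSpace ℝ E']
  {H' : Type*} [TopologicalSpace H'] {I' : ModelWithCorners ℝ E' H'}
  {N : Type*} [TopologicalSpace N] [ChartedSpace H' N] [IsManifold I' ∞ N]
  {G : Type*} [NormedAddCommGroup G] [NormedSpace ℝ G]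
  {W : N → Type*} [TopologicalSpace (TotalSpace G W)] [∀ x, AddCommGroup (W x)]
  [∀ x, Module ℝ (W x)] [∀ x, TopologicalSpace (W x)] [FiberBundle G W] [VectorBundle ℝ G W]

namespace LieAlgebroid

section ExpandedSection

variable (B : LieAlgebroid I' G W) {ι κ : Type*} (f : M → N)
  (X Y : Cₛ^∞⟮I; E, (TangentSpace I : M → Type _)⟯)
  (h : ι → C^∞⟮I, M; 𝓘(ℝ, ℝ), ℝ⟯) (b : ι → Cₛ^∞⟮I'; G, W⟯)
  (g : κ → C^∞⟮I, M; 𝓘(ℝ, ℝ), ℝ⟯) (c : κ → Cₛ^∞⟮I'; G, W⟯)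

/-- The coefficients of an expansion of the bracket of the expansions with coefficients `h` and
`g` along the vector fields `X` and `Y`. -/
noncomputable def bracketCoeff : (ι × κ) ⊕ (κ ⊕ ι) → C^∞⟮I, M; 𝓘(ℝ, ℝ), ℝ⟯ :=
  Sum.elim (fun p ↦ h p.1 * g p.2)
    (Sum.elim (fun j ↦ dirDeriv X (g j)) (fun i ↦ -dirDeriv Y (h i)))

/-- The sections in an expansion of the bracket of expansions with sections `b` and `c`. -/
noncomputable def bracketSec : (ι × κ) ⊕ (κ ⊕ ι) → Cₛ^∞⟮I'; G, W⟯ :=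
  Sum.elim (fun p ↦ B.bracket (b p.1) (c p.2)) (Sum.elim c b)

theorem expBracket_eq_sum [Fintype ι] [Fintype κ] (x : M) :
    B.expBracket f (X x) (Y x) h b g c =
      ∑ k, bracketCoeff X Y h g k x • B.bracketSec b c k (f x) := by
  simp only [expBracket, bracketCoeff, bracketSec, Fintype.sum_sum_type, Sum.elim_inl,
    Sum.elim_inr, ContMDiffMap.coe_mul, Pi.mul_apply, ContMDiffMap.coe_neg, Pi.neg_apply, neg_smul,
    Finset.sum_neg_distrib, dirDeriv_apply, ← Finset.univ_product_univ, Finset.sum_product]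
  abel

theorem contMDiff_expBracket [Fintype ι] [Fintype κ] {f : M → N} (hf : ContMDiff I I' ∞ f) :
    ContMDiff I (I'.prod 𝓘(ℝ, G)) ∞ (fun x ↦
      (⟨f x, B.expBracket f (X x) (Y x) h b g c⟩ : TotalSpace G W)) := by
  intro x
  simp only [expBracket_eq_sum]
  exact ContMDiffAt.sum_along (σ := fun k x ↦ bracketCoeff X Y h g k x • B.bracketSec b c k (f x))
    _ (hf x) fun k ↦ (bracketCoeff X Y h g k).contMDiff.contMDiffAt.smul_along
      ((B.bracketSec b c k).contMDiffAt_along (hf x))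

end ExpandedSection

/-- The sum of brackets `∑ u_ij [b_i, c_j]` at a point. -/
noncomputable def bracketSum (B : LieAlgebroid I' G W) (y : N) {ι κ : Type*} [Fintype ι]
    [Fintype κ] (b : ι → Cₛ^∞⟮I'; G, W⟯) (c : κ → Cₛ^∞⟮I'; G, W⟯) (u : ι → κ → ℝ) : W y :=
  ∑ i, ∑ j, u i j • B.bracket (b i) (c j) y

theorem bracketSum_swap (B : LieAlgebroid I' G W) (y : N) {ι κ : Type*} [Fintype ι] [Fintype κ]
    (b : ι → Cₛ^∞⟮I'; G, W⟯) (c : κ → Cₛ^∞⟮I'; G, W⟯) (u : ι → κ → ℝ) :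
    B.bracketSum y b c u = -B.bracketSum y c b fun j i ↦ u i j := by
  have h1 (i : ι) (j : κ) : u i j • B.bracket (b i) (c j) y =
      -(u i j • B.bracket (c j) (b i) y) := by
    rw [B.bracket_swap (b i)]
    simp
  simp only [bracketSum, h1, Finset.sum_neg_distrib]
  rw [Finset.sum_comm]

section Jacobi

variable [FiniteDimensional ℝ E] [T2Space M]

/-- The bracket of an expansion with the expansion of a bracket, sorted by the sections of `W`
which occur. -/
theorem expBracket_expBracket (B : LieAlgebroid I' G W) (f : M → N)
    {ι κ l : Type*} [Fintype ι] [Fintype κ] [Fintype l]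
    (X Y Z : Cₛ^∞⟮I; E, (TangentSpace I : M → Type _)⟯)
    (h : ι → C^∞⟮I, M; 𝓘(ℝ, ℝ), ℝ⟯) (b : ι → Cₛ^∞⟮I'; G, W⟯)
    (g : κ → C^∞⟮I, M; 𝓘(ℝ, ℝ), ℝ⟯) (c : κ → Cₛ^∞⟮I'; G, W⟯)
    (k : l → C^∞⟮I, M; 𝓘(ℝ, ℝ), ℝ⟯) (d : l → Cₛ^∞⟮I'; G, W⟯) (x : M) :
    B.expBracket f (X x) (VectorField.mlieBracket I Y Z x) h b
        (bracketCoeff Y Z g k) (B.bracketSec c d) =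
      ∑ i, ∑ j, ∑ m, (h i x * g j x * k m x) • B.bracket (b i) (B.bracket (c j) (d m)) (f x) +
      B.bracketSum (f x) b d (fun i m ↦ h i x * mvfderiv I (k m) x (Y x)) -
      B.bracketSum (f x) b c (fun i j ↦ h i x * mvfderiv I (g j) x (Z x)) +
      B.bracketSum (f x) c d (fun j m ↦ g j x * mvfderiv I (k m) x (X x)) +
      B.bracketSum (f x) c d (fun j m ↦ k m x * mvfderiv I (g j) x (X x)) +
      ∑ m, mvfderiv I (dirDeriv Y (k m)) x (X x) • d m (f x) -
      ∑ j, mvfderiv I (dirDeriv Z (g j)) x (X x) • c j (f x) -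
      ∑ i, mvfderiv I (dirDeriv Z (h i)) x (Y x) • b i (f x) +
      ∑ i, mvfderiv I (dirDeriv Y (h i)) x (Z x) • b i (f x) := by
  have h1 (j : κ) (m : l) : mvfderiv I (g j * k m : C^∞⟮I, M; 𝓘(ℝ, ℝ), ℝ⟯) x (X x) =
      g j x * mvfderiv I (k m) x (X x) + k m x * mvfderiv I (g j) x (X x) :=
    mvfderiv_mul_apply (g j).mdifferentiableAt (k m).mdifferentiableAt _
  have h2 (j : κ) : mvfderiv I (-⇑(dirDeriv Z (g j))) x (X x) =
      -mvfderiv I (dirDeriv Z (g j)) x (X x) := by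
    rw [mvfderiv_neg]; rfl
  simp only [expBracket, bracketCoeff, bracketSec, Fintype.sum_sum_type, Sum.elim_inl,
    Sum.elim_inr, ContMDiffMap.coe_mul, Pi.mul_apply, ContMDiffMap.coe_neg, Pi.neg_apply, neg_smul,
    Finset.sum_neg_distrib, ← Finset.univ_product_univ, Finset.sum_product, h2,
    mvfderiv_mlieBracket, Finset.sum_add_distrib, sub_smul, Finset.sum_sub_distrib, bracketSum,
    mul_neg]
  simp only [← ContMDiffMap.coe_mul, h1, add_smul, Finset.sum_add_distrib, dirDeriv_apply,
    ← mul_assoc]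
  abel

/-- The Jacobi identity for the bracket of expansions. The terms without derivatives of the
coefficients cancel by the Jacobi identity of `B`, those with first derivatives by the antisymmetry
of its bracket, and those with second derivatives against the derivatives along the commutators. -/
theorem expBracket_jacobi (B : LieAlgebroid I' G W) (f : M → N)
    {ι κ l : Type*} [Fintype ι] [Fintype κ] [Fintype l]
    (X Y Z : Cₛ^∞⟮I; E, (TangentSpace I : M → Type _)⟯)
    (h : ι → C^∞⟮I, M; 𝓘(ℝ, ℝ), ℝ⟯) (b : ι → Cₛ^∞⟮I'; G, W⟯)
    (g : κ → C^∞⟮I, M; 𝓘(ℝ, ℝ), ℝ⟯) (c : κ → Cₛ^∞⟮I'; G, W⟯)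
    (k : l → C^∞⟮I, M; 𝓘(ℝ, ℝ), ℝ⟯) (d : l → Cₛ^∞⟮I'; G, W⟯) (x : M) :
    B.expBracket f (X x) (VectorField.mlieBracket I Y Z x) h b
        (bracketCoeff Y Z g k) (B.bracketSec c d) +
      B.expBracket f (Y x) (VectorField.mlieBracket I Z X x) g c
        (bracketCoeff Z X k h) (B.bracketSec d b) +
      B.expBracket f (Z x) (VectorField.mlieBracket I X Y x) k d
        (bracketCoeff X Y h g) (B.bracketSec b c) = 0 := by
  have h3 : ∑ i, ∑ j, ∑ m, (h i x * g j x * k m x) • B.bracket (b i) (B.bracket (c j) (d m)) (f x) +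
      ∑ j, ∑ m, ∑ i, (g j x * k m x * h i x) • B.bracket (c j) (B.bracket (d m) (b i)) (f x) +
      ∑ m, ∑ i, ∑ j, (k m x * h i x * g j x) • B.bracket (d m) (B.bracket (b i) (c j)) (f x) =
        0 := by
    have e1 (t : κ → l → ι → W (f x)) : ∑ j, ∑ m, ∑ i, t j m i = ∑ i, ∑ j, ∑ m, t j m i := by
      rw [Finset.sum_comm (s := (Finset.univ : Finset ι))]
      exact Finset.sum_congr rfl fun j _ ↦ Finset.sum_comm
    have e2 (t : l → ι → κ → W (f x)) : ∑ m, ∑ i, ∑ j, t m i j = ∑ i, ∑ j, ∑ m, t m i j := by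
      rw [Finset.sum_comm]
      exact Finset.sum_congr rfl fun i _ ↦ Finset.sum_comm
    rw [e1, e2, ← Finset.sum_add_distrib, ← Finset.sum_add_distrib]
    refine Finset.sum_eq_zero fun i _ ↦ ?_
    rw [← Finset.sum_add_distrib, ← Finset.sum_add_distrib]
    refine Finset.sum_eq_zero fun j _ ↦ ?_
    rw [← Finset.sum_add_distrib, ← Finset.sum_add_distrib]
    refine Finset.sum_eq_zero fun m _ ↦ ?_
    have hJ := DFunLike.congr_fun (B.jacobi (b i) (c j) (d m)) (f x)
    have hJ' : (h i x * g j x * k m x) • (B.bracket (b i) (B.bracket (c j) (d m)) (f x) +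
      B.bracket (c j) (B.bracket (d m) (b i)) (f x) +
      B.bracket (d m) (B.bracket (b i) (c j)) (f x)) = 0 :=
        (congrArg _ hJ).trans (smul_zero _)
    rw [← hJ']
    module
  rw [expBracket_expBracket, expBracket_expBracket, expBracket_expBracket, ← h3,
    B.bracketSum_swap (f x) c b, B.bracketSum_swap (f x) d b, B.bracketSum_swap (f x) d b,
    B.bracketSum_swap (f x) d c]
  abel

end Jacobi

variable (F) in
/-- The smooth maps `ρ : V → TM` and `Φ : V → W` over `f` identify `V` with the fibre product
`TM ×_{TN} W` formed with respect to the tangent map of `f` and the anchor of `B`. -/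
structure IsFibreProduct (B : LieAlgebroid I' G W) (f : M → N)
    (ρ : ∀ x, V x →ₗ[ℝ] TangentSpace I x) (Φ : ∀ x, V x →ₗ[ℝ] W (f x)) : Prop where
  contMDiff_base : ContMDiff I I' ∞ f
  contMDiff_fst : ContMDiff (I.prod 𝓘(ℝ, F)) I.tangent ∞
    (fun v : TotalSpace F V ↦ (⟨v.proj, ρ v.proj v.2⟩ : TangentBundle I M))
  contMDiff_snd : ContMDiff (I.prod 𝓘(ℝ, F)) (I'.prod 𝓘(ℝ, G)) ∞
    (fun v : TotalSpace F V ↦ (⟨f v.proj, Φ v.proj v.2⟩ : TotalSpace G W))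
  compat : ∀ x (v : V x), B.anchor (f x) (Φ x v) = mfderiv I I' f x (ρ x v)
  injective : ∀ x (v : V x), ρ x v = 0 → Φ x v = 0 → v = 0
  surjective : ∀ x (X : TangentSpace I x) (w : W (f x)), mfderiv I I' f x X = B.anchor (f x) w →
    ∃ v, ρ x v = X ∧ Φ x v = w

namespace IsFibreProduct

variable {B : LieAlgebroid I' G W} {f : M → N}
    {ρ : ∀ x, V x →ₗ[ℝ] TangentSpace I x} {Φ : ∀ x, V x →ₗ[ℝ] W (f x)}

theorem eq_of_eq (hV : IsFibreProduct F B f ρ Φ) {x : M} {v w : V x}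
    (h₁ : ρ x v = ρ x w) (h₂ : Φ x v = Φ x w) : v = w :=
  sub_eq_zero.1 (hV.injective x _ (by rw [map_sub, h₁, sub_self]) (by rw [map_sub, h₂, sub_self]))

/-- The vector field `ρ ∘ σ`. -/
noncomputable def fst (hV : IsFibreProduct F B f ρ Φ) (σ : Cₛ^∞⟮I; F, V⟯) :
    Cₛ^∞⟮I; E, (TangentSpace I : M → Type _)⟯ :=
  ⟨fun x ↦ ρ x (σ x), hV.contMDiff_fst.comp σ.contMDiff⟩

theorem fst_apply (hV : IsFibreProduct F B f ρ Φ) (σ : Cₛ^∞⟮I; F, V⟯) (x : M) :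
    hV.fst σ x = ρ x (σ x) := rfl

variable [FiniteDimensional ℝ E] [T2Space M] [FiniteDimensional ℝ E'] [T2Space N]
  [FiniteDimensional ℝ F] [ContMDiffVectorBundle ∞ F V I]
  [FiniteDimensional ℝ G] [ContMDiffVectorBundle ∞ G W I']

theorem exists_expansion (hV : IsFibreProduct F B f ρ Φ) (σ : Cₛ^∞⟮I; F, V⟯) (x : M) :
    ∃ (k : ℕ) (h : Fin k → C^∞⟮I, M; 𝓘(ℝ, ℝ), ℝ⟯) (b : Fin k → Cₛ^∞⟮I'; G, W⟯),
      ∀ᶠ x' in 𝓝 x, Φ x' (σ x') = ∑ i, h i x' • b i (f x') :=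
  exists_isLocalExpansion (s := fun x ↦ Φ x (σ x)) isOpen_univ (Set.mem_univ x)
    (hV.contMDiff_snd.comp σ.contMDiff).contMDiffOn

theorem exists_bracketFiber (hV : IsFibreProduct F B f ρ Φ) (σ τ : Cₛ^∞⟮I; F, V⟯) (x : M) :
    ∃ v : V x, ρ x v = VectorField.mlieBracket I (hV.fst σ) (hV.fst τ) x ∧
      ∀ (ι κ : Type) [Fintype ι] [Fintype κ]
        (h : ι → C^∞⟮I, M; 𝓘(ℝ, ℝ), ℝ⟯) (b : ι → Cₛ^∞⟮I'; G, W⟯)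
        (g : κ → C^∞⟮I, M; 𝓘(ℝ, ℝ), ℝ⟯) (c : κ → Cₛ^∞⟮I'; G, W⟯),
        (∀ᶠ x' in 𝓝 x, Φ x' (σ x') = ∑ i, h i x' • b i (f x')) →
        (∀ᶠ x' in 𝓝 x, Φ x' (τ x') = ∑ j, g j x' • c j (f x')) →
        Φ x v = B.expBracket f (hV.fst σ x) (hV.fst τ x) h b g c := by
  obtain ⟨n, h, b, hhb⟩ := hV.exists_expansion σ x
  obtain ⟨n', g, c, hgc⟩ := hV.exists_expansion τ x
  have hσ {x' : M} {s : Cₛ^∞⟮I; F, V⟯} {w : W (f x')} (hx' : Φ x' (s x') = w) :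
      mfderiv I I' f x' (hV.fst s x') = B.anchor (f x') w := by
    rw [← hx', hV.compat]; rfl
  obtain ⟨v, hv₁, hv₂⟩ := hV.surjective x _ _ (B.mfderiv_mlieBracket_eq_anchor_expBracket
    (h := h) (b := b) (g := g) (c := c) hV.contMDiff_base (hV.fst σ) (hV.fst τ)
    (hhb.mono fun x' hx' ↦ hσ hx') (hgc.mono fun x' hx' ↦ hσ hx'))
  refine ⟨v, hv₁, fun ι κ _ _ h' b' g' c' hh' hg' ↦ hv₂.trans ?_⟩
  exact B.expBracket_congr (hV.contMDiff_base x) (hσ hhb.self_of_nhds) (hσ hgc.self_of_nhds)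
    (by filter_upwards [hhb, hh'] with x' h₁ h₂ using h₁.symm.trans h₂)
    (by filter_upwards [hgc, hg'] with x' h₁ h₂ using h₁.symm.trans h₂)

/-- The value of the bracket of two sections of the fibre product. -/
noncomputable def bracketFiber (hV : IsFibreProduct F B f ρ Φ) (σ τ : Cₛ^∞⟮I; F, V⟯) (x : M) : V x :=
  (hV.exists_bracketFiber σ τ x).choose

theorem fst_bracketFiber (hV : IsFibreProduct F B f ρ Φ) (σ τ : Cₛ^∞⟮I; F, V⟯) (x : M) :
    ρ x (hV.bracketFiber σ τ x) = VectorField.mlieBracket I (hV.fst σ) (hV.fst τ) x :=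
  (hV.exists_bracketFiber σ τ x).choose_spec.1

theorem snd_bracketFiber (hV : IsFibreProduct F B f ρ Φ) (σ τ : Cₛ^∞⟮I; F, V⟯) {x : M}
    {ι κ : Type} [Fintype ι] [Fintype κ]
    {h : ι → C^∞⟮I, M; 𝓘(ℝ, ℝ), ℝ⟯} {b : ι → Cₛ^∞⟮I'; G, W⟯}
    {g : κ → C^∞⟮I, M; 𝓘(ℝ, ℝ), ℝ⟯} {c : κ → Cₛ^∞⟮I'; G, W⟯}
    (h₁ : ∀ᶠ x' in 𝓝 x, Φ x' (σ x') = ∑ i, h i x' • b i (f x'))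
    (h₂ : ∀ᶠ x' in 𝓝 x, Φ x' (τ x') = ∑ j, g j x' • c j (f x')) :
    Φ x (hV.bracketFiber σ τ x) = B.expBracket f (hV.fst σ x) (hV.fst τ x) h b g c :=
  (hV.exists_bracketFiber σ τ x).choose_spec.2 ι κ h b g c h₁ h₂

/-- The bracket of two sections of the fibre product: over the Lie bracket of their vector fields
and the bracket of expansions of their components along `f`. -/
noncomputable def bracket (hV : IsFibreProduct F B f ρ Φ) (σ τ : Cₛ^∞⟮I; F, V⟯) :
    Cₛ^∞⟮I; F, V⟯ :=
  ⟨hV.bracketFiber σ τ, fun x ↦ by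
    have hc : CompleteSpace E := FiniteDimensional.complete ℝ E
    obtain ⟨n, h, b, hhb⟩ := hV.exists_expansion σ x
    obtain ⟨n', g, c, hgc⟩ := hV.exists_expansion τ x
    refine contMDiffAt_along_of_injective (f₁ := f) (f₂ := fun x : M ↦ x) (g := fun x : M ↦ x)
      (Ψ₁ := Φ) (Ψ₂ := ρ) (W := W) hV.contMDiff_base.continuous continuous_id hV.contMDiff_snd
      hV.contMDiff_fst (fun x v h₁ h₂ ↦ hV.injective x v h₂ h₁) contMDiffAt_id ?_ ?_
    · refine (B.contMDiff_expBracket (hV.fst σ) (hV.fst τ) h b g c hV.contMDiff_base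
        x).congr_of_eventuallyEq ?_
      filter_upwards [hhb.eventually_nhds, hgc.eventually_nhds] with x' h₁ h₂
      rw [hV.snd_bracketFiber σ τ h₁ h₂]
    · simp only [fst_bracketFiber]
      exact ((tangent I M).bracket (hV.fst σ) (hV.fst τ)).contMDiff x⟩

theorem fst_bracket (hV : IsFibreProduct F B f ρ Φ) (σ τ : Cₛ^∞⟮I; F, V⟯) (x : M) :
    ρ x (hV.bracket σ τ x) = VectorField.mlieBracket I (hV.fst σ) (hV.fst τ) x :=
  hV.fst_bracketFiber σ τ x

theorem fst_bracket_eq [CompleteSpace E] (hV : IsFibreProduct F B f ρ Φ) (σ τ : Cₛ^∞⟮I; F, V⟯) :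
    hV.fst (hV.bracket σ τ) = (tangent I M).bracket (hV.fst σ) (hV.fst τ) :=
  ContMDiffSection.ext fun x ↦ hV.fst_bracketFiber σ τ x

theorem snd_bracket (hV : IsFibreProduct F B f ρ Φ) (σ τ : Cₛ^∞⟮I; F, V⟯) {x : M}
    {ι κ : Type} [Fintype ι] [Fintype κ]
    {h : ι → C^∞⟮I, M; 𝓘(ℝ, ℝ), ℝ⟯} {b : ι → Cₛ^∞⟮I'; G, W⟯}
    {g : κ → C^∞⟮I, M; 𝓘(ℝ, ℝ), ℝ⟯} {c : κ → Cₛ^∞⟮I'; G, W⟯}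
    (h₁ : ∀ᶠ x' in 𝓝 x, Φ x' (σ x') = ∑ i, h i x' • b i (f x'))
    (h₂ : ∀ᶠ x' in 𝓝 x, Φ x' (τ x') = ∑ j, g j x' • c j (f x')) :
    Φ x (hV.bracket σ τ x) = B.expBracket f (hV.fst σ x) (hV.fst τ x) h b g c :=
  hV.snd_bracketFiber σ τ h₁ h₂

theorem bracket_swap (hV : IsFibreProduct F B f ρ Φ) (σ τ : Cₛ^∞⟮I; F, V⟯) :
    hV.bracket σ τ = -hV.bracket τ σ := by
  ext x
  obtain ⟨n, h, b, hhb⟩ := hV.exists_expansion σ x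
  obtain ⟨n', g, c, hgc⟩ := hV.exists_expansion τ x
  refine hV.eq_of_eq ?_ ?_
  · rw [ContMDiffSection.coe_neg, Pi.neg_apply, map_neg, fst_bracket, fst_bracket]
    exact VectorField.mlieBracket_swap_apply
  · rw [ContMDiffSection.coe_neg, Pi.neg_apply, map_neg, hV.snd_bracket σ τ hhb hgc,
      hV.snd_bracket τ σ hgc hhb, expBracket_swap]

theorem bracket_add (hV : IsFibreProduct F B f ρ Φ) (σ τ τ' : Cₛ^∞⟮I; F, V⟯) :
    hV.bracket σ (τ + τ') = hV.bracket σ τ + hV.bracket σ τ' := by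
  have hc : CompleteSpace E := FiniteDimensional.complete ℝ E
  ext x
  obtain ⟨n, h, b, hhb⟩ := hV.exists_expansion σ x
  obtain ⟨m, g, c, hgc⟩ := hV.exists_expansion τ x
  obtain ⟨m', g', c', hgc'⟩ := hV.exists_expansion τ' x
  have hfst : hV.fst (τ + τ') = hV.fst τ + hV.fst τ' :=
    ContMDiffSection.ext fun x ↦ map_add (ρ x) _ _
  refine hV.eq_of_eq ?_ ?_
  · rw [ContMDiffSection.coe_add, Pi.add_apply, map_add, fst_bracket, fst_bracket, fst_bracket,
      hfst]
    exact DFunLike.congr_fun (((tangent I M).bracket (hV.fst σ)).map_add (hV.fst τ) (hV.fst τ')) x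
  · have h₂ : ∀ᶠ x' in 𝓝 x, Φ x' ((τ + τ') x') =
        ∑ j, Sum.elim g g' j x' • Sum.elim c c' j (f x') := by
      filter_upwards [hgc, hgc'] with x' h₁ h₂
      rw [Fintype.sum_sum_type, ContMDiffSection.coe_add, Pi.add_apply, map_add, h₁, h₂]
      rfl
    rw [ContMDiffSection.coe_add, Pi.add_apply, map_add, hV.snd_bracket σ _ hhb h₂,
      hV.snd_bracket σ τ hhb hgc, hV.snd_bracket σ τ' hhb hgc', hfst]
    simp only [expBracket, Fintype.sum_sum_type, Sum.elim_inl, Sum.elim_inr,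
      ContMDiffSection.coe_add, Pi.add_apply, map_add, add_smul, Finset.sum_add_distrib]
    abel

theorem bracket_smulSection (hV : IsFibreProduct F B f ρ Φ) (σ τ : Cₛ^∞⟮I; F, V⟯)
    (u : C^∞⟮I, M; 𝓘(ℝ, ℝ), ℝ⟯) (x : M) :
    hV.bracket σ (smulSection u τ) x =
      u x • hV.bracket σ τ x + mvfderiv I u x (ρ x (σ x)) • τ x := by
  have hc : CompleteSpace E := FiniteDimensional.complete ℝ E
  obtain ⟨n, h, b, hhb⟩ := hV.exists_expansion σ x
  obtain ⟨m, g, c, hgc⟩ := hV.exists_expansion τ x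
  have hfst : hV.fst (smulSection u τ) = smulSection u (hV.fst τ) :=
    ContMDiffSection.ext fun x ↦ map_smul (ρ x) _ _
  refine hV.eq_of_eq ?_ ?_
  · rw [map_add, map_smul, map_smul, fst_bracket, fst_bracket, hfst]
    exact (tangent I M).leibniz (hV.fst σ) (hV.fst τ) u x
  · have h₂ : ∀ᶠ x' in 𝓝 x, Φ x' (smulSection u τ x') = ∑ j, (u * g j) x' • c j (f x') := by
      filter_upwards [hgc] with x' h₁
      rw [smulSection_apply, map_smul, h₁, Finset.smul_sum]
      exact Finset.sum_congr rfl fun j _ ↦ (mul_smul _ _ _).symm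
    have h3 (j : Fin m) : mvfderiv I (u * g j : C^∞⟮I, M; 𝓘(ℝ, ℝ), ℝ⟯) x (ρ x (σ x)) =
        u x * mvfderiv I (g j) x (ρ x (σ x)) + g j x * mvfderiv I u x (ρ x (σ x)) :=
      mvfderiv_mul_apply u.mdifferentiableAt (g j).mdifferentiableAt _
    rw [map_add, map_smul, map_smul, hV.snd_bracket σ _ hhb h₂, hV.snd_bracket σ τ hhb hgc, hfst,
      hgc.self_of_nhds]
    simp only [expBracket, fst_apply, smulSection_apply, h3, map_smul, smul_add, smul_sub,
      Finset.smul_sum, add_smul, Finset.sum_add_distrib, ← mul_smul, smul_eq_mul]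
    simp only [ContMDiffMap.coe_mul, Pi.mul_apply, mul_left_comm (h _ x), mul_comm (g _ x)]
    abel

theorem bracket_smul (hV : IsFibreProduct F B f ρ Φ) (t : ℝ) (σ τ : Cₛ^∞⟮I; F, V⟯) :
    hV.bracket σ (t • τ) = t • hV.bracket σ τ := by
  ext x
  have h := hV.bracket_smulSection σ τ (ContMDiffMap.const t) x
  have h0 : mvfderiv I (ContMDiffMap.const t : C^∞⟮I, M; 𝓘(ℝ, ℝ), ℝ⟯) x = 0 :=
    mvfderiv_const t
  rw [h0, zero_apply, zero_smul, add_zero] at h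
  exact h

theorem bracket_jacobi (hV : IsFibreProduct F B f ρ Φ) (σ τ υ : Cₛ^∞⟮I; F, V⟯) :
    hV.bracket σ (hV.bracket τ υ) + hV.bracket τ (hV.bracket υ σ) +
      hV.bracket υ (hV.bracket σ τ) = 0 := by
  have hc : CompleteSpace E := FiniteDimensional.complete ℝ E
  ext x
  obtain ⟨n, h, b, hhb⟩ := hV.exists_expansion σ x
  obtain ⟨m, g, c, hgc⟩ := hV.exists_expansion τ x
  obtain ⟨l, k, d, hkd⟩ := hV.exists_expansion υ x
  refine hV.eq_of_eq ?_ ?_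
  · have hJ := DFunLike.congr_fun ((tangent I M).jacobi (hV.fst σ) (hV.fst τ) (hV.fst υ)) x
    simp only [ContMDiffSection.coe_add, Pi.add_apply, map_add, fst_bracket, fst_bracket_eq]
    exact hJ.trans (map_zero (ρ x)).symm
  · have hexp {ι κ : Type} [Fintype ι] [Fintype κ] {σ τ : Cₛ^∞⟮I; F, V⟯}
        {h : ι → C^∞⟮I, M; 𝓘(ℝ, ℝ), ℝ⟯} {b : ι → Cₛ^∞⟮I'; G, W⟯}
        {g : κ → C^∞⟮I, M; 𝓘(ℝ, ℝ), ℝ⟯} {c : κ → Cₛ^∞⟮I'; G, W⟯}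
        (h₁ : ∀ᶠ x' in 𝓝 x, Φ x' (σ x') = ∑ i, h i x' • b i (f x'))
        (h₂ : ∀ᶠ x' in 𝓝 x, Φ x' (τ x') = ∑ j, g j x' • c j (f x')) :
        ∀ᶠ x' in 𝓝 x, Φ x' (hV.bracket σ τ x') =
          ∑ i, bracketCoeff (hV.fst σ) (hV.fst τ) h g i x' • B.bracketSec b c i (f x') := by
      filter_upwards [h₁.eventually_nhds, h₂.eventually_nhds] with x' h₁' h₂'
      rw [hV.snd_bracket σ τ h₁' h₂', expBracket_eq_sum]
    rw [ContMDiffSection.coe_add, ContMDiffSection.coe_add, Pi.add_apply, Pi.add_apply, map_add,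
      map_add, hV.snd_bracket _ _ hhb (hexp hgc hkd), hV.snd_bracket _ _ hgc (hexp hkd hhb),
      hV.snd_bracket _ _ hkd (hexp hhb hgc), hV.fst_apply (hV.bracket τ υ),
      hV.fst_apply (hV.bracket υ σ), hV.fst_apply (hV.bracket σ τ), fst_bracket, fst_bracket,
      fst_bracket, B.expBracket_jacobi]
    exact (map_zero (Φ x)).symm

/-- The Lie algebroid structure on a fibre product. -/
noncomputable def algebroid (hV : IsFibreProduct F B f ρ Φ) : LieAlgebroid I F V where
  anchor := ρ
  contMDiff_anchor := hV.contMDiff_fst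
  bracket := LinearMap.mk₂ ℝ hV.bracket
    (fun σ σ' τ ↦ by
      rw [hV.bracket_swap, hV.bracket_add, hV.bracket_swap σ, hV.bracket_swap σ', neg_add])
    (fun t σ τ ↦ by rw [hV.bracket_swap, hV.bracket_smul, hV.bracket_swap σ, smul_neg])
    hV.bracket_add (fun t σ τ ↦ hV.bracket_smul t σ τ)
  bracket_self σ := by
    have h : (2 : ℝ) • hV.bracket σ σ = 0 := by
      rw [two_smul]
      exact add_eq_zero_iff_eq_neg.2 (hV.bracket_swap σ σ)
    have h' := congrArg (fun s ↦ (2 : ℝ)⁻¹ • s) h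
    rw [smul_zero, inv_smul_smul₀ two_ne_zero] at h'
    exact h'
  jacobi := hV.bracket_jacobi
  leibniz := hV.bracket_smulSection

theorem isMorphism (hV : IsFibreProduct F B f ρ Φ) : IsMorphism hV.algebroid B f Φ where
  contMDiff_base := hV.contMDiff_base
  contMDiff := hV.contMDiff_snd
  anchor := hV.compat
  bracket _ _ _ _ _ _ _ _ _ h₁ h₂ := hV.snd_bracket _ _ h₁ h₂

end IsFibreProduct

end LieAlgebroid

end FibreProducts

/-! ### Pullback and product algebroids -/

section Pullbacks

variable {E : Type*} [NormedAddCommGroup E] [NormedSpace ℝ E]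
  {H : Type*} [TopologicalSpace H] {I : ModelWithCorners ℝ E H}
  {M : Type*} [TopologicalSpace M] [ChartedSpace H M] [IsManifold I ∞ M]
  {F : Type*} [NormedAddCommGroup F] [NormedSpace ℝ F]
  {V : M → Type*} [TopologicalSpace (TotalSpace F V)] [∀ x, AddCommGroup (V x)]
  [∀ x, Module ℝ (V x)] [∀ x, TopologicalSpace (V x)] [FiberBundle F V] [VectorBundle ℝ F V]
  {E' : Type*} [NormedAddCommGroup E'] [NormedSpace ℝ E']
  {H' : Type*} [TopologicalSpace H'] {I' : ModelWithCorners ℝ E' H'}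
  {N : Type*} [TopologicalSpace N] [ChartedSpace H' N] [IsManifold I' ∞ N]
  {G : Type*} [NormedAddCommGroup G] [NormedSpace ℝ G]
  {W : N → Type*} [TopologicalSpace (TotalSpace G W)] [∀ x, AddCommGroup (W x)]
  [∀ x, Module ℝ (W x)] [∀ x, TopologicalSpace (W x)] [FiberBundle G W] [VectorBundle ℝ G W]

/-- The inclusion of a smooth subbundle is smooth. -/
theorem Subbundle.contMDiff_incl [ContMDiffVectorBundle ∞ F V I] {S : ∀ x, Submodule ℝ (V x)}
    {r : ℕ} (hS : IsSmoothSubbundle I F S r) :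
    ContMDiff (I.prod 𝓘(ℝ, EuclideanSpace ℝ (Fin r))) (I.prod 𝓘(ℝ, F)) ∞
      (fun v : TotalSpace (EuclideanSpace ℝ (Fin r)) (Subbundle hS) ↦
        (⟨v.proj, incl hS v.proj v.2⟩ : TotalSpace F V)) := by
  intro v
  let d := (hS v.proj).some
  have hproj := (contMDiff_proj (n := ∞) (IB := I) (Subbundle hS)) v
  refine contMDiffAt_along_iff.2 ⟨hproj, ?_⟩
  have h1 : ContMDiffAt (I.prod 𝓘(ℝ, EuclideanSpace ℝ (Fin r)))
      𝓘(ℝ, EuclideanSpace ℝ (Fin r)) ∞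
      (fun w : TotalSpace (EuclideanSpace ℝ (Fin r)) (Subbundle hS) ↦
        (pretriv hS d ⟨w.proj, w.2⟩).2) v :=
    (contMDiffAt_totalSpace (f := fun w : TotalSpace (EuclideanSpace ℝ (Fin r)) (Subbundle hS) ↦
      (⟨w.proj, w.2⟩ : TotalSpace (EuclideanSpace ℝ (Fin r)) (Subbundle hS)))).1
        contMDiffAt_id |>.2
  have h2 : ContMDiffAt (I.prod 𝓘(ℝ, EuclideanSpace ℝ (Fin r)))
      𝓘(ℝ, EuclideanSpace ℝ (Fin r) →L[ℝ] F) ∞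
      (fun w : TotalSpace (EuclideanSpace ℝ (Fin r)) (Subbundle hS) ↦ d.q w.proj) v :=
    ((d.contMDiffOn_q).contMDiffAt (d.isOpen.mem_nhds d.mem)).comp v hproj
  refine (h2.clm_apply h1).congr_of_eventuallyEq ?_
  filter_upwards [hproj.continuousAt.eventually (d.isOpen.mem_nhds d.mem)] with w hw
  exact (d.q_p w.proj hw _ (incl_mem hS w.proj w.2)).symm

section ProductBundle

variable {F₁ : Type*} [NormedAddCommGroup F₁] [NormedSpace ℝ F₁]
  {V₁ : M → Type*} [TopologicalSpace (TotalSpace F₁ V₁)] [∀ x, AddCommGroup (V₁ x)]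
  [∀ x, Module ℝ (V₁ x)] [∀ x, TopologicalSpace (V₁ x)] [FiberBundle F₁ V₁] [VectorBundle ℝ F₁ V₁]

theorem contMDiff_bundleProd_fst :
    ContMDiff (I.prod 𝓘(ℝ, F × F₁)) (I.prod 𝓘(ℝ, F)) ∞
      (fun v : TotalSpace (F × F₁) (fun x ↦ V x × V₁ x) ↦
        (⟨v.proj, v.2.1⟩ : TotalSpace F V)) := by
  intro v
  have h := (contMDiffAt_totalSpace (IB := I) (n := ∞)
    (f := fun w : TotalSpace (F × F₁) (fun x ↦ V x × V₁ x) ↦ w)).1 (contMDiffAt_id (x := v))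
  exact contMDiffAt_along_iff.2 ⟨h.1, (contDiff_fst (𝕜 := ℝ) (E := F) (F := F₁)).contMDiff.contMDiffAt.comp v h.2⟩

theorem contMDiff_bundleProd_snd :
    ContMDiff (I.prod 𝓘(ℝ, F × F₁)) (I.prod 𝓘(ℝ, F₁)) ∞
      (fun v : TotalSpace (F × F₁) (fun x ↦ V x × V₁ x) ↦
        (⟨v.proj, v.2.2⟩ : TotalSpace F₁ V₁)) := by
  intro v
  have h := (contMDiffAt_totalSpace (IB := I) (n := ∞)
    (f := fun w : TotalSpace (F × F₁) (fun x ↦ V x × V₁ x) ↦ w)).1 (contMDiffAt_id (x := v))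
  exact contMDiffAt_along_iff.2 ⟨h.1, (contDiff_snd (𝕜 := ℝ) (E := F) (F := F₁)).contMDiff.contMDiffAt.comp v h.2⟩

theorem contMDiff_pullback_lift (f : C^∞⟮I, M; I', N⟯) :
    ContMDiff (I.prod 𝓘(ℝ, G)) (I'.prod 𝓘(ℝ, G)) ∞
      (fun v : TotalSpace G ((f : M → N) *ᵖ W) ↦ (⟨f v.proj, v.2⟩ : TotalSpace G W)) := by
  intro v
  have h := (contMDiffAt_totalSpace (IB := I) (n := ∞)
    (f := fun w : TotalSpace G ((f : M → N) *ᵖ W) ↦ w)).1 (contMDiffAt_id (x := v))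
  exact contMDiffAt_along_iff.2 ⟨f.contMDiff.contMDiffAt.comp v h.1, h.2⟩

end ProductBundle

namespace LieAlgebroid

section Pullback

variable [FiniteDimensional ℝ E] [FiniteDimensional ℝ E'] [FiniteDimensional ℝ G]
  [ContMDiffVectorBundle ∞ G W I'] (B : LieAlgebroid I' G W) (f : C^∞⟮I, M; I', N⟯) {r : ℕ}
  (h : B.PullbackExists f r)

theorem isFibreProduct_pullback :
    IsFibreProduct (EuclideanSpace ℝ (Fin r)) B f (B.pullbackAnchor f h) (B.pullbackProj f h) where
  contMDiff_base := f.contMDiff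
  contMDiff_fst := contMDiff_bundleProd_fst.comp (Subbundle.contMDiff_incl _)
  contMDiff_snd := ((contMDiff_pullback_lift f).comp contMDiff_bundleProd_snd).comp
    (Subbundle.contMDiff_incl _)
  compat x v := (Subbundle.incl_mem (B.isSmoothSubbundle_pullback f h) x v).symm
  injective _ _ h₁ h₂ := Subtype.ext (Prod.ext h₁ h₂)
  surjective x X w hX := ⟨Subbundle.mk _ x (X, w) hX, rfl, rfl⟩

variable [T2Space M] [T2Space N]

theorem isPullback_algebroid : B.IsPullback f h (B.isFibreProduct_pullback f h).algebroid where
  anchor _ _ := rfl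
  bracket_fst := (B.isFibreProduct_pullback f h).fst_bracket
  bracket_snd _ _ _ _ _ _ _ _ _ h₁ h₂ := (B.isFibreProduct_pullback f h).snd_bracket _ _ h₁ h₂

end Pullback

section Product

variable [FiniteDimensional ℝ E] [T2Space M] [FiniteDimensional ℝ E'] [FiniteDimensional ℝ G]
  [ContMDiffVectorBundle ∞ G W I'] [T2Space N] (B : LieAlgebroid I' G W)

variable (I M) in
/-- The anchor of `TM × W`. -/
noncomputable def prodAnchor (p : M × N) :
    ProdBundle I (TangentSpace I : M → Type _) I' W p →ₗ[ℝ] TangentSpace (I.prod I') p :=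
  LinearMap.prodMap (LinearMap.id : TangentSpace I p.1 →ₗ[ℝ] TangentSpace I p.1) (B.anchor p.2)

variable (I I' M W) in
/-- The projection `TM × W → W`. -/
noncomputable def prodProj (p : M × N) :
    ProdBundle I (TangentSpace I : M → Type _) I' W p →ₗ[ℝ] W p.2 :=
  LinearMap.snd ℝ (TangentSpace I p.1) (W p.2)

theorem contMDiff_prodBundle_fst :
    ContMDiff ((I.prod I').prod 𝓘(ℝ, F × G)) (I.prod 𝓘(ℝ, F)) ∞
      (fun v : TotalSpace (F × G) (ProdBundle (N := N) I V I' W) ↦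
        (⟨v.proj.1, v.2.1⟩ : TotalSpace F V)) :=
  (contMDiff_pullback_lift (ContMDiffMap.fst : C^∞⟮I.prod I', M × N; I, M⟯)).comp
    contMDiff_bundleProd_fst

theorem contMDiff_prodBundle_snd :
    ContMDiff ((I.prod I').prod 𝓘(ℝ, F × G)) (I'.prod 𝓘(ℝ, G)) ∞
      (fun v : TotalSpace (F × G) (ProdBundle (N := N) I V I' W) ↦
        (⟨v.proj.2, v.2.2⟩ : TotalSpace G W)) :=
  (contMDiff_pullback_lift (ContMDiffMap.snd : C^∞⟮I.prod I', M × N; I', N⟯)).comp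
    contMDiff_bundleProd_snd

theorem isFibreProduct_prod :
    IsFibreProduct (E × G) B (Prod.snd : M × N → N) (prodAnchor I M B) (prodProj I M I' W) where
  contMDiff_base := contMDiff_snd
  contMDiff_fst := by
    have h1 : ContMDiff ((I.prod I').prod 𝓘(ℝ, E × G)) (I.tangent.prod I'.tangent) ∞
        (fun v : TotalSpace (E × G) (ProdBundle (N := N) I (TangentSpace I : M → Type _) I' W) ↦
          ((⟨v.proj.1, v.2.1⟩ : TangentBundle I M),
            (⟨v.proj.2, B.anchor v.proj.2 v.2.2⟩ : TangentBundle I' N))) :=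
      contMDiff_prodBundle_fst.prodMk (B.contMDiff_anchor.comp contMDiff_prodBundle_snd)
    exact contMDiff_equivTangentBundleProd_symm.comp h1
  contMDiff_snd := contMDiff_prodBundle_snd
  compat p v := by
    rw [mfderiv_snd]
    rfl
  injective p v h₁ h₂ := Prod.ext (congrArg (fun z : E × E' ↦ z.1) h₁) h₂
  surjective p X w hX := by
    rw [mfderiv_snd] at hX
    exact ⟨(X.1, w), Prod.ext rfl hX.symm, rfl⟩

theorem tangent_prod_ext {p : M × N} {v w : TangentSpace (I.prod I') p}
    (h₁ : mfderiv (I.prod I') I Prod.fst p v = mfderiv (I.prod I') I Prod.fst p w)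
    (h₂ : mfderiv (I.prod I') I' Prod.snd p v = mfderiv (I.prod I') I' Prod.snd p w) : v = w := by
  rw [mfderiv_fst] at h₁
  rw [mfderiv_snd] at h₂
  exact Prod.ext h₁ h₂

theorem mlieBracket_prod_related (X Y : Cₛ^∞⟮I.prod I'; E × E',
      (TangentSpace (I.prod I') : M × N → Type _)⟯)
    (X₁ Y₁ : Cₛ^∞⟮I; E, (TangentSpace I : M → Type _)⟯)
    (X₂ Y₂ : Cₛ^∞⟮I'; E', (TangentSpace I' : N → Type _)⟯)
    (hX : ∀ p, X p = (X₁ p.1, X₂ p.2)) (hY : ∀ p, Y p = (Y₁ p.1, Y₂ p.2)) (p : M × N) :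
    VectorField.mlieBracket (I.prod I') X Y p =
      (VectorField.mlieBracket I X₁ Y₁ p.1, VectorField.mlieBracket I' X₂ Y₂ p.2) := by
  refine tangent_prod_ext ?_ ?_
  · refine (mfderiv_mlieBracket_of_related contMDiff_fst X Y X₁ Y₁ ?_ ?_).trans ?_
    · intro q; rw [mfderiv_fst, hX]; rfl
    · intro q; rw [mfderiv_fst, hY]; rfl
    · rw [mfderiv_fst]; rfl
  · refine (mfderiv_mlieBracket_of_related contMDiff_snd X Y X₂ Y₂ ?_ ?_).trans ?_
    · intro q; rw [mfderiv_snd, hX]; rfl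
    · intro q; rw [mfderiv_snd, hY]; rfl
    · rw [mfderiv_snd]; rfl

theorem isProduct_algebroid [CompleteSpace E] :
    IsProduct (tangent I M) B (B.isFibreProduct_prod (I := I) (M := M)).algebroid := by
  set hV := B.isFibreProduct_prod (I := I) (M := M)
  have h1 (p : M × N) (v : TangentSpace (I.prod I') p) :
      mvfderiv (I.prod I') (1 : C^∞⟮I.prod I', M × N; 𝓘(ℝ, ℝ), ℝ⟯) p v = 0 := by
    rw [ContMDiffMap.coe_one]
    exact congrArg (fun L : E × E' →L[ℝ] ℝ ↦ L v)
      (mvfderiv_const (I := I.prod I') (M := M × N) (1 : ℝ) (x := p))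
  have hleft (a : Cₛ^∞⟮I; E, (TangentSpace I : M → Type _)⟯) (p : M × N) :
      ∀ᶠ q in 𝓝 p, prodProj I M I' W q (prodSection a (0 : Cₛ^∞⟮I'; G, W⟯) q) =
        ∑ i : Fin 0, (1 : C^∞⟮I.prod I', M × N; 𝓘(ℝ, ℝ), ℝ⟯) q •
          (0 : Cₛ^∞⟮I'; G, W⟯) q.2 :=
    Filter.Eventually.of_forall fun q ↦ rfl
  have hright (b : Cₛ^∞⟮I'; G, W⟯) (p : M × N) :
      ∀ᶠ q in 𝓝 p, prodProj I M I' W q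
        (prodSection (0 : Cₛ^∞⟮I; E, (TangentSpace I : M → Type _)⟯) b q) =
        ∑ i : Fin 1, (1 : C^∞⟮I.prod I', M × N; 𝓘(ℝ, ℝ), ℝ⟯) q • b q.2 :=
    Filter.Eventually.of_forall fun q ↦ by simp; rfl
  have hfl (a : Cₛ^∞⟮I; E, (TangentSpace I : M → Type _)⟯) (q : M × N) :
      hV.fst (prodSection a 0) q = (a q.1,
        (0 : Cₛ^∞⟮I'; E', (TangentSpace I' : N → Type _)⟯) q.2) :=
    Prod.ext rfl (map_zero (B.anchor q.2))
  have hfr (b : Cₛ^∞⟮I'; G, W⟯) (q : M × N) :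
      hV.fst (prodSection 0 b) q = ((0 : Cₛ^∞⟮I; E, (TangentSpace I : M → Type _)⟯) q.1,
        B.anchorSection b q.2) := rfl
  constructor
  · intro p v w; rfl
  · intro a a'
    refine ContMDiffSection.ext fun p ↦ ?_
    refine hV.eq_of_eq ((hV.fst_bracket _ _ p).trans ?_)
      ((hV.snd_bracket _ _ (hleft a p) (hleft a' p)).trans ?_)
    · rw [mlieBracket_prod_related _ _ a a' 0 0 (hfl a) (hfl a')]
      refine Prod.ext rfl ?_
      exact (congrFun VectorField.mlieBracket_zero_left p.2).trans (map_zero (B.anchor p.2)).symm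
    · simp [expBracket]
      rfl
  · intro b b'
    refine ContMDiffSection.ext fun p ↦ ?_
    refine hV.eq_of_eq ((hV.fst_bracket _ _ p).trans ?_)
      ((hV.snd_bracket _ _ (hright b p) (hright b' p)).trans ?_)
    · rw [mlieBracket_prod_related _ _ 0 0 _ _ (hfr b) (hfr b')]
      refine Prod.ext (congrFun VectorField.mlieBracket_zero_left p.1) ?_
      exact (B.anchor_bracket b b' p.2).symm
    · simp only [expBracket, h1]
      simp
      rfl
  · intro a b
    refine ContMDiffSection.ext fun p ↦ ?_
    refine hV.eq_of_eq ((hV.fst_bracket _ _ p).trans ?_)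
      ((hV.snd_bracket _ _ (hleft a p) (hright b p)).trans ?_)
    · rw [mlieBracket_prod_related _ _ a 0 0 _ (hfl a) (hfr b)]
      exact (Prod.ext (congrFun VectorField.mlieBracket_zero_right p.1)
        (congrFun VectorField.mlieBracket_zero_left p.2)).trans (map_zero (prodAnchor I M B p)).symm
    · simp only [expBracket, h1]
      simp

end Product

end LieAlgebroid

end Pullbacks

/-! ### Spanning families over compact sets -/

section GlobalSpanning

variable {E : Type*} [NormedAddCommGroup E] [NormedSpace ℝ E]
  {H : Type*} [TopologicalSpace H] {I : ModelWithCorners ℝ E H}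
  {M : Type*} [TopologicalSpace M] [ChartedSpace H M] [IsManifold I ∞ M]
  {F : Type*} [NormedAddCommGroup F] [NormedSpace ℝ F]
  {V : M → Type*} [TopologicalSpace (TotalSpace F V)] [∀ x, AddCommGroup (V x)]
  [∀ x, Module ℝ (V x)] [∀ x, TopologicalSpace (V x)] [FiberBundle F V] [VectorBundle ℝ F V]
  [FiniteDimensional ℝ E] [FiniteDimensional ℝ F] [T2Space M] [ContMDiffVectorBundle ∞ F V I]

/-- Near a point of its domain, a section has smooth coefficients with respect to a frame. -/
theorem GlobalFrame.exists_coord {x₀ x : M} (e : GlobalFrame I F V x₀) (hx : x ∈ e.U)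
    (s : Cₛ^∞⟮I; F, V⟯) :
    ∃ u : Fin e.n → C^∞⟮I, M; 𝓘(ℝ, ℝ), ℝ⟯, ∀ᶠ x' in 𝓝 x, s x' = ∑ i, u i x' • e.sec i x' := by
  have h1 (i : Fin e.n) : ∃ u : C^∞⟮I, M; 𝓘(ℝ, ℝ), ℝ⟯,
      u =ᶠ[𝓝 x] fun x' ↦ e.coord i x' (s x') :=
    exists_contMDiffMap_eventuallyEq e.isOpen hx fun z hz ↦
      (e.contMDiffAt_coord_along (f := fun z ↦ z) hz s.contMDiff.contMDiffAt i).contMDiffWithinAt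
  choose u hu using h1
  refine ⟨u, ?_⟩
  filter_upwards [Filter.eventually_all.2 hu, e.isOpen.mem_nhds hx] with x' hx' hU
  simp only [hx']
  exact (e.sum_coord x' hU _).symm

/-- Over a compact set, every section is a combination of finitely many fixed sections, with smooth
coefficients. -/
theorem exists_spanning_of_isCompact [SigmaCompactSpace M] {K : Set M} (hK : IsCompact K) :
    ∃ (n : ℕ) (e : Fin n → Cₛ^∞⟮I; F, V⟯), ∀ s : Cₛ^∞⟮I; F, V⟯,
      ∃ u : Fin n → C^∞⟮I, M; 𝓘(ℝ, ℝ), ℝ⟯, ∀ x ∈ K, s x = ∑ i, u i x • e i x := by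
  let e (x : M) : GlobalFrame I F V x := (nonempty_globalFrame I F V x).some
  obtain ⟨T, -, hT⟩ := hK.elim_nhds_subcover (fun x ↦ (e x).U)
    fun x _ ↦ (e x).isOpen.mem_nhds (e x).mem
  obtain ⟨ψ, hψ⟩ := SmoothPartitionOfUnity.exists_isSubordinate I hK.isClosed
    (fun a : T ↦ (e a).U) (fun a ↦ (e a).isOpen) (by
      intro x hx
      obtain ⟨a, ha, hxa⟩ := Set.mem_iUnion₂.1 (hT hx)
      exact Set.mem_iUnion.2 ⟨⟨a, ha⟩, hxa⟩)
  let ι := Σ a : T, Fin (e a).n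
  have hι (s : Cₛ^∞⟮I; F, V⟯) : ∃ u : ι → C^∞⟮I, M; 𝓘(ℝ, ℝ), ℝ⟯,
      ∀ x ∈ K, s x = ∑ i, u i x • (e i.1).sec i.2 x := by
    refine ⟨fun i ↦ ⟨fun x ↦ ψ i.1 x • (e i.1).coord i.2 x (s x),
      contMDiff_of_tsupport fun x hx ↦ ?_⟩, fun x hx ↦ ?_⟩
    · have hxU : x ∈ (e i.1).U :=
        hψ i.1 (closure_mono (Function.support_smul_subset_left _ _) hx)
      exact ((ψ i.1).contMDiff x).smul ((e i.1).contMDiffAt_coord_along (f := fun z ↦ z) hxU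
        s.contMDiff.contMDiffAt i.2)
    · have h1 : ∑ a : T, ψ a x = 1 := by
        rw [← finsum_eq_sum_of_fintype]; exact ψ.sum_eq_one hx
      have h2 (a : T) : ψ a x • s x =
          ∑ i, (ψ a x • (e a).coord i x (s x)) • (e a).sec i x := by
        by_cases hxa : x ∈ (e a).U
        · conv_lhs => rw [← (e a).sum_coord x hxa (s x), Finset.smul_sum]
          exact Finset.sum_congr rfl fun i _ ↦ (mul_smul _ _ _).symm
        · have h0 : ψ a x = 0 := image_eq_zero_of_notMem_tsupport fun h ↦ hxa (hψ a h)
          simp [h0]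
      calc s x = (∑ a : T, ψ a x) • s x := by rw [h1, one_smul]
        _ = _ := by
          rw [Finset.sum_smul, Fintype.sum_sigma]
          exact Finset.sum_congr rfl fun a _ ↦ h2 a
  let eqv := (Fintype.equivFin ι).symm
  refine ⟨_, fun i ↦ (e (eqv i).1).sec (eqv i).2, fun s ↦ ?_⟩
  obtain ⟨u, hu⟩ := hι s
  refine ⟨u ∘ eqv, fun x hx ↦ (hu x hx).trans ?_⟩
  exact (eqv.sum_comp fun i ↦ u i x • (e i.1).sec i.2 x).symm

end GlobalSpanning

/-! ### Derivatives in the direction of time -/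

section TimeDerivative

variable {E : Type*} [NormedAddCommGroup E] [NormedSpace ℝ E]
  {H : Type*} [TopologicalSpace H] {I : ModelWithCorners ℝ E H}
  {M : Type*} [TopologicalSpace M] [ChartedSpace H M] [IsManifold I ∞ M]
  {J : TopologicalSpace.Opens ℝ}

open Classical in
/-- The inverse of the inclusion `J → ℝ`, extended by a constant outside of `J`. -/
noncomputable def toOpens (t₀ : J) (t : ℝ) : J := if h : t ∈ J then ⟨t, h⟩ else t₀

theorem toOpens_of_mem (t₀ : J) {t : ℝ} (h : t ∈ J) : toOpens t₀ t = ⟨t, h⟩ := dif_pos h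

theorem val_comp_toOpens (t₀ : J) {t : ℝ} (h : t ∈ J) :
    (Subtype.val ∘ toOpens t₀ : ℝ → ℝ) =ᶠ[𝓝 t] id := by
  filter_upwards [J.isOpen.mem_nhds h] with s hs
  simp [toOpens_of_mem t₀ hs]

theorem contMDiffAt_toOpens (t₀ : J) {t : ℝ} (h : t ∈ J) :
    ContMDiffAt 𝓘(ℝ, ℝ) 𝓘(ℝ, ℝ) ∞ (toOpens t₀) t :=
  (ContMDiffAt.subtypeVal_comp_iff J _ _).1 (contMDiffAt_id.congr_of_eventuallyEq
    (val_comp_toOpens t₀ h))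

theorem hasMFDerivAt_toOpens (t₀ : J) {t : ℝ} (h : t ∈ J) :
    HasMFDerivAt 𝓘(ℝ, ℝ) 𝓘(ℝ, ℝ) (toOpens t₀) t (ContinuousLinearMap.id ℝ ℝ) := by
  refine ⟨(contMDiffAt_toOpens t₀ h).continuousAt, ?_⟩
  have h1 := hasFDerivAt_id (𝕜 := ℝ) t
  refine (h1.congr_of_eventuallyEq ?_).hasFDerivWithinAt
  filter_upwards [val_comp_toOpens t₀ h] with s hs
  simpa [writtenInExtChartAt, extChartAt] using! hs

theorem hasDerivAt_comp_toOpens (t₀ : J) {t : ℝ} (h : t ∈ J) (m : M)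
    (g : C^∞⟮𝓘(ℝ, ℝ).prod I, J × M; 𝓘(ℝ, ℝ), ℝ⟯) :
    HasDerivAt (fun t ↦ g (toOpens t₀ t, m))
      (mvfderiv (𝓘(ℝ, ℝ).prod I) g (⟨t, h⟩, m)
        (LieAlgebroid.timeField ((⟨t, h⟩, m) : J × M))) t := by
  have h1 := (hasMFDerivAt_toOpens t₀ h).prodMk (hasMFDerivAt_const (I := 𝓘(ℝ, ℝ)) (I' := I) m t)
  have hg : HasMFDerivAt (𝓘(ℝ, ℝ).prod I) 𝓘(ℝ, ℝ) g (toOpens t₀ t, m)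
      (mfderiv (𝓘(ℝ, ℝ).prod I) 𝓘(ℝ, ℝ) g (toOpens t₀ t, m)) :=
    g.mdifferentiableAt.hasMFDerivAt
  let L (p : J × M) : ℝ × E →L[ℝ] ℝ := mfderiv (𝓘(ℝ, ℝ).prod I) 𝓘(ℝ, ℝ) g p
  have h2 : HasFDerivAt (fun t ↦ g (toOpens t₀ t, m))
      ((L (toOpens t₀ t, m)).comp ((ContinuousLinearMap.id ℝ ℝ).prod 0)) t :=
    hasMFDerivAt_iff_hasFDerivAt.1 (hg.comp t h1)
  refine h2.hasDerivAt.congr_deriv ?_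
  exact congrArg (fun s : J ↦ L (s, m) (1, 0)) (toOpens_of_mem t₀ h)

end TimeDerivative

/-! ### Parallel transport in the direction of time -/

section ParallelTransport

universe uE

variable {E : Type uE} [NormedAddCommGroup E] [NormedSpace ℝ E] [FiniteDimensional ℝ E]
  {H : Type*} [TopologicalSpace H] {I : ModelWithCorners ℝ E H}
  {M : Type*} [TopologicalSpace M] [ChartedSpace H M] [IsManifold I ∞ M] [T2Space M]
  {J : TopologicalSpace.Opens ℝ}
  {F : Type*} [NormedAddCommGroup F] [NormedSpace ℝ F] [FiniteDimensional ℝ F]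
  {V : J × M → Type*} [TopologicalSpace (TotalSpace F V)] [∀ x, AddCommGroup (V x)]
  [∀ x, Module ℝ (V x)] [∀ x, TopologicalSpace (V x)] [FiberBundle F V] [VectorBundle ℝ F V]
  [ContMDiffVectorBundle ∞ F V (𝓘(ℝ, ℝ).prod I)]

/-- A derivation of the sections of a bundle over `J × M` which covers the vector field `∂_t`. -/
def IsTimeDerivation (D : Cₛ^∞⟮𝓘(ℝ, ℝ).prod I; F, V⟯ →ₗ[ℝ] Cₛ^∞⟮𝓘(ℝ, ℝ).prod I; F, V⟯) : Prop :=
  ∀ p, IsPointDerivation (LieAlgebroid.timeField p : TangentSpace (𝓘(ℝ, ℝ).prod I) p)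
    (evalSection p ∘ₗ D)

namespace IsTimeDerivation

variable {D : Cₛ^∞⟮𝓘(ℝ, ℝ).prod I; F, V⟯ →ₗ[ℝ] Cₛ^∞⟮𝓘(ℝ, ℝ).prod I; F, V⟯}

theorem congr (hD : IsTimeDerivation D) {σ τ : Cₛ^∞⟮𝓘(ℝ, ℝ).prod I; F, V⟯} {p : J × M}
    (h : ∀ᶠ q in 𝓝 p, σ q = τ q) : D σ p = D τ p :=
  (hD p).congr h

theorem apply_sum (hD : IsTimeDerivation D) {ι : Type*} [Fintype ι]
    (u : ι → C^∞⟮𝓘(ℝ, ℝ).prod I, J × M; 𝓘(ℝ, ℝ), ℝ⟯)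
    (e : ι → Cₛ^∞⟮𝓘(ℝ, ℝ).prod I; F, V⟯) (p : J × M) :
    D (∑ i, smulSection (u i) (e i)) p = ∑ i, (u i p • D (e i) p +
      mvfderiv (𝓘(ℝ, ℝ).prod I) (u i) p (LieAlgebroid.timeField p) • e i p) := by
  rw [map_sum, ContMDiffSection.sum_apply]
  exact Finset.sum_congr rfl fun i _ ↦ hD p (u i) (e i)

/-- The equation `D σ = 0` for `σ = ∑ x_i e_i`, where `D e_j = ∑ c_ij e_i`. -/
theorem apply_sum_eq (hD : IsTimeDerivation D) {ι : Type*} [Fintype ι]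
    (x : ι → C^∞⟮𝓘(ℝ, ℝ).prod I, J × M; 𝓘(ℝ, ℝ), ℝ⟯)
    (e : ι → Cₛ^∞⟮𝓘(ℝ, ℝ).prod I; F, V⟯)
    (c : ι → ι → C^∞⟮𝓘(ℝ, ℝ).prod I, J × M; 𝓘(ℝ, ℝ), ℝ⟯) (p : J × M)
    (hc : ∀ j, D (e j) p = ∑ i, c j i p • e i p) :
    D (∑ i, smulSection (x i) (e i)) p = ∑ i, (∑ j, c j i p * x j p +
      mvfderiv (𝓘(ℝ, ℝ).prod I) (x i) p (LieAlgebroid.timeField p)) • e i p := by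
  rw [hD.apply_sum]
  simp only [hc, Finset.sum_add_distrib, add_smul, Finset.smul_sum, Finset.sum_smul]
  rw [Finset.sum_comm]
  simp only [← mul_smul, mul_comm]

/-- A parallel section which vanishes at one point of a time interval vanishes on the whole
interval. -/
theorem eq_zero_of_eq_zero (hD : IsTimeDerivation D) {S : Set ℝ} (hS : IsPreconnected S)
    (hSo : IsOpen S) (hSJ : S ⊆ J) {m : M} {σ : Cₛ^∞⟮𝓘(ℝ, ℝ).prod I; F, V⟯}
    (hσ : ∀ t : J, (t : ℝ) ∈ S → D σ (t, m) = 0) {t₁ t₂ : J} (h₁ : (t₁ : ℝ) ∈ S)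
    (h₂ : (t₂ : ℝ) ∈ S) (h0 : σ (t₁, m) = 0) : σ (t₂, m) = 0 := by
  suffices H : ∀ a ∈ S, ∀ b ∈ S, (σ (toOpens t₁ a, m) = 0 ↔ σ (toOpens t₁ b, m) = 0) by
    have h := (H t₁ h₁ t₂ h₂).1
    rw [toOpens_of_mem t₁ t₁.2, toOpens_of_mem t₁ t₂.2] at h
    exact h h0
  intro a ha b hb
  refine hS.induction₂ (fun a b ↦ σ (toOpens t₁ a, m) = 0 ↔ σ (toOpens t₁ b, m) = 0) ?_
    (fun _ _ _ _ _ _ h h' ↦ h.trans h') (fun _ _ _ _ h ↦ h.symm) ha hb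
  intro t ht
  refine Filter.Eventually.filter_mono nhdsWithin_le_nhds ?_
  -- near `p`, the section and the derivation are given by a linear ODE in a frame
  set p : J × M := (toOpens t₁ t, m) with hp
  have hcurve : ContinuousAt (fun s ↦ ((toOpens t₁ s, m) : J × M)) t :=
    (contMDiffAt_toOpens t₁ (hSJ ht)).continuousAt.prodMk continuousAt_const
  obtain ⟨e⟩ := nonempty_globalFrame (𝓘(ℝ, ℝ).prod I) F V p
  obtain ⟨x, hx⟩ := e.exists_coord e.mem σ
  have h1 (j : Fin e.n) := e.exists_coord e.mem (D (e.sec j))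
  choose c hc using h1
  have hnear : ∀ᶠ q in 𝓝 p, (q ∈ e.U ∧ σ q = ∑ i, x i q • e.sec i q) ∧
      D σ q = ∑ i, (∑ j, c j i q * x j q +
        mvfderiv (𝓘(ℝ, ℝ).prod I) (x i) q (LieAlgebroid.timeField q)) • e.sec i q := by
    have hU : ∀ᶠ q in 𝓝 p, q ∈ e.U := e.isOpen.mem_nhds e.mem
    filter_upwards [hU, hx, hx.eventually_nhds, Filter.eventually_all.2 hc] with q hq₁ hq₂ hq₃ hq₄
    refine ⟨⟨hq₁, hq₂⟩, ?_⟩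
    rw [← hD.apply_sum_eq x e.sec c q hq₄]
    refine hD.congr (hq₃.mono fun q' hq' ↦ hq'.trans ?_)
    rw [ContMDiffSection.sum_apply]
    rfl
  let X : ℝ → Fin e.n → ℝ := fun s i ↦ x i (toOpens t₁ s, m)
  let A : ℝ → (Fin e.n → ℝ) →L[ℝ] (Fin e.n → ℝ) := fun s ↦
    -∑ i, ∑ j, c j i (toOpens t₁ s, m) •
      ((ContinuousLinearMap.single ℝ (fun _ : Fin e.n ↦ ℝ) i).comp (ContinuousLinearMap.proj j))
  have hA : ContinuousAt A t := by
    refine ContinuousAt.neg (tendsto_finsetSum _ fun i _ ↦ tendsto_finsetSum _ fun j _ ↦ ?_)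
    exact (ContinuousAt.comp (g := c j i) (c j i).contMDiff.continuous.continuousAt hcurve).smul
      continuousAt_const
  have hAX (s : ℝ) (i : Fin e.n) : A s (X s) i = -∑ j, c j i (toOpens t₁ s, m) * X s j := by
    simp [A, Finset.sum_apply, Pi.single_apply]
  have hzero (s : ℝ) (h : ((toOpens t₁ s, m) : J × M) ∈ e.U ∧
      σ (toOpens t₁ s, m) = ∑ i, x i (toOpens t₁ s, m) • e.sec i (toOpens t₁ s, m)) :
      σ (toOpens t₁ s, m) = 0 ↔ X s = 0 := by
    rw [h.2]
    constructor
    · intro h0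
      refine e.coeff_eq h.1 (h0.trans ?_)
      simp
    · intro h0
      exact Finset.sum_eq_zero fun i _ ↦ by rw [show x i (toOpens t₁ s, m) = 0 from congrFun h0 i,
        zero_smul]
  have hX : ∀ᶠ s in 𝓝 t, HasDerivAt X (A s (X s)) s := by
    filter_upwards [hcurve.eventually hnear, hSo.mem_nhds ht] with s hs hsS
    refine hasDerivAt_pi.2 fun i ↦ ?_
    refine (hasDerivAt_comp_toOpens t₁ (hSJ hsS) m (x i)).congr_deriv ?_
    rw [hAX]
    have h2 := hs.2
    rw [toOpens_of_mem t₁ (hSJ hsS)] at h2 hs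
    rw [hσ _ hsS] at h2
    have h3 := congrFun (e.coeff_eq (b := fun _ ↦ 0) hs.1.1 (h2.symm.trans (by simp))) i
    simp only [X, toOpens_of_mem t₁ (hSJ hsS)]
    linarith
  have hev : ∀ᶠ s in 𝓝 t, (X t = 0 ↔ X s = 0) := by
    by_cases h0 : X t = 0
    · filter_upwards [linearODE_eventually_eq_zero hA hX h0] with s hs
      simp [h0, hs]
    · filter_upwards [hX.self_of_nhds.continuousAt.eventually_ne h0] with s hs
      simp [h0, hs]
  have ht' := hnear.self_of_nhds
  filter_upwards [hev, hcurve.eventually hnear] with s hs₁ hs₂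
  rw [hzero t ht'.1, hzero s hs₂.1, hs₁]

end IsTimeDerivation

end ParallelTransport

/-! ### Existence of parallel sections -/

section ParallelTransportExistence

universe uE

variable {E : Type uE} [NormedAddCommGroup E] [NormedSpace ℝ E] [FiniteDimensional ℝ E]
  {H : Type*} [TopologicalSpace H] {I : ModelWithCorners ℝ E H} [I.Boundaryless]
  {M : Type*} [TopologicalSpace M] [ChartedSpace H M] [IsManifold I ∞ M] [T2Space M]
  {J : TopologicalSpace.Opens ℝ}
  {F : Type*} [NormedAddCommGroup F] [NormedSpace ℝ F] [FiniteDimensional ℝ F]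
  {V : J × M → Type*} [TopologicalSpace (TotalSpace F V)] [∀ x, AddCommGroup (V x)]
  [∀ x, Module ℝ (V x)] [∀ x, TopologicalSpace (V x)] [FiberBundle F V] [VectorBundle ℝ F V]
  [ContMDiffVectorBundle ∞ F V (𝓘(ℝ, ℝ).prod I)]

/-- Smooth functions on `J × M` are, over a compact interval in `J` and near a point of `M`,
restrictions of smooth functions on `ℝ × E`, where `E` is the model space of `M`. -/
theorem exists_chart_extension {c₀ r R : ℝ} (hr : 0 < r) (hrR : r < R)
    (hRJ : Metric.closedBall c₀ R ⊆ (J : Set ℝ)) (t₀ : J) (m₀ : M) :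
    ∃ O : Set M, O ∈ 𝓝 m₀ ∧ (∃ C : Set M, IsCompact C ∧ O ⊆ C) ∧
      ∀ g : C^∞⟮𝓘(ℝ, ℝ).prod I, J × M; 𝓘(ℝ, ℝ), ℝ⟯, ∃ g' : ℝ × E → ℝ, ContDiff ℝ ∞ g' ∧
        ∀ t : J, (t : ℝ) ∈ Metric.closedBall c₀ r → ∀ m ∈ O,
          g' (t, extChartAt I m₀ m) = g (t, m) := by
  obtain ⟨ρ, hρ, hρt⟩ := Metric.nhds_basis_closedBall.mem_iff.1
    ((isOpen_extChartAt_target (I := I) m₀).mem_nhds (mem_extChartAt_target (I := I) m₀))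
  let lam : ContDiffBump c₀ := ⟨r, R, hr, hrR⟩
  let mu : ContDiffBump (extChartAt I m₀ m₀) := ⟨ρ / 2, ρ, half_pos hρ, half_lt_self hρ⟩
  have hsub : Metric.closedBall (extChartAt I m₀ m₀) (ρ / 2) ⊆ (extChartAt I m₀).target :=
    (Metric.closedBall_subset_closedBall (half_le_self hρ.le)).trans hρt
  refine ⟨(extChartAt I m₀).source ∩ extChartAt I m₀ ⁻¹' Metric.closedBall (extChartAt I m₀ m₀)
    (ρ / 2), ?_, ⟨(extChartAt I m₀).symm '' Metric.closedBall (extChartAt I m₀ m₀) (ρ / 2),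
    (isCompact_closedBall _ _).image_of_continuousOn
      ((continuousOn_extChartAt_symm m₀).mono hsub), fun m hm ↦
        ⟨_, hm.2, (extChartAt I m₀).left_inv hm.1⟩⟩, fun g ↦
    ⟨fun z ↦ (lam z.1 * mu z.2) • g (toOpens t₀ z.1, (extChartAt I m₀).symm z.2), ?_, ?_⟩⟩
  · exact Filter.inter_mem (extChartAt_source_mem_nhds m₀)
      ((continuousAt_extChartAt m₀).preimage_mem_nhds (Metric.closedBall_mem_nhds _ (half_pos hρ)))
  · rw [← contMDiff_iff_contDiff]
    refine contMDiff_of_tsupport fun z hz ↦ ?_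
    have hz' : z ∈ Metric.closedBall c₀ R ×ˢ Metric.closedBall (extChartAt I m₀ m₀) ρ := by
      refine closure_minimal ?_ (Metric.isClosed_closedBall.prod Metric.isClosed_closedBall) hz
      intro w hw
      have h1 : lam w.1 * mu w.2 ≠ 0 := left_ne_zero_of_smul hw
      exact ⟨lam.tsupport_eq ▸ subset_closure (left_ne_zero_of_mul h1),
        mu.tsupport_eq ▸ subset_closure (right_ne_zero_of_mul h1)⟩
    have h1 : ContMDiffAt 𝓘(ℝ, ℝ × E) 𝓘(ℝ, ℝ) ∞ (fun z : ℝ × E ↦ lam z.1 * mu z.2) z :=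
      ((lam.contDiff.comp contDiff_fst).mul
        (mu.contDiff.comp contDiff_snd)).contMDiff.contMDiffAt
    have h2 : ContMDiffAt 𝓘(ℝ, ℝ × E) 𝓘(ℝ, ℝ) ∞ (fun z : ℝ × E ↦ toOpens t₀ z.1) z :=
      (contMDiffAt_toOpens t₀ (hRJ hz'.1)).comp z contDiff_fst.contMDiff.contMDiffAt
    have h3 : ContMDiffAt 𝓘(ℝ, ℝ × E) I ∞ (fun z : ℝ × E ↦ (extChartAt I m₀).symm z.2) z :=
      ((contMDiffOn_extChartAt_symm m₀).contMDiffAt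
        ((isOpen_extChartAt_target m₀).mem_nhds (hρt hz'.2))).comp z
          contDiff_snd.contMDiff.contMDiffAt
    exact h1.smul ((g.contMDiff _).comp z (h2.prodMk h3))
  · intro t ht m hm
    have h1 : lam (t : ℝ) = 1 := lam.one_of_mem_closedBall ht
    have h2 : mu (extChartAt I m₀ m) = 1 := mu.one_of_mem_closedBall hm.2
    simp only [h1, h2, (extChartAt I m₀).left_inv hm.1, toOpens_of_mem t₀ t.2]
    simp

/-- Conversely, functions on `ℝ × E` define functions on `J × M` near a point of `M`. -/
theorem exists_chart_restriction {g : ℝ × E → ℝ} (hg : ContDiff ℝ ∞ g) {m₀ : M} {χ : M → ℝ}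
    (hχ : ContMDiff I 𝓘(ℝ, ℝ) ∞ χ) (hχs : tsupport χ ⊆ (chartAt H m₀).source) :
    ContMDiff (𝓘(ℝ, ℝ).prod I) 𝓘(ℝ, ℝ) ∞
      (fun p : J × M ↦ χ p.2 • g (p.1, extChartAt I m₀ p.2)) := by
  refine contMDiff_of_tsupport fun p hp ↦ ?_
  have hp' : p.2 ∈ tsupport χ := by
    have h1 : IsClosed (Prod.snd ⁻¹' tsupport χ : Set (J × M)) :=
      (isClosed_tsupport χ).preimage continuous_snd
    refine closure_minimal ?_ h1 hp
    exact fun q hq ↦ subset_closure (left_ne_zero_of_smul hq)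
  have h1 : ContMDiffAt (𝓘(ℝ, ℝ).prod I) 𝓘(ℝ, ℝ) ∞ (fun p : J × M ↦ χ p.2) p :=
    (hχ _).comp p contMDiffAt_snd
  have h2 : ContMDiffAt (𝓘(ℝ, ℝ).prod I) 𝓘(ℝ, ℝ) ∞ (fun p : J × M ↦ (p.1 : ℝ)) p :=
    (contMDiff_subtype_val _).comp p contMDiffAt_fst
  have h3 : ContMDiffAt (𝓘(ℝ, ℝ).prod I) 𝓘(ℝ, E) ∞ (fun p : J × M ↦ extChartAt I m₀ p.2) p :=
    (contMDiffAt_extChartAt' (hχs hp')).comp p contMDiffAt_snd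
  exact h1.smul ((hg.contMDiff.contMDiffAt).comp p (h2.prodMk_space h3))

namespace IsTimeDerivation

variable {D : Cₛ^∞⟮𝓘(ℝ, ℝ).prod I; F, V⟯ →ₗ[ℝ] Cₛ^∞⟮𝓘(ℝ, ℝ).prod I; F, V⟯}

/-- Local existence of parallel sections. In a chart at `m₀`, a linear differential equation with
parameters for the coefficients with respect to a spanning family of sections implies `D τ = 0`; a
cutoff function extends its solution to a global section. -/
theorem exists_parallel_local [SecondCountableTopology M] (hD : IsTimeDerivation D) {c₀ r R : ℝ}
    (hr : 0 < r) (hrR : r < R) (hRJ : Metric.closedBall c₀ R ⊆ (J : Set ℝ)) {t₀ : J}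
    (ht₀ : (t₀ : ℝ) = 0) (ht₀r : (t₀ : ℝ) ∈ Metric.ball c₀ r) {s : ∀ m, V (t₀, m)}
    (hs : ContMDiff I ((𝓘(ℝ, ℝ).prod I).prod 𝓘(ℝ, F)) ∞
      (fun m ↦ (⟨(t₀, m), s m⟩ : TotalSpace F V))) (m₀ : M) :
    ∃ τ : Cₛ^∞⟮𝓘(ℝ, ℝ).prod I; F, V⟯, ∀ᶠ m in 𝓝 m₀, τ (t₀, m) = s m ∧
      ∀ t : J, (t : ℝ) ∈ Metric.ball c₀ r → D τ (t, m) = 0 := by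
  have hlcH : LocallyCompactSpace H := I.locallyCompactSpace
  have hlcM : LocallyCompactSpace M := ChartedSpace.locallyCompactSpace H M
  have hlcJ : LocallyCompactSpace J := ChartedSpace.locallyCompactSpace ℝ J
  obtain ⟨O, hO, ⟨C, hC, hOC⟩, hext⟩ := exists_chart_extension (I := I) hr hrR hRJ t₀ m₀
  have hKJ : IsCompact {t : J | (t : ℝ) ∈ Metric.closedBall c₀ r} :=
    Topology.IsInducing.subtypeVal.isCompact_preimage' (isCompact_closedBall c₀ r) (by
      rw [Subtype.range_coe]
      exact (Metric.closedBall_subset_closedBall hrR.le).trans hRJ)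
  obtain ⟨n, e, he⟩ := exists_spanning_of_isCompact (I := 𝓘(ℝ, ℝ).prod I) (F := F) (V := V)
    (hKJ.prod hC)
  choose c hc using fun j ↦ he (D (e j))
  -- the initial values of the coefficients
  obtain ⟨k, h, b, hb⟩ := exists_isLocalExpansion (f := LieAlgebroid.timeIncl I t₀) (s := s)
    isOpen_univ (Set.mem_univ m₀) hs.contMDiffOn
  choose u hu using fun j ↦ he (b j)
  let x₀ (i : Fin n) : C^∞⟮I, M; 𝓘(ℝ, ℝ), ℝ⟯ :=
    ∑ j, h j * (u j i).comp (LieAlgebroid.timeIncl I t₀)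
  have hx₀ (i : Fin n) (m : M) : x₀ i m = ∑ j, h j m * u j i (t₀, m) := by
    have := map_sum (ContMDiffMap.coeFnRingHom (I := I) (N := M) (n := ∞) (I' := 𝓘(ℝ, ℝ)) (R := ℝ))
      (fun j ↦ h j * (u j i).comp (LieAlgebroid.timeIncl I t₀)) Finset.univ
    refine (congrFun this m).trans ?_
    rw [Finset.sum_apply]
    rfl
  -- the ODE in a chart
  choose c' hc' hcc' using fun j i ↦ hext (c j i)
  choose x₀' hx₀' hxx₀' using fun i ↦ hext ((x₀ i).comp ContMDiffMap.snd)
  let F' := ULift.{uE} (Fin n) → ℝ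
  let A : ℝ → E → F' →L[ℝ] F' := fun t z ↦ -∑ i, ∑ j, c' j.down i.down (t, z) •
    ((ContinuousLinearMap.single ℝ (fun _ : ULift.{uE} (Fin n) ↦ ℝ) i).comp
      (ContinuousLinearMap.proj j))
  have hA : ContDiff ℝ ∞ ↿A := by
    refine ContDiff.neg (ContDiff.sum fun i _ ↦ ContDiff.sum fun j _ ↦ ?_)
    exact (hc' j.down i.down).smul contDiff_const
  have hAx (t : ℝ) (z : E) (v : F') (i : Fin n) :
      A t z v ⟨i⟩ = -∑ j, c' j i (t, z) * v ⟨j⟩ := by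
    simp only [A, F', neg_apply, sum_apply, Pi.neg_apply,
      Finset.sum_apply, smul_apply, ContinuousLinearMap.comp_apply,
      ContinuousLinearMap.proj_apply, ContinuousLinearMap.single_apply, Pi.smul_apply,
      Pi.single_apply, smul_eq_mul, mul_ite, mul_zero]
    rw [Finset.sum_comm]
    simp only [Finset.sum_ite_eq, Finset.mem_univ, if_true]
    congr 1
    exact Equiv.ulift.sum_comp fun j ↦ c' j i (t, z) * v ⟨j⟩
  have hinit : ContDiff ℝ ∞ (fun z : E ↦ (fun i ↦ x₀' i.down (0, z) : F')) :=
    contDiff_pi.2 fun i ↦ (hx₀' i.down).comp (contDiff_const.prodMk contDiff_id)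
  obtain ⟨X, hX, hX0, hXd⟩ := exists_linearODE_contDiff hA hinit
  -- back to the manifold
  obtain ⟨χ, hχ1, hχs⟩ := exists_cutoff (I := I)
    ((chartAt H m₀).open_source.mem_nhds (mem_chart_source H m₀))
  let x (i : Fin n) : C^∞⟮𝓘(ℝ, ℝ).prod I, J × M; 𝓘(ℝ, ℝ), ℝ⟯ :=
    ⟨fun p ↦ χ p.2 • X p.1 (extChartAt I m₀ p.2) ⟨i⟩,
      exists_chart_restriction (g := fun z ↦ X z.1 z.2 ⟨i⟩) (contDiff_pi.1 hX ⟨i⟩)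
        χ.contMDiff hχs⟩
  have hxX {m : M} (hm : χ m = 1) (i : Fin n) (t : J) :
      x i (t, m) = X t (extChartAt I m₀ m) ⟨i⟩ := by
    change χ m • X t (extChartAt I m₀ m) ⟨i⟩ = _
    rw [hm, one_smul]
  refine ⟨∑ i, smulSection (x i) (e i), ?_⟩
  filter_upwards [hχ1, hO, hb] with m hm hmO hbm
  have hm' : χ m = 1 := hm
  have hball : Metric.ball c₀ r ⊆ Metric.closedBall c₀ r := Metric.ball_subset_closedBall
  constructor
  · have h1 (i : Fin n) : x i (t₀, m) = ∑ j, h j m * u j i (t₀, m) := by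
      rw [hxX hm', ht₀, hX0, ← hx₀]
      refine Eq.trans ?_ (hxx₀' i t₀ (hball ht₀r) m hmO)
      rw [ht₀]
    have h2 (j : Fin k) : b j (t₀, m) = ∑ i, u j i (t₀, m) • e i (t₀, m) :=
      hu j (t₀, m) ⟨hball ht₀r, hOC hmO⟩
    refine Eq.trans ?_ hbm.symm
    change _ = ∑ j, h j m • b j (t₀, m)
    rw [ContMDiffSection.sum_apply]
    simp only [smulSection_apply, h1, h2, Finset.sum_smul, Finset.smul_sum, mul_smul]
    exact Finset.sum_comm
  · intro t ht
    have hmem : ((t, m) : J × M) ∈ {t : J | (t : ℝ) ∈ Metric.closedBall c₀ r} ×ˢ C :=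
      ⟨hball ht, hOC hmO⟩
    rw [hD.apply_sum_eq x e c (t, m) fun j ↦ hc j (t, m) hmem]
    refine Finset.sum_eq_zero fun i _ ↦ ?_
    have h1 := hasDerivAt_comp_toOpens t₀ t.2 m (x i)
    have h2 : HasDerivAt (fun t' ↦ x i (toOpens t₀ t', m))
        (A t (extChartAt I m₀ m) (X t (extChartAt I m₀ m)) ⟨i⟩) t := by
      refine (hasDerivAt_pi.1 (hXd t (extChartAt I m₀ m)) ⟨i⟩).congr_of_eventuallyEq ?_
      filter_upwards [J.isOpen.mem_nhds t.2] with t' ht'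
      rw [toOpens_of_mem t₀ ht', hxX hm']
    have h3 := h1.unique h2
    rw [hAx] at h3
    have h4 : mvfderiv (𝓘(ℝ, ℝ).prod I) (x i) (t, m) (LieAlgebroid.timeField (t, m)) =
        -∑ j, c j i (t, m) * x j (t, m) := by
      refine h3.trans ?_
      congr 1
      refine Finset.sum_congr rfl fun j _ ↦ ?_
      rw [hcc' j i t (hball ht) m hmO, hxX hm']
    rw [h4, add_neg_cancel, zero_smul]

theorem exists_ball_subset (hJ : (J : Set ℝ).OrdConnected) (t₀ t : J) :
    ∃ c₀ r R : ℝ, 0 < r ∧ r < R ∧ Metric.closedBall c₀ R ⊆ (J : Set ℝ) ∧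
      (t₀ : ℝ) ∈ Metric.ball c₀ r ∧ (t : ℝ) ∈ Metric.ball c₀ r := by
  obtain ⟨a, ha, haJ⟩ : ∃ a, a < min (t₀ : ℝ) t ∧ a ∈ J := by
    have h1 : min (t₀ : ℝ) t ∈ J := min_rec' (· ∈ J) t₀.2 t.2
    obtain ⟨ε, hε, h⟩ := Metric.isOpen_iff.1 J.isOpen _ h1
    exact ⟨min (t₀ : ℝ) t - ε / 2, by linarith, h (by
      rw [Metric.mem_ball, Real.dist_eq, abs_lt]; constructor <;> linarith)⟩
  obtain ⟨b, hb, hbJ⟩ : ∃ b, max (t₀ : ℝ) t < b ∧ b ∈ J := by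
    have h1 : max (t₀ : ℝ) t ∈ J := max_rec' (· ∈ J) t₀.2 t.2
    obtain ⟨ε, hε, h⟩ := Metric.isOpen_iff.1 J.isOpen _ h1
    exact ⟨max (t₀ : ℝ) t + ε / 2, by linarith, h (by
      rw [Metric.mem_ball, Real.dist_eq, abs_lt]; constructor <;> linarith)⟩
  have ha₁ := ha.trans_le (min_le_left _ _)
  have ha₂ := ha.trans_le (min_le_right _ _)
  have hb₁ := (le_max_left _ _).trans_lt hb
  have hb₂ := (le_max_right _ _).trans_lt hb
  let δ := min (min ((t₀ : ℝ) - a) (t - a)) (min (b - t₀) (b - t))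
  have hδ : 0 < δ := by simp only [δ, lt_min_iff]; refine ⟨⟨?_, ?_⟩, ?_, ?_⟩ <;> linarith
  have hδ₁ : δ ≤ t₀ - a := (min_le_left _ _).trans (min_le_left _ _)
  have hδ₂ : δ ≤ t - a := (min_le_left _ _).trans (min_le_right _ _)
  have hδ₃ : δ ≤ b - t₀ := (min_le_right _ _).trans (min_le_left _ _)
  have hδ₄ : δ ≤ b - t := (min_le_right _ _).trans (min_le_right _ _)
  refine ⟨(a + b) / 2, (b - a) / 2 - δ / 2, (b - a) / 2, by linarith, by linarith, ?_, ?_, ?_⟩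
  · rw [Real.closedBall_eq_Icc]
    refine Set.Subset.trans (Set.Icc_subset_Icc ?_ ?_) (hJ.out haJ hbJ) <;> linarith
  · rw [Real.ball_eq_Ioo]; constructor <;> linarith
  · rw [Real.ball_eq_Ioo]; constructor <;> linarith

/-- Every section at time `0` has a parallel extension. -/
theorem exists_parallel [SecondCountableTopology M] (hD : IsTimeDerivation D)
    (hJ : (J : Set ℝ).OrdConnected) {t₀ : J} (ht₀ : (t₀ : ℝ) = 0) {s : ∀ m, V (t₀, m)}
    (hs : ContMDiff I ((𝓘(ℝ, ℝ).prod I).prod 𝓘(ℝ, F)) ∞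
      (fun m ↦ (⟨(t₀, m), s m⟩ : TotalSpace F V))) :
    ∃ σ : Cₛ^∞⟮𝓘(ℝ, ℝ).prod I; F, V⟯, D σ = 0 ∧ ∀ m, σ (t₀, m) = s m := by
  choose c₀ r R hr hrR hRJ h0 ht using fun t : J ↦ exists_ball_subset hJ t₀ t
  choose τ hτ using fun p : J × M ↦
    hD.exists_parallel_local (hr p.1) (hrR p.1) (hRJ p.1) ht₀ (h0 p.1) hs p.2
  -- two local solutions agree where both are defined
  have huniq (p q : J × M) (t : J) (m : M) (hp : (t : ℝ) ∈ Metric.ball (c₀ p.1) (r p.1))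
      (hq : (t : ℝ) ∈ Metric.ball (c₀ q.1) (r q.1))
      (hpm : τ p (t₀, m) = s m ∧
        ∀ t : J, (t : ℝ) ∈ Metric.ball (c₀ p.1) (r p.1) → D (τ p) (t, m) = 0)
      (hqm : τ q (t₀, m) = s m ∧
        ∀ t : J, (t : ℝ) ∈ Metric.ball (c₀ q.1) (r q.1) → D (τ q) (t, m) = 0) :
      τ p (t, m) = τ q (t, m) := by
    have hconn : IsPreconnected (Metric.ball (c₀ p.1) (r p.1) ∩ Metric.ball (c₀ q.1) (r q.1)) := by
      rw [Real.ball_eq_Ioo, Real.ball_eq_Ioo, Set.Ioo_inter_Ioo]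
      exact isPreconnected_Ioo
    refine sub_eq_zero.1 (hD.eq_zero_of_eq_zero hconn (Metric.isOpen_ball.inter Metric.isOpen_ball)
      (fun a ha ↦ hRJ p.1 ((Metric.ball_subset_closedBall.trans
        (Metric.closedBall_subset_closedBall (hrR p.1).le)) ha.1)) (σ := τ p - τ q) (m := m)
      (fun t' ht' ↦ ?_) (t₁ := t₀) (t₂ := t) ⟨h0 p.1, h0 q.1⟩ ⟨hp, hq⟩ ?_)
    · rw [map_sub, ContMDiffSection.coe_sub, Pi.sub_apply, hpm.2 t' ht'.1, hqm.2 t' ht'.2, sub_zero]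
    · rw [ContMDiffSection.coe_sub, Pi.sub_apply, hpm.1, hqm.1, sub_self]
  have hev (p : J × M) : ∀ᶠ q in 𝓝 p, τ q q = τ p q ∧ D (τ p) q = 0 := by
    have h1 : ∀ᶠ q : J × M in 𝓝 p, (q.1 : ℝ) ∈ Metric.ball (c₀ p.1) (r p.1) :=
      (continuous_subtype_val.comp continuous_fst).continuousAt.eventually
        (Metric.isOpen_ball.mem_nhds (ht p.1))
    filter_upwards [h1, continuous_snd.continuousAt.eventually (hτ p)] with q hq₁ hq₂
    exact ⟨huniq q p q.1 q.2 (ht q.1) hq₁ (hτ q).self_of_nhds hq₂, hq₂.2 q.1 hq₁⟩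
  let σ : Cₛ^∞⟮𝓘(ℝ, ℝ).prod I; F, V⟯ := ⟨fun p ↦ τ p p, fun p ↦
    ((τ p).contMDiff p).congr_of_eventuallyEq ((hev p).mono fun q hq ↦
      congrArg (TotalSpace.mk q) hq.1)⟩
  refine ⟨σ, ContMDiffSection.ext fun p ↦ ?_, fun m ↦ (hτ (t₀, m)).self_of_nhds.1⟩
  rw [hD.congr (σ := σ) (τ := τ p) ((hev p).mono fun q hq ↦ hq.1), (hev p).self_of_nhds.2]
  rfl

/-- Uniqueness of the solution of `D σ = η` with a given value at one time. -/
theorem eq_of_eq (hD : IsTimeDerivation D) (hJ : (J : Set ℝ).OrdConnected)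
    {σ τ : Cₛ^∞⟮𝓘(ℝ, ℝ).prod I; F, V⟯} (h : D σ = D τ) {t₀ : J} {m : M}
    (h0 : σ (t₀, m) = τ (t₀, m)) (t : J) : σ (t, m) = τ (t, m) := by
  refine sub_eq_zero.1 (hD.eq_zero_of_eq_zero hJ.isPreconnected J.isOpen subset_rfl
    (σ := σ - τ) (fun t' _ ↦ ?_) t₀.2 t.2 (sub_eq_zero.2 h0))
  rw [map_sub, h, sub_self]
  rfl

end IsTimeDerivation

end ParallelTransportExistence

/-! ### Composition of morphisms and lifts to fibre products -/

section Morphisms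

variable {E : Type*} [NormedAddCommGroup E] [NormedSpace ℝ E] [FiniteDimensional ℝ E]
  {H : Type*} [TopologicalSpace H] {I : ModelWithCorners ℝ E H}
  {M : Type*} [TopologicalSpace M] [ChartedSpace H M] [IsManifold I ∞ M] [T2Space M]
  {F : Type*} [NormedAddCommGroup F] [NormedSpace ℝ F] [FiniteDimensional ℝ F]
  {V : M → Type*} [TopologicalSpace (TotalSpace F V)] [∀ x, AddCommGroup (V x)]
  [∀ x, Module ℝ (V x)] [∀ x, TopologicalSpace (V x)] [FiberBundle F V] [VectorBundle ℝ F V]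
  [ContMDiffVectorBundle ∞ F V I]
  {E' : Type*} [NormedAddCommGroup E'] [NormedSpace ℝ E'] [FiniteDimensional ℝ E']
  {H' : Type*} [TopologicalSpace H'] {I' : ModelWithCorners ℝ E' H'}
  {N : Type*} [TopologicalSpace N] [ChartedSpace H' N] [IsManifold I' ∞ N] [T2Space N]
  {G : Type*} [NormedAddCommGroup G] [NormedSpace ℝ G] [FiniteDimensional ℝ G]
  {W : N → Type*} [TopologicalSpace (TotalSpace G W)] [∀ x, AddCommGroup (W x)]
  [∀ x, Module ℝ (W x)] [∀ x, TopologicalSpace (W x)] [FiberBundle G W] [VectorBundle ℝ G W]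
  [ContMDiffVectorBundle ∞ G W I']
  {E₀ : Type*} [NormedAddCommGroup E₀] [NormedSpace ℝ E₀] [FiniteDimensional ℝ E₀]
  {H₀ : Type*} [TopologicalSpace H₀] {I₀ : ModelWithCorners ℝ E₀ H₀}
  {M₀ : Type*} [TopologicalSpace M₀] [ChartedSpace H₀ M₀] [IsManifold I₀ ∞ M₀] [T2Space M₀]
  {F₀ : Type*} [NormedAddCommGroup F₀] [NormedSpace ℝ F₀] [FiniteDimensional ℝ F₀]
  {V₀ : M₀ → Type*} [TopologicalSpace (TotalSpace F₀ V₀)] [∀ x, AddCommGroup (V₀ x)]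
  [∀ x, Module ℝ (V₀ x)] [∀ x, TopologicalSpace (V₀ x)] [FiberBundle F₀ V₀] [VectorBundle ℝ F₀ V₀]
  [ContMDiffVectorBundle ∞ F₀ V₀ I₀]

namespace LieAlgebroid

variable {A₀ : LieAlgebroid I₀ F₀ V₀} {A : LieAlgebroid I F V} {B : LieAlgebroid I' G W}

/-- The image of a bracket of expansions along `g` under a Lie algebroid morphism. -/
theorem _root_.LieAlgebroid.IsMorphism.map_expBracket {f : M → N} {Φ : ∀ x, V x →ₗ[ℝ] W (f x)}
    (hΦ : IsMorphism A B f Φ) (g : C^∞⟮I₀, M₀; I, M⟯) {x : M₀} {X Y : TangentSpace I₀ x}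
    {ι κ : Type*} [Fintype ι] [Fintype κ] {h : ι → C^∞⟮I₀, M₀; 𝓘(ℝ, ℝ), ℝ⟯}
    {b : ι → Cₛ^∞⟮I; F, V⟯} {h' : κ → C^∞⟮I₀, M₀; 𝓘(ℝ, ℝ), ℝ⟯} {b' : κ → Cₛ^∞⟮I; F, V⟯}
    (hX : mfderiv I₀ I g x X = A.anchor (g x) (∑ i, h i x • b i (g x)))
    (hY : mfderiv I₀ I g x Y = A.anchor (g x) (∑ j, h' j x • b' j (g x)))
    {α : ι → Type*} {β : κ → Type*} [∀ i, Fintype (α i)] [∀ j, Fintype (β j)]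
    {u : ∀ i, α i → C^∞⟮I, M; 𝓘(ℝ, ℝ), ℝ⟯} {c : ∀ i, α i → Cₛ^∞⟮I'; G, W⟯}
    {v : ∀ j, β j → C^∞⟮I, M; 𝓘(ℝ, ℝ), ℝ⟯} {d : ∀ j, β j → Cₛ^∞⟮I'; G, W⟯}
    (hu : ∀ i, ∀ᶠ z in 𝓝 (g x), Φ z (b i z) = ∑ k, u i k z • c i k (f z))
    (hv : ∀ j, ∀ᶠ z in 𝓝 (g x), Φ z (b' j z) = ∑ l, v j l z • d j l (f z)) :
    Φ (g x) (A.expBracket g X Y h b h' b') =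
      B.expBracket (f ∘ g) X Y (fun p : Σ i, α i ↦ h p.1 * (u p.1 p.2).comp g)
        (fun p ↦ c p.1 p.2) (fun p : Σ j, β j ↦ h' p.1 * (v p.1 p.2).comp g)
        (fun p ↦ d p.1 p.2) := by
  have hmul (w w' : C^∞⟮I₀, M₀; 𝓘(ℝ, ℝ), ℝ⟯) (Z : TangentSpace I₀ x) :
      mvfderiv I₀ (⇑w * ⇑w') x Z =
        w x * mvfderiv I₀ w' x Z + w' x * mvfderiv I₀ w x Z :=
    mvfderiv_mul_apply w.mdifferentiableAt w'.mdifferentiableAt Z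
  have hcX (w : C^∞⟮I, M; 𝓘(ℝ, ℝ), ℝ⟯) : mvfderiv I₀ (w.comp g) x X =
      ∑ i, h i x * mvfderiv I w (g x) (A.anchor (g x) (b i (g x))) := by
    refine (mvfderiv_comp_of_contMDiff g.contMDiff w X).trans ?_
    rw [hX, map_sum, map_sum]
    simp only [map_smul, smul_eq_mul]
  have hcY (w : C^∞⟮I, M; 𝓘(ℝ, ℝ), ℝ⟯) : mvfderiv I₀ (w.comp g) x Y =
      ∑ i, h' i x * mvfderiv I w (g x) (A.anchor (g x) (b' i (g x))) := by
    refine (mvfderiv_comp_of_contMDiff g.contMDiff w Y).trans ?_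
    rw [hY, map_sum, map_sum]
    simp only [map_smul, smul_eq_mul]
  have hc (w : C^∞⟮I, M; 𝓘(ℝ, ℝ), ℝ⟯) : w.comp g x = w (g x) := rfl
  have hbr (i : ι) (j : κ) := hΦ.map_bracket (B := B) (b i) (b' j) (hu i) (hv j)
  simp only [expBracket] at hbr
  simp only [expBracket, map_sub, map_add, map_sum, map_smul, hbr, fun i ↦ (hu i).self_of_nhds,
    fun j ↦ (hv j).self_of_nhds, Fintype.sum_sigma, hmul, hcX, hcY, ContMDiffMap.coe_mul,
    Pi.mul_apply, hc, smul_add, smul_sub, Finset.sum_add_distrib, Finset.sum_sub_distrib,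
    Finset.smul_sum, Finset.mul_sum, add_smul, Finset.sum_smul, ← mul_smul, Function.comp]
  have e1 (t : ∀ i, ∀ j, α i → β j → W (f (g x))) :
      ∑ i, ∑ j, ∑ k, ∑ l, t i j k l = ∑ i, ∑ k, ∑ j, ∑ l, t i j k l :=
    Finset.sum_congr rfl fun i _ ↦ Finset.sum_comm
  have e2 (t : ∀ _ : ι, ∀ j, β j → W (f (g x))) :
      ∑ i, ∑ j, ∑ l, t i j l = ∑ j, ∑ l, ∑ i, t i j l := by
    rw [Finset.sum_comm]
    exact Finset.sum_congr rfl fun i _ ↦ Finset.sum_comm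
  have e3 (t : ∀ i, ∀ _ : κ, α i → W (f (g x))) :
      ∑ i, ∑ j, ∑ k, t i j k = ∑ i, ∑ k, ∑ j, t i j k :=
    Finset.sum_congr rfl fun i _ ↦ Finset.sum_comm
  rw [e1, e2, e3]
  simp only [mul_assoc, mul_comm, mul_left_comm]
  abel

theorem _root_.LieAlgebroid.IsMorphism.exists_expansion {f : M → N}
    {Φ : ∀ x, V x →ₗ[ℝ] W (f x)} (hΦ : IsMorphism A B f Φ) (σ : Cₛ^∞⟮I; F, V⟯) (x : M) :
    ∃ (k : ℕ) (h : Fin k → C^∞⟮I, M; 𝓘(ℝ, ℝ), ℝ⟯) (b : Fin k → Cₛ^∞⟮I'; G, W⟯),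
      ∀ᶠ x' in 𝓝 x, Φ x' (σ x') = ∑ i, h i x' • b i (f x') :=
  exists_isLocalExpansion (s := fun x ↦ Φ x (σ x)) isOpen_univ (Set.mem_univ x)
    (hΦ.contMDiff.comp σ.contMDiff).contMDiffOn

theorem sum_smul_comp {f : M → N} {Φ : ∀ x, V x →ₗ[ℝ] W (f x)} (g : C^∞⟮I₀, M₀; I, M⟯) {x : M₀}
    {ι : Type*} [Fintype ι] (h : ι → C^∞⟮I₀, M₀; 𝓘(ℝ, ℝ), ℝ⟯) {b : ι → Cₛ^∞⟮I; F, V⟯}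
    {α : ι → Type*} [∀ i, Fintype (α i)]
    {u : ∀ i, α i → C^∞⟮I, M; 𝓘(ℝ, ℝ), ℝ⟯} {c : ∀ i, α i → Cₛ^∞⟮I'; G, W⟯}
    (hu : ∀ i, ∀ᶠ z in 𝓝 (g x), Φ z (b i z) = ∑ k, u i k z • c i k (f z)) :
    ∀ᶠ x' in 𝓝 x, Φ (g x') (∑ i, h i x' • b i (g x')) =
      ∑ p : Σ i, α i, (h p.1 * (u p.1 p.2).comp g) x' • c p.1 p.2 ((f ∘ g) x') := by
  filter_upwards [g.contMDiff.continuous.continuousAt.eventually (Filter.eventually_all.2 hu)]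
    with x' hx'
  simp only [map_sum, map_smul, hx', Fintype.sum_sigma, Finset.smul_sum, ← mul_smul]
  rfl

/-- The composition of two Lie algebroid morphisms. -/
theorem _root_.LieAlgebroid.IsMorphism.comp {f : M → N} {Φ : ∀ x, V x →ₗ[ℝ] W (f x)}
    (hΦ : IsMorphism A B f Φ) {g : M₀ → M} {Ψ : ∀ x, V₀ x →ₗ[ℝ] V (g x)}
    (hΨ : IsMorphism A₀ A g Ψ) :
    IsMorphism A₀ B (f ∘ g) (fun x ↦ Φ (g x) ∘ₗ Ψ x) where
  contMDiff_base := hΦ.contMDiff_base.comp hΨ.contMDiff_base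
  contMDiff := hΦ.contMDiff.comp hΨ.contMDiff
  anchor x v := by
    rw [mfderiv_comp x (hΦ.contMDiff_base.mdifferentiable (by simp) _)
      (hΨ.contMDiff_base.mdifferentiable (by simp) x)]
    exact (hΦ.anchor _ _).trans (congrArg _ (hΨ.anchor x v))
  bracket a₁ a₂ x n m h b h' b' h₁ h₂ := by
    let g' : C^∞⟮I₀, M₀; I, M⟯ := ⟨g, hΨ.contMDiff_base⟩
    obtain ⟨k, u, c, hu⟩ := hΨ.exists_expansion a₁ x
    obtain ⟨l, v, d, hv⟩ := hΨ.exists_expansion a₂ x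
    choose k' u' c' hu' using fun i ↦ hΦ.exists_expansion (c i) (g x)
    choose l' v' d' hv' using fun i ↦ hΦ.exists_expansion (d i) (g x)
    have hX : mfderiv I₀ I g x (A₀.anchor x (a₁ x)) = A.anchor (g x) (∑ i, u i x • c i (g x)) := by
      rw [← hΨ.anchor, hu.self_of_nhds]
    have hY : mfderiv I₀ I g x (A₀.anchor x (a₂ x)) = A.anchor (g x) (∑ i, v i x • d i (g x)) := by
      rw [← hΨ.anchor, hv.self_of_nhds]
    have hX' (a : Cₛ^∞⟮I₀; F₀, V₀⟯) : mfderiv I₀ I' (f ∘ g) x (A₀.anchor x (a x)) =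
        B.anchor (f (g x)) (Φ (g x) (Ψ x (a x))) := by
      rw [mfderiv_comp x (hΦ.contMDiff_base.mdifferentiable (by simp) _)
        (hΨ.contMDiff_base.mdifferentiable (by simp) x)]
      exact ((hΦ.anchor _ _).trans (congrArg _ (hΨ.anchor x _))).symm
    have hs₁ := sum_smul_comp (Φ := Φ) g' u hu'
    have hs₂ := sum_smul_comp (Φ := Φ) g' v hv'
    have hh₁ : ∀ᶠ x' in 𝓝 x, ∑ i, h i x' • b i (f (g x')) = Φ (g x') (∑ i, u i x' • c i (g x')) := by
      filter_upwards [h₁, hu] with x' e₁ e₂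
      rw [← e₂]
      exact e₁.symm
    have hh₂ : ∀ᶠ x' in 𝓝 x, ∑ i, h' i x' • b' i (f (g x')) =
        Φ (g x') (∑ i, v i x' • d i (g x')) := by
      filter_upwards [h₂, hv] with x' e₁ e₂
      rw [← e₂]
      exact e₁.symm
    refine (congrArg (Φ (g x)) (hΨ.map_bracket (B := A) a₁ a₂ hu hv)).trans
      ((hΦ.map_expBracket g' hX hY hu' hv').trans (Eq.symm ?_))
    refine B.expBracket_congr ((hΦ.contMDiff_base.comp hΨ.contMDiff_base) x) ?_ ?_ ?_ ?_
    · exact (hX' a₁).trans (congrArg (B.anchor (f (g x))) h₁.self_of_nhds)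
    · exact (hX' a₂).trans (congrArg (B.anchor (f (g x))) h₂.self_of_nhds)
    · filter_upwards [hh₁, hs₁] with x' e₁ e₂ using e₁.trans e₂
    · filter_upwards [hh₂, hs₂] with x' e₁ e₂ using e₁.trans e₂

/-- A morphism to `B` over `f ∘ g`, together with the tangent map of `g`, defines a morphism over
`g` to the fibre product over `f`. -/
theorem IsFibreProduct.isMorphism_lift {f : M → N} {ρ : ∀ x, V x →ₗ[ℝ] TangentSpace I x}
    {Φ : ∀ x, V x →ₗ[ℝ] W (f x)} (hV : IsFibreProduct F B f ρ Φ) (g : C^∞⟮I₀, M₀; I, M⟯)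
    {Ψ : ∀ x, V₀ x →ₗ[ℝ] W (f (g x))} (hΨ : IsMorphism A₀ B (f ∘ g) Ψ)
    {j : ∀ x, V₀ x →ₗ[ℝ] V (g x)}
    (hj₁ : ∀ x v, ρ (g x) (j x v) = mfderiv I₀ I g x (A₀.anchor x v))
    (hj₂ : ∀ x v, Φ (g x) (j x v) = Ψ x v) :
    IsMorphism A₀ hV.algebroid g j where
  contMDiff_base := g.contMDiff
  contMDiff := by
    refine contMDiff_of_map_section g.contMDiff j fun s x ↦ ?_
    refine contMDiffAt_along_of_injective (f₁ := f) (f₂ := fun x : M ↦ x) (g := g)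
      (Ψ₁ := Φ) (Ψ₂ := ρ) (W := W) hV.contMDiff_base.continuous continuous_id hV.contMDiff_snd
      hV.contMDiff_fst (fun x v h₁ h₂ ↦ hV.injective x v h₂ h₁) g.contMDiff.contMDiffAt ?_ ?_
    · simp only [hj₂]
      exact (hΨ.contMDiff.comp s.contMDiff) x
    · simp only [hj₁]
      exact ((g.contMDiff.contMDiff_tangentMap (m := ∞) le_rfl).comp
        (A₀.anchorSection s).contMDiff) x
  anchor := hj₁
  bracket a₁ a₂ x n m h b h' b' h₁ h₂ := by
    have hX {a : Cₛ^∞⟮I₀; F₀, V₀⟯} {z : M₀} {w : V (g z)} (hw : j z (a z) = w) :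
        mfderiv I₀ I g z (A₀.anchorSection a z) = hV.algebroid.anchor (g z) w := by
      rw [← hw]
      exact (hj₁ z (a z)).symm
    refine hV.eq_of_eq ?_ ?_
    · rw [hj₁, A₀.anchor_bracket]
      exact hV.algebroid.mfderiv_mlieBracket_eq_anchor_expBracket g.contMDiff _ _
        (h₁.mono fun z hz ↦ hX hz) (h₂.mono fun z hz ↦ hX hz)
    · choose k' u' c' hu' using fun i ↦ hV.exists_expansion (b i) (g x)
      choose l' v' d' hv' using fun i ↦ hV.exists_expansion (b' i) (g x)
      rw [hj₂]
      refine Eq.trans ?_ (hV.isMorphism.map_expBracket g (hX h₁.self_of_nhds)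
        (hX h₂.self_of_nhds) hu' hv').symm
      refine hΨ.map_bracket (B := B) a₁ a₂ ?_ ?_
      · filter_upwards [h₁, sum_smul_comp (Φ := Φ) g h hu'] with z e₁ e₂
        rw [← hj₂, e₁]
        exact e₂
      · filter_upwards [h₂, sum_smul_comp (Φ := Φ) g h' hv'] with z e₁ e₂
        rw [← hj₂, e₁]
        exact e₂

/-- Linear maps to the factors of a fibre product which agree over the base lift to the fibre. -/
theorem IsFibreProduct.exists_lift {f : M → N} {ρ : ∀ x, V x →ₗ[ℝ] TangentSpace I x}
    {Φ : ∀ x, V x →ₗ[ℝ] W (f x)} (hV : IsFibreProduct F B f ρ Φ) {x : M} {U : Type*}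
    [AddCommGroup U] [Module ℝ U] (α : U →ₗ[ℝ] TangentSpace I x) (β : U →ₗ[ℝ] W (f x))
    (h : ∀ u, mfderiv I I' f x (α u) = B.anchor (f x) (β u)) :
    ∃ j : U →ₗ[ℝ] V x, ∀ u, ρ x (j u) = α u ∧ Φ x (j u) = β u := by
  choose j hj₁ hj₂ using fun u ↦ hV.surjective x (α u) (β u) (h u)
  exact ⟨{ toFun := j
           map_add' := fun u v ↦ hV.eq_of_eq (by simp only [hj₁, map_add])
             (by simp only [hj₂, map_add])
           map_smul' := fun t u ↦ hV.eq_of_eq (by simp only [hj₁, map_smul, RingHom.id_apply])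
             (by simp only [hj₂, map_smul, RingHom.id_apply]) }, fun u ↦ ⟨hj₁ u, hj₂ u⟩⟩

/-- The Lie algebroid bracket is the bracket of expansions along the identity. -/
theorem bracket_eq_expBracket (A : LieAlgebroid I F V) {s t : Cₛ^∞⟮I; F, V⟯} {x : M}
    {ι κ : Type*} [Fintype ι] [Fintype κ]
    {h : ι → C^∞⟮I, M; 𝓘(ℝ, ℝ), ℝ⟯} {b : ι → Cₛ^∞⟮I; F, V⟯}
    {g : κ → C^∞⟮I, M; 𝓘(ℝ, ℝ), ℝ⟯} {c : κ → Cₛ^∞⟮I; F, V⟯}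
    (h₁ : ∀ᶠ x' in 𝓝 x, s x' = ∑ i, h i x' • b i x')
    (h₂ : ∀ᶠ x' in 𝓝 x, t x' = ∑ j, g j x' • c j x') :
    A.bracket s t x =
      A.expBracket (fun z : M ↦ z) (A.anchor x (s x)) (A.anchor x (t x)) h b g c := by
  have h1 (v : TangentSpace I x) : mvfderiv I (1 : C^∞⟮I, M; 𝓘(ℝ, ℝ), ℝ⟯) x v = 0 := by
    rw [ContMDiffMap.coe_one]
    exact congrArg (fun L : E →L[ℝ] ℝ ↦ L v) (mvfderiv_const (I := I) (M := M) (1 : ℝ) (x := x))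
  have hid (v : TangentSpace I x) : mfderiv I I (fun z : M ↦ z) x v = v := by
    rw [show (fun z : M ↦ z) = id from rfl, mfderiv_id]
    rfl
  refine Eq.trans ?_ (A.expBracket_congr (ι := Unit) (κ := Unit) (h := fun _ ↦ 1) (b := fun _ ↦ s)
    (g := fun _ ↦ 1) (c := fun _ ↦ t) (f := fun z : M ↦ z) contMDiffAt_id ?_ ?_ ?_ ?_)
  · simp only [expBracket, h1]
    simp
  · rw [hid]; simp
  · rw [hid]; simp
  · simpa using h₁
  · simpa using h₂

theorem isMorphism_id (A : LieAlgebroid I F V) :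
    IsMorphism A A (fun x ↦ x) (fun _ ↦ LinearMap.id) where
  contMDiff_base := contMDiff_id
  contMDiff := contMDiff_id
  anchor x v := by
    rw [show (fun z : M ↦ z) = id from rfl, mfderiv_id]
    rfl
  bracket _ _ _ _ _ _ _ _ _ h₁ h₂ := A.bracket_eq_expBracket h₁ h₂

variable {V' : M → Type*} {F' : Type*} [NormedAddCommGroup F'] [NormedSpace ℝ F']
  [FiniteDimensional ℝ F'] [TopologicalSpace (TotalSpace F' V')] [∀ x, AddCommGroup (V' x)]
  [∀ x, Module ℝ (V' x)] [∀ x, TopologicalSpace (V' x)] [FiberBundle F' V'] [VectorBundle ℝ F' V']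
  [ContMDiffVectorBundle ∞ F' V' I] {A' : LieAlgebroid I F' V'} {Θ : ∀ x, V x ≃ₗ[ℝ] V' x}

theorem IsIso.isMorphism (hΘ : IsIso A A' Θ) :
    IsMorphism A A' (fun x ↦ x) (fun x ↦ (Θ x : V x →ₗ[ℝ] V' x)) where
  contMDiff_base := contMDiff_id
  contMDiff := hΘ.contMDiff
  anchor x v := by
    rw [show (fun z : M ↦ z) = id from rfl, mfderiv_id]
    exact hΘ.anchor x v
  bracket a₁ a₂ x _ _ h b g c h₁ h₂ := by
    refine (DFunLike.congr_fun (hΘ.bracket a₁ a₂) x).trans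
      ((A'.bracket_eq_expBracket (h := h) (b := b) (g := g) (c := c)
        (s := mapSection (fun x ↦ (Θ x : V x →ₗ[ℝ] V' x)) hΘ.contMDiff a₁)
        (t := mapSection (fun x ↦ (Θ x : V x →ₗ[ℝ] V' x)) hΘ.contMDiff a₂) h₁ h₂).trans ?_)
    rw [expandedBracket_eq]
    change A'.expBracket _ (A'.anchor x (Θ x (a₁ x))) (A'.anchor x (Θ x (a₂ x))) h b g c = _
    rw [hΘ.anchor, hΘ.anchor]

/-- It can be checked on generators that a fibrewise isomorphism is an isomorphism of Lie
algebroids. -/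
theorem isIso_of_generators (hanchor : ∀ x (v : V x), A'.anchor x (Θ x v) = A.anchor x v)
    {γ : Type*} (S : γ → Cₛ^∞⟮I; F, V⟯) (S' : γ → Cₛ^∞⟮I; F', V'⟯)
    (hS : ∀ o x, Θ x (S o x) = S' o x)
    (hspan : ∀ (s : Cₛ^∞⟮I; F, V⟯) (x : M), ∃ (n : ℕ) (h : Fin n → C^∞⟮I, M; 𝓘(ℝ, ℝ), ℝ⟯)
      (b : Fin n → γ), ∀ᶠ x' in 𝓝 x, s x' = ∑ i, h i x' • S (b i) x')
    (hbr : ∀ o o' x, Θ x (A.bracket (S o) (S o') x) = A'.bracket (S' o) (S' o') x) :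
    IsIso A A' Θ := by
  have hmap {s : Cₛ^∞⟮I; F, V⟯} {x : M} {n : ℕ} {h : Fin n → C^∞⟮I, M; 𝓘(ℝ, ℝ), ℝ⟯} {b : Fin n → γ}
      (hs : ∀ᶠ x' in 𝓝 x, s x' = ∑ i, h i x' • S (b i) x') :
      ∀ᶠ x' in 𝓝 x, Θ x' (s x') = ∑ i, h i x' • S' (b i) x' := by
    filter_upwards [hs] with x' hx'
    simp only [hx', map_sum, map_smul, hS]
  have hsmooth : ContMDiff (I.prod 𝓘(ℝ, F)) (I.prod 𝓘(ℝ, F')) ∞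
      (fun v : TotalSpace F V ↦ (⟨v.proj, (Θ v.proj : V v.proj →ₗ[ℝ] V' v.proj) v.2⟩ :
        TotalSpace F' V')) := by
    refine contMDiff_of_map_section contMDiff_id (fun x ↦ (Θ x : V x →ₗ[ℝ] V' x)) fun s x ↦ ?_
    obtain ⟨n, h, b, hs⟩ := hspan s x
    refine (ContMDiffAt.sum_along (f := fun x : M ↦ x) (σ := fun i x ↦ h i x • S' (b i) x)
      Finset.univ contMDiffAt_id fun i ↦ (h i).contMDiff.contMDiffAt.smul_along
        ((S' (b i)).contMDiff x)).congr_of_eventuallyEq ?_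
    filter_upwards [hmap hs] with x' hx'
    exact congrArg (TotalSpace.mk x') hx'
  refine ⟨hsmooth, contMDiff_bundle_symm Θ hsmooth, hanchor, fun s t ↦
    ContMDiffSection.ext fun x ↦ ?_⟩
  obtain ⟨n, h, b, hs⟩ := hspan s x
  obtain ⟨m, g, c, ht⟩ := hspan t x
  rw [A'.bracket_eq_expBracket (s := mapSection (fun x ↦ (Θ x : V x →ₗ[ℝ] V' x)) hsmooth s)
    (t := mapSection (fun x ↦ (Θ x : V x →ₗ[ℝ] V' x)) hsmooth t) (hmap hs) (hmap ht)]
  change Θ x (A.bracket s t x) = A'.expBracket (fun z : M ↦ z) (A'.anchor x (Θ x (s x)))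
    (A'.anchor x (Θ x (t x))) h (fun i ↦ S' (b i)) g (fun j ↦ S' (c j))
  rw [A.bracket_eq_expBracket hs ht, hanchor, hanchor]
  simp only [expBracket, map_sub, map_add, map_sum, map_smul, hbr, hS]

end LieAlgebroid

end Morphisms

/-! ### Splitting a Lie algebroid along a section over the time direction -/

section Splitting

variable {E : Type*} [NormedAddCommGroup E] [NormedSpace ℝ E] [FiniteDimensional ℝ E]
  {H : Type*} [TopologicalSpace H] {I : ModelWithCorners ℝ E H} [I.Boundaryless]
  {M : Type*} [TopologicalSpace M] [ChartedSpace H M] [IsManifold I ∞ M] [T2Space M]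
  {J : TopologicalSpace.Opens ℝ}
  {F : Type*} [NormedAddCommGroup F] [NormedSpace ℝ F] [FiniteDimensional ℝ F]
  {V : J × M → Type*} [TopologicalSpace (TotalSpace F V)] [∀ x, AddCommGroup (V x)]
  [∀ x, Module ℝ (V x)] [∀ x, TopologicalSpace (V x)] [FiberBundle F V] [VectorBundle ℝ F V]
  [ContMDiffVectorBundle ∞ F V (𝓘(ℝ, ℝ).prod I)]
  {F₀ : Type*} [NormedAddCommGroup F₀] [NormedSpace ℝ F₀] [FiniteDimensional ℝ F₀]
  {V₀ : M → Type*} [TopologicalSpace (TotalSpace F₀ V₀)] [∀ x, AddCommGroup (V₀ x)]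
  [∀ x, Module ℝ (V₀ x)] [∀ x, TopologicalSpace (V₀ x)] [FiberBundle F₀ V₀] [VectorBundle ℝ F₀ V₀]
  [ContMDiffVectorBundle ∞ F₀ V₀ I]

theorem hasMFDerivAt_opens_val (t : J) :
    HasMFDerivAt 𝓘(ℝ, ℝ) 𝓘(ℝ, ℝ) (Subtype.val : J → ℝ) t (ContinuousLinearMap.id ℝ ℝ) := by
  refine ⟨continuous_subtype_val.continuousAt, ?_⟩
  refine ((hasFDerivAt_id (𝕜 := ℝ) (t : ℝ)).congr_of_eventuallyEq ?_).hasFDerivWithinAt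
  filter_upwards [(isOpen_extChartAt_target (I := 𝓘(ℝ, ℝ)) t).mem_nhds
    (mem_extChartAt_target (I := 𝓘(ℝ, ℝ)) t)] with s hs
  exact (extChartAt 𝓘(ℝ, ℝ) t).right_inv hs

/-- The coordinate vector field on an open subset of the real line. -/
noncomputable def unitField (J : TopologicalSpace.Opens ℝ) :
    Cₛ^∞⟮𝓘(ℝ, ℝ); ℝ, (TangentSpace 𝓘(ℝ, ℝ) : J → Type)⟯ :=
  ⟨fun _ ↦ (1 : ℝ), fun t ↦ by
    have hval : ContMDiff 𝓘(ℝ, ℝ) 𝓘(ℝ, ℝ) ∞ (Subtype.val : J → ℝ) := contMDiff_subtype_val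
    let Ψ (t : J) : TangentSpace 𝓘(ℝ, ℝ) t →ₗ[ℝ] TangentSpace 𝓘(ℝ, ℝ) (t : ℝ) :=
      mfderiv 𝓘(ℝ, ℝ) 𝓘(ℝ, ℝ) (Subtype.val : J → ℝ) t
    have hΨ (t : J) (v : TangentSpace 𝓘(ℝ, ℝ) t) : Ψ t v = v :=
      congrArg (fun L : ℝ →L[ℝ] ℝ ↦ L v) (hasMFDerivAt_opens_val t).mfderiv
    have h1 : ContMDiff 𝓘(ℝ, ℝ) 𝓘(ℝ, ℝ).tangent ∞
        (fun t : J ↦ (⟨(t : ℝ), Ψ t (1 : ℝ)⟩ : TangentBundle 𝓘(ℝ, ℝ) ℝ)) := by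
      have h2 : (fun t : J ↦ (⟨(t : ℝ), Ψ t (1 : ℝ)⟩ : TangentBundle 𝓘(ℝ, ℝ) ℝ)) =
          fun t : J ↦ (⟨(t : ℝ), (1 : ℝ)⟩ : TangentBundle 𝓘(ℝ, ℝ) ℝ) :=
        funext fun t ↦ congrArg (TotalSpace.mk (t : ℝ)) (hΨ t (1 : ℝ))
      rw [h2]
      exact ContMDiff.comp (g := fun s : ℝ ↦ (⟨s, (1 : ℝ)⟩ : TangentBundle 𝓘(ℝ, ℝ) ℝ))
        (contMDiff_vectorSpace_iff_contDiff.2 contDiff_const) hval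
    exact contMDiffAt_along_of_injective (f₁ := (Subtype.val : J → ℝ))
      (f₂ := (Subtype.val : J → ℝ)) (Ψ₁ := Ψ) (Ψ₂ := Ψ) (g := fun t : J ↦ t)
      continuous_subtype_val continuous_subtype_val (hval.contMDiff_tangentMap le_rfl)
      (hval.contMDiff_tangentMap le_rfl) (fun t v h _ ↦ (hΨ t v).symm.trans h) contMDiffAt_id
      (h1 t) (h1 t)⟩

variable (I M J) in
/-- The time coordinate on `J × M`. -/
def timeFunction : C^∞⟮𝓘(ℝ, ℝ).prod I, J × M; 𝓘(ℝ, ℝ), ℝ⟯ :=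
  ⟨fun p ↦ p.1, contMDiff_subtype_val.comp contMDiff_fst⟩

theorem mvfderiv_timeFunction (p : J × M) (v : TangentSpace (𝓘(ℝ, ℝ).prod I) p) :
    mvfderiv (𝓘(ℝ, ℝ).prod I) (timeFunction I M J) p v = v.1 :=
  congrArg (fun L : ℝ × E →L[ℝ] ℝ ↦ L v)
    ((hasMFDerivAt_opens_val p.1).comp p (hasMFDerivAt_fst (I := 𝓘(ℝ, ℝ)) (I' := I) p)).mfderiv

namespace LieAlgebroid

theorem mfderiv_timeIncl (t : J) (m : M) (v : TangentSpace I m) :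
    mfderiv I (𝓘(ℝ, ℝ).prod I) (timeIncl I t) m v = ((0 : ℝ), v) := by
  have h := mfderiv_prod_right (I := 𝓘(ℝ, ℝ)) (I' := I) (x₀ := t) (y₀ := m)
  exact congrArg (fun L : E →L[ℝ] ℝ × E ↦ L v) h

variable {A : LieAlgebroid (𝓘(ℝ, ℝ).prod I) F V} {A₀ : LieAlgebroid I F₀ V₀}
  {P : LieAlgebroid (𝓘(ℝ, ℝ).prod I) (ℝ × F₀)
    (ProdBundle 𝓘(ℝ, ℝ) (TangentSpace 𝓘(ℝ, ℝ) : J → Type) I V₀)}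
  {y : Cₛ^∞⟮𝓘(ℝ, ℝ).prod I; F, V⟯}

/-- Brackets with a section over `∂_t` differentiate in the direction of time. -/
theorem isTimeDerivation_bracket (A : LieAlgebroid (𝓘(ℝ, ℝ).prod I) F V)
    (hy : ∀ p, A.anchor p (y p) = timeField p) : IsTimeDerivation (A.bracket y) := fun p ↦ by
  rw [← hy p]
  exact A.isPointDerivation_bracket y p

/-- Two sections of Lie algebroids over `J × M` have the same anchor if they commute with
sections over `∂_t` and have the same anchor at one time. -/
theorem anchor_eq_of_bracket_eq_zero {F' : Type*} [NormedAddCommGroup F'] [NormedSpace ℝ F']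
    [FiniteDimensional ℝ F'] {V' : J × M → Type*} [TopologicalSpace (TotalSpace F' V')]
    [∀ x, AddCommGroup (V' x)] [∀ x, Module ℝ (V' x)] [∀ x, TopologicalSpace (V' x)]
    [FiberBundle F' V'] [VectorBundle ℝ F' V'] [ContMDiffVectorBundle ∞ F' V' (𝓘(ℝ, ℝ).prod I)]
    {A' : LieAlgebroid (𝓘(ℝ, ℝ).prod I) F' V'} {y' : Cₛ^∞⟮𝓘(ℝ, ℝ).prod I; F', V'⟯}
    (hJ : (J : Set ℝ).OrdConnected) (hy : ∀ p, A.anchor p (y p) = timeField p)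
    (hy' : ∀ p, A'.anchor p (y' p) = timeField p) {σ : Cₛ^∞⟮𝓘(ℝ, ℝ).prod I; F, V⟯}
    {σ' : Cₛ^∞⟮𝓘(ℝ, ℝ).prod I; F', V'⟯} (hσ : A.bracket y σ = 0) (hσ' : A'.bracket y' σ' = 0)
    {t₀ : J} {m : M} (h0 : A.anchor (t₀, m) (σ (t₀, m)) = A'.anchor (t₀, m) (σ' (t₀, m))) (t : J) :
    A.anchor (t, m) (σ (t, m)) = A'.anchor (t, m) (σ' (t, m)) := by
  have hc : CompleteSpace (ℝ × E) := FiniteDimensional.complete ℝ _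
  let T := tangent (𝓘(ℝ, ℝ).prod I) (J × M)
  have hyy : A.anchorSection y = A'.anchorSection y' :=
    ContMDiffSection.ext fun p ↦ (hy p).trans (hy' p).symm
  have h1 : T.bracket (A.anchorSection y) (A.anchorSection σ) = 0 :=
    ContMDiffSection.ext fun p ↦ (A.anchor_bracket y σ p).symm.trans (by
      rw [hσ]; exact map_zero (A.anchor p))
  have h2 : T.bracket (A.anchorSection y) (A'.anchorSection σ') = 0 := by
    rw [hyy]
    exact ContMDiffSection.ext fun p ↦ (A'.anchor_bracket y' σ' p).symm.trans (by
      rw [hσ']; exact map_zero (A'.anchor p))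
  exact (T.isTimeDerivation_bracket (y := A.anchorSection y) hy).eq_of_eq hJ (h1.trans h2.symm)
    h0 t

/-- If a Lie algebroid `A` on `J × M` has a section `y` over `∂_t`, and `A₀` is embedded in `A` over
`{t₀} × M` with corank one, then the flow of `y` identifies `A` with `TJ × A₀`. -/
theorem exists_isIso_of_timeField [SecondCountableTopology M]
    (hP : IsProduct (tangent 𝓘(ℝ, ℝ) J) A₀ P) (hJ : (J : Set ℝ).OrdConnected)
    (hy : ∀ p, A.anchor p (y p) = timeField p) {t₀ : J} (ht₀ : (t₀ : ℝ) = 0)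
    {j : ∀ m, V₀ m →ₗ[ℝ] V (t₀, m)} (hj : IsMorphism A₀ A (timeIncl I t₀) j)
    (hj_inj : ∀ m, Function.Injective (j m))
    (hrank : ∀ _ : M, Module.finrank ℝ F = Module.finrank ℝ F₀ + 1) :
    ∃ Θ, IsIso P A Θ := by
  have hD := A.isTimeDerivation_bracket hy
  choose σ hσ hσ0 using fun a : Cₛ^∞⟮I; F₀, V₀⟯ ↦
    hD.exists_parallel hJ ht₀ (s := fun m ↦ j m (a m)) (hj.contMDiff.comp a.contMDiff)
  let Y : Cₛ^∞⟮𝓘(ℝ, ℝ).prod I; ℝ × F₀,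
    ProdBundle 𝓘(ℝ, ℝ) (TangentSpace 𝓘(ℝ, ℝ) : J → Type) I V₀⟯ := prodSection (unitField J) 0
  have hY (p : J × M) : P.anchor p (Y p) = timeField p :=
    (hP.anchor p _ _).trans (Prod.ext rfl (map_zero (A₀.anchor p.2)))
  -- the anchor of the parallel extensions
  have hanchor (a : Cₛ^∞⟮I; F₀, V₀⟯) (p : J × M) :
      A.anchor p (σ a p) = ((0 : ℝ), A₀.anchor p.2 (a p.2)) := by
    refine (anchor_eq_of_bracket_eq_zero hJ hy hY (hσ a) (hP.bracket_mixed (unitField J) a)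
      (t₀ := t₀) ?_ p.1).trans (hP.anchor p _ _)
    rw [hσ0]
    refine (hj.anchor p.2 (a p.2)).trans ?_
    rw [mfderiv_timeIncl]
    exact (hP.anchor (t₀, p.2) _ _).symm
  -- brackets of parallel extensions are parallel extensions of brackets
  have hbracket (a a' : Cₛ^∞⟮I; F₀, V₀⟯) : A.bracket (σ a) (σ a') = σ (A₀.bracket a a') := by
    refine ContMDiffSection.ext fun p ↦ hD.eq_of_eq hJ ?_ (t₀ := t₀) ?_ p.1
    · have h := A.jacobi y (σ a) (σ a')
      rw [hσ, A.bracket_swap (σ a') y, hσ, neg_zero, map_zero, map_zero, add_zero, add_zero] at h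
      rw [h, hσ]
    · have h1 (v : TangentSpace I p.2) :
          mvfderiv I (1 : C^∞⟮I, M; 𝓘(ℝ, ℝ), ℝ⟯) p.2 v = 0 := by
        rw [ContMDiffMap.coe_one]
        exact congrArg (fun L : E →L[ℝ] ℝ ↦ L v)
          (mvfderiv_const (I := I) (M := M) (1 : ℝ) (x := p.2))
      have hexp (a : Cₛ^∞⟮I; F₀, V₀⟯) : ∀ᶠ m in 𝓝 p.2, j m (a m) =
          ∑ _ : Unit, (1 : C^∞⟮I, M; 𝓘(ℝ, ℝ), ℝ⟯) m • σ a (timeIncl I t₀ m) :=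
        Filter.Eventually.of_forall fun m ↦ by
          simpa using! (hσ0 a m).symm
      rw [hσ0]
      refine Eq.symm ((hj.map_bracket (B := A) a a' (hexp a) (hexp a')).trans ?_)
      simp only [expBracket, h1]
      simp
      rfl
  -- the parallel extension of a single vector
  have hval {a a' : Cₛ^∞⟮I; F₀, V₀⟯} {p : J × M} (h : a p.2 = a' p.2) : σ a p = σ a' p :=
    hD.eq_of_eq hJ ((hσ a).trans (hσ a').symm) (t₀ := t₀) (by rw [hσ0, hσ0, h]) p.1
  choose ext hext using fun (m : M) (v : V₀ m) ↦
    exists_contMDiffSection_apply_eq (I := I) (F := F₀) m v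
  let T (p : J × M) : V₀ p.2 →ₗ[ℝ] V p :=
    { toFun := fun v ↦ σ (ext p.2 v) p
      map_add' := fun v w ↦ by
        refine hD.eq_of_eq hJ (τ := σ (ext p.2 v) + σ (ext p.2 w)) ?_ (t₀ := t₀) ?_ p.1
        · rw [map_add, hσ, hσ, hσ, add_zero]
        · rw [ContMDiffSection.coe_add, Pi.add_apply, hσ0, hσ0, hσ0, hext, hext, hext, map_add]
      map_smul' := fun c v ↦ by
        refine hD.eq_of_eq hJ (τ := c • σ (ext p.2 v)) ?_ (t₀ := t₀) ?_ p.1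
        · rw [map_smul, hσ, hσ, smul_zero]
        · rw [ContMDiffSection.coe_smul, Pi.smul_apply, hσ0, hσ0, hext, hext, map_smul] }
  have hT (a : Cₛ^∞⟮I; F₀, V₀⟯) (p : J × M) : T p (a p.2) = σ a p := hval (hext _ _)
  have hTanchor (p : J × M) (v : V₀ p.2) : A.anchor p (T p v) = ((0 : ℝ), A₀.anchor p.2 v) := by
    refine (hanchor (ext p.2 v) p).trans ?_
    rw [hext]
  let L (p : J × M) : ProdBundle 𝓘(ℝ, ℝ) (TangentSpace 𝓘(ℝ, ℝ) : J → Type) I V₀ p →ₗ[ℝ] V p :=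
    LinearMap.coprod (LinearMap.toSpanSingleton ℝ (V p) (y p) : ℝ →ₗ[ℝ] V p) (T p)
  have hL (p : J × M) (τ : ℝ) (v : V₀ p.2) : L p (τ, v) = τ • y p + T p v := rfl
  have hLanchor (p : J × M) (τ : ℝ) (v : V₀ p.2) :
      A.anchor p (L p (τ, v)) = (τ, A₀.anchor p.2 v) := by
    rw [hL, map_add, map_smul, hy, hTanchor]
    refine Prod.ext ?_ ?_
    · change τ * 1 + 0 = τ
      ring
    · change τ • (0 : TangentSpace I p.2) + A₀.anchor p.2 v = _
      rw [smul_zero, zero_add]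
  have hLker (p : J × M) (τ : ℝ) (v : V₀ p.2) (h : L p (τ, v) = 0) : τ = 0 ∧ v = 0 := by
    have hτ : τ = 0 := by
      have h1 := (hLanchor p τ v).symm.trans ((congrArg _ h).trans (map_zero _))
      exact congrArg (fun z : ℝ × E ↦ z.1) h1
    have h1 : σ (ext p.2 v) p = (0 : Cₛ^∞⟮𝓘(ℝ, ℝ).prod I; F, V⟯) p := by
      refine Eq.trans ?_ h
      rw [hL, hτ, zero_smul, zero_add]
      rfl
    have h2 := hD.eq_of_eq hJ (τ := 0) ((hσ _).trans (map_zero _).symm) (t₀ := p.1) (m := p.2)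
      h1 t₀
    rw [hσ0, hext] at h2
    exact ⟨hτ, hj_inj p.2 (h2.trans (map_zero _).symm)⟩
  have hLinj (p : J × M) : Function.Injective (L p) :=
    (injective_iff_map_eq_zero _).2 fun z hz ↦
      Prod.ext (hLker p z.1 z.2 hz).1 (hLker p z.1 z.2 hz).2
  let e (p : J × M) := (trivializationAt F V p).continuousLinearEquivAt ℝ p
    (mem_baseSet_trivializationAt F V p)
  let e₀ (m : M) := (trivializationAt F₀ V₀ m).continuousLinearEquivAt ℝ m
    (mem_baseSet_trivializationAt F₀ V₀ m)
  have hfin (p : J × M) : FiniteDimensional ℝ (V p) :=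
    (e p).symm.toLinearEquiv.finiteDimensional
  have hfin₀ (m : M) : FiniteDimensional ℝ (V₀ m) :=
    (e₀ m).symm.toLinearEquiv.finiteDimensional
  have hfinP (p : J × M) : FiniteDimensional ℝ
      (ProdBundle 𝓘(ℝ, ℝ) (TangentSpace 𝓘(ℝ, ℝ) : J → Type) I V₀ p) :=
    inferInstanceAs (FiniteDimensional ℝ (ℝ × V₀ p.2))
  have hdim (p : J × M) : Module.finrank ℝ
      (ProdBundle 𝓘(ℝ, ℝ) (TangentSpace 𝓘(ℝ, ℝ) : J → Type) I V₀ p) = Module.finrank ℝ (V p) := by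
    rw [(e p).toLinearEquiv.finrank_eq, hrank p.2, ← (e₀ p.2).toLinearEquiv.finrank_eq, add_comm]
    exact (Module.finrank_prod (R := ℝ) (M := ℝ) (M' := V₀ p.2)).trans
      (by rw [Module.finrank_self])
  refine ⟨fun p ↦ LinearEquiv.ofInjectiveOfFinrankEq (L p) (hLinj p) (hdim p),
    isIso_of_generators (fun p z ↦ (hLanchor p z.1 z.2).trans (hP.anchor p z.1 z.2).symm)
      (fun o : Option Cₛ^∞⟮I; F₀, V₀⟯ ↦ o.elim Y fun a ↦ prodSection 0 a)
      (fun o ↦ o.elim y σ) ?_ ?_ ?_⟩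
  · rintro (_ | a) p
    · refine (hL p 1 0).trans ?_
      rw [one_smul, map_zero, add_zero]
      rfl
    · refine (hL p 0 (a p.2)).trans ?_
      rw [zero_smul, zero_add, hT]
      rfl
  · intro s p
    obtain ⟨n, h, b, hs⟩ := exists_isLocalExpansion (I := 𝓘(ℝ, ℝ).prod I) (I' := I) (G := F₀)
      (W := V₀) (f := (Prod.snd : J × M → M)) (s := fun q ↦ (s q).2) isOpen_univ (Set.mem_univ p)
      (contMDiff_prodBundle_snd.comp s.contMDiff).contMDiffOn
    refine ⟨n + 1, Fin.cons (dirDeriv (P.anchorSection s) (timeFunction I M J)) h,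
      Fin.cons none fun i ↦ some (b i), ?_⟩
    filter_upwards [hs] with q hq
    have hg : dirDeriv (P.anchorSection s) (timeFunction I M J) q = (s q).1 :=
      (mvfderiv_timeFunction q _).trans (congrArg (fun z : ℝ × E ↦ z.1)
        (hP.anchor q (s q).1 (s q).2))
    let π₁ : ProdBundle 𝓘(ℝ, ℝ) (TangentSpace 𝓘(ℝ, ℝ) : J → Type) I V₀ q →ₗ[ℝ] ℝ :=
      LinearMap.fst ℝ ℝ (V₀ q.2)
    let π₂ : ProdBundle 𝓘(ℝ, ℝ) (TangentSpace 𝓘(ℝ, ℝ) : J → Type) I V₀ q →ₗ[ℝ] V₀ q.2 :=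
      LinearMap.snd ℝ ℝ (V₀ q.2)
    have hext₂ (z w : ProdBundle 𝓘(ℝ, ℝ) (TangentSpace 𝓘(ℝ, ℝ) : J → Type) I V₀ q)
      (h₁ : π₁ z = π₁ w) (h₂ : π₂ z = π₂ w) : z = w := Prod.ext h₁ h₂
    have h₁Y : π₁ (Y q) = 1 := rfl
    have h₂Y : π₂ (Y q) = 0 := rfl
    have h₁b (a : Cₛ^∞⟮I; F₀, V₀⟯) : π₁ (prodSection (0 : Cₛ^∞⟮𝓘(ℝ, ℝ); ℝ,
        (TangentSpace 𝓘(ℝ, ℝ) : J → Type)⟯) a q) = 0 := rfl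
    have h₂b (a : Cₛ^∞⟮I; F₀, V₀⟯) : π₂ (prodSection (0 : Cₛ^∞⟮𝓘(ℝ, ℝ); ℝ,
        (TangentSpace 𝓘(ℝ, ℝ) : J → Type)⟯) a q) = a q.2 := rfl
    rw [Fin.sum_univ_succ]
    simp only [Fin.cons_zero, Fin.cons_succ, Option.elim]
    refine hext₂ _ _ ?_ ?_
    · simp only [map_add, map_sum, map_smul, h₁Y, h₁b, mul_zero, Finset.sum_const_zero, add_zero,
        smul_eq_mul, mul_one]
      exact hg.symm
    · simp only [map_add, map_sum, map_smul, h₂Y, h₂b, smul_zero, zero_add]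
      exact hq
  · have hmixed (a : Cₛ^∞⟮I; F₀, V₀⟯) : P.bracket Y (prodSection 0 a) = 0 :=
      hP.bracket_mixed (unitField J) a
    rintro (_ | a) (_ | a') p
    · change L p (P.bracket Y Y p) = A.bracket y y p
      rw [P.bracket_self, A.bracket_self]
      exact map_zero (L p)
    · change L p (P.bracket Y (prodSection 0 a') p) = A.bracket y (σ a') p
      rw [hmixed, hσ]
      exact map_zero (L p)
    · change L p (P.bracket (prodSection 0 a) Y p) = A.bracket (σ a) y p
      rw [P.bracket_swap, A.bracket_swap, hmixed, hσ, neg_zero, neg_zero]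
      exact map_zero (L p)
    · change L p (P.bracket (prodSection 0 a) (prodSection 0 a') p) = A.bracket (σ a) (σ a') p
      rw [hP.bracket_right, hbracket]
      refine (hL p 0 (A₀.bracket a a' p.2)).trans ?_
      rw [zero_smul, zero_add, hT]

end LieAlgebroid

end Splitting

/-! ### Restriction to a fixed time -/

section RestrictionToATime

variable {E : Type*} [NormedAddCommGroup E] [NormedSpace ℝ E] [FiniteDimensional ℝ E]
  {H : Type*} [TopologicalSpace H] {I : ModelWithCorners ℝ E H} [I.Boundaryless]
  {M : Type*} [TopologicalSpace M] [ChartedSpace H M] [IsManifold I ∞ M] [T2Space M]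
  {J : TopologicalSpace.Opens ℝ}
  {E' : Type*} [NormedAddCommGroup E'] [NormedSpace ℝ E']
  {H' : Type*} [TopologicalSpace H'] {I' : ModelWithCorners ℝ E' H'}
  {N : Type*} [TopologicalSpace N] [ChartedSpace H' N] [IsManifold I' ∞ N]
  {G : Type*} [NormedAddCommGroup G] [NormedSpace ℝ G] [FiniteDimensional ℝ G]
  {W : N → Type*} [TopologicalSpace (TotalSpace G W)] [∀ x, AddCommGroup (W x)]
  [∀ x, Module ℝ (W x)] [∀ x, TopologicalSpace (W x)] [FiberBundle G W] [VectorBundle ℝ G W]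

namespace LieAlgebroid

theorem mfderiv_comp_timeIncl (φ : C^∞⟮𝓘(ℝ, ℝ).prod I, J × M; I', N⟯) (t : J) (m : M)
    (v : TangentSpace I m) :
    mfderiv I I' (φ.comp (timeIncl I t)) m v =
      mfderiv (𝓘(ℝ, ℝ).prod I) I' φ (t, m) (mfderiv I (𝓘(ℝ, ℝ).prod I) (timeIncl I t) m v) :=
  mfderiv_comp_apply m (φ.contMDiff.mdifferentiable (by simp) _)
    ((timeIncl I t).contMDiff.mdifferentiable (by simp) m) v

/-- If the fibre of `φ^{!!}B` contains a vector over `∂_t`, then the fibre of `φ_t^{!!}B` has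
corank one in it, as the kernel of the time component. -/
theorem finrank_pullbackSubmodule_timeIncl (B : LieAlgebroid I' G W)
    (φ : C^∞⟮𝓘(ℝ, ℝ).prod I, J × M; I', N⟯) (t : J) (m : M)
    {w : TangentSpace (𝓘(ℝ, ℝ).prod I) ((t, m) : J × M) × ((φ : J × M → N) *ᵖ W) (t, m)}
    (hw : w ∈ B.pullbackSubmodule φ (t, m)) (hwt : w.1 = timeField ((t, m) : J × M)) :
    Module.finrank ℝ (B.pullbackSubmodule φ (t, m)) =
      Module.finrank ℝ (B.pullbackSubmodule (φ.comp (timeIncl I t)) m) + 1 := by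
  let S := B.pullbackSubmodule φ (t, m)
  let S₀ := B.pullbackSubmodule (φ.comp (timeIncl I t)) m
  let e := (trivializationAt G W (φ (t, m))).continuousLinearEquivAt ℝ (φ (t, m))
    (mem_baseSet_trivializationAt G W (φ (t, m)))
  have hfin : FiniteDimensional ℝ (W (φ (t, m))) := e.symm.toLinearEquiv.finiteDimensional
  have hfin' : FiniteDimensional ℝ (TangentSpace (𝓘(ℝ, ℝ).prod I) ((t, m) : J × M) ×
      ((φ : J × M → N) *ᵖ W) (t, m)) :=
    inferInstanceAs (FiniteDimensional ℝ ((ℝ × E) × W (φ (t, m))))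
  let ℓ : S →ₗ[ℝ] ℝ :=
    (LinearMap.fst ℝ ℝ E ∘ₗ LinearMap.fst ℝ (ℝ × E) (W (φ (t, m)))) ∘ₗ S.subtype
  let j : S₀ →ₗ[ℝ] S :=
    { toFun := fun z ↦ ⟨(((0 : ℝ), z.1.1), z.1.2), by
        have h := mfderiv_comp_timeIncl φ t m z.1.1
        rw [mfderiv_timeIncl] at h
        exact h.symm.trans z.2⟩
      map_add' := fun z z' ↦ Subtype.ext (Prod.ext (Prod.ext (add_zero (0 : ℝ)).symm rfl) rfl)
      map_smul' := fun c z ↦ Subtype.ext (Prod.ext (Prod.ext (mul_zero c).symm rfl) rfl) }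
  have hj : Function.Injective j := fun z z' h ↦ by
    have h1 : (((0 : ℝ), z.1.1), z.1.2) = (((0 : ℝ), z'.1.1), z'.1.2) := congrArg Subtype.val h
    exact Subtype.ext (Prod.ext (congrArg (fun u : (ℝ × E) × W (φ (t, m)) ↦ u.1.2) h1)
      (congrArg (fun u : (ℝ × E) × W (φ (t, m)) ↦ u.2) h1))
  have hker : LinearMap.ker ℓ = LinearMap.range j := by
    ext z
    constructor
    · intro hz
      have hz1 : z.1.1 = ((0 : ℝ), z.1.1.2) := Prod.ext hz rfl
      refine ⟨⟨(z.1.1.2, z.1.2), ?_⟩, Subtype.ext (Prod.ext hz1.symm rfl)⟩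
      let v : TangentSpace I m := z.1.1.2
      exact ((mfderiv_comp_timeIncl φ t m v).trans (congrArg _
        ((mfderiv_timeIncl t m v).trans hz1.symm))).trans z.2
    · rintro ⟨z, rfl⟩
      rfl
  have hrange : LinearMap.range ℓ = ⊤ := by
    rw [LinearMap.range_eq_top]
    intro c
    refine ⟨c • ⟨w, hw⟩, ?_⟩
    have h1 : ℓ ⟨w, hw⟩ = 1 := congrArg (fun z : ℝ × E ↦ z.1) hwt
    rw [map_smul, h1, smul_eq_mul, mul_one]
  have h := ℓ.finrank_range_add_finrank_ker
  rw [hrange, hker, LinearMap.finrank_range_of_inj hj, finrank_top, Module.finrank_self] at h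
  change Module.finrank ℝ S = Module.finrank ℝ S₀ + 1
  rw [← h, add_comm]

/-- The inclusion of `A` in `TJ × A` at time `t` is a lift of the identity of `A`. -/
theorem isMorphism_bundleIncl {F : Type*} [NormedAddCommGroup F] [NormedSpace ℝ F]
    [FiniteDimensional ℝ F] {V : M → Type*} [TopologicalSpace (TotalSpace F V)]
    [∀ x, AddCommGroup (V x)] [∀ x, Module ℝ (V x)] [∀ x, TopologicalSpace (V x)]
    [FiberBundle F V] [VectorBundle ℝ F V] [ContMDiffVectorBundle ∞ F V I]
    (A : LieAlgebroid I F V) (t : J) :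
    IsMorphism A (A.isFibreProduct_prod (I := 𝓘(ℝ, ℝ)) (M := J)).algebroid (timeIncl I t)
      (bundleIncl I V t) :=
  A.isFibreProduct_prod.isMorphism_lift (timeIncl I t) (A₀ := A) (V₀ := V)
    (Ψ := fun m ↦ (LinearMap.id : V m →ₗ[ℝ] V m))
    A.isMorphism_id (fun m v ↦ (mfderiv_timeIncl t m (A.anchor m v)).symm) fun _ _ ↦ rfl

end LieAlgebroid

end RestrictionToATime

theorem corollary3p19
    {EM : Type*} [NormedAddCommGroup EM] [NormedSpace ℝ EM] [FiniteDimensional ℝ EM]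
    {HM : Type*} [TopologicalSpace HM] (IM : ModelWithCorners ℝ EM HM) [IM.Boundaryless]
    {M : Type*} [TopologicalSpace M] [ChartedSpace HM M] [IsManifold IM ∞ M]
    [T2Space M] [SecondCountableTopology M]
    {EN : Type*} [NormedAddCommGroup EN] [NormedSpace ℝ EN] [FiniteDimensional ℝ EN]
    {HN : Type*} [TopologicalSpace HN] (IN : ModelWithCorners ℝ EN HN) [IN.Boundaryless]
    {N : Type*} [TopologicalSpace N] [ChartedSpace HN N] [IsManifold IN ∞ N]
    [T2Space N] [SecondCountableTopology N]
    {FB : Type*} [NormedAddCommGroup FB] [NormedSpace ℝ FB] [FiniteDimensional ℝ FB]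
    {VB : N → Type*} [TopologicalSpace (TotalSpace FB VB)] [∀ n, AddCommGroup (VB n)]
    [∀ n, Module ℝ (VB n)] [∀ n, TopologicalSpace (VB n)] [FiberBundle FB VB]
    [VectorBundle ℝ FB VB] [ContMDiffVectorBundle ∞ FB VB IN]
    -- the Lie algebroid `B → N` and the open interval `J ∋ 0, 1`
    (B : LieAlgebroid IN FB VB)
    (J : TopologicalSpace.Opens ℝ) (_hJ : (J : Set ℝ).OrdConnected)
    (h0 : (0 : ℝ) ∈ J) (h1 : (1 : ℝ) ∈ J)
    -- the smooth homotopy `φ`, such that `φ^{!!}B` exists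
    (φ : C^∞⟮𝓘(ℝ, ℝ).prod IM, J × M; IN, N⟯) {r : ℕ} (hφ : B.PullbackExists φ r)
    -- the smooth section `(s, m) ↦ (∂_t|_s, 0_m, y(s, m))` of `φ^{!!}B`
    (y : Cₛ^∞⟮𝓘(ℝ, ℝ).prod IM; EuclideanSpace ℝ (Fin r), B.PullbackBundle φ hφ⟯)
    (_hy : ∀ p, B.pullbackAnchor φ hφ p (y p) = LieAlgebroid.timeField p) :
    -- the pullback `φ₀^{!!}B` exists
    ∃ (r₀ : ℕ) (hφ₀ : B.PullbackExists (φ.comp (LieAlgebroid.timeIncl IM ⟨0, h0⟩)) r₀)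
      -- the Lie algebroids `φ^{!!}B`, `φ₀^{!!}B` and `TJ × φ₀^{!!}B`
      (A : LieAlgebroid (𝓘(ℝ, ℝ).prod IM) (EuclideanSpace ℝ (Fin r)) (B.PullbackBundle φ hφ))
      (A₀ : LieAlgebroid IM (EuclideanSpace ℝ (Fin r₀))
        (B.PullbackBundle (φ.comp (LieAlgebroid.timeIncl IM ⟨0, h0⟩)) hφ₀))
      (P : LieAlgebroid (𝓘(ℝ, ℝ).prod IM) (ℝ × EuclideanSpace ℝ (Fin r₀))
        (LieAlgebroid.ProdBundle 𝓘(ℝ, ℝ) (TangentSpace 𝓘(ℝ, ℝ) : J → Type) IM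
          (B.PullbackBundle (φ.comp (LieAlgebroid.timeIncl IM ⟨0, h0⟩)) hφ₀))),
      B.IsPullback φ hφ A ∧
      B.IsPullback (φ.comp (LieAlgebroid.timeIncl IM ⟨0, h0⟩)) hφ₀ A₀ ∧
      LieAlgebroid.IsProduct (LieAlgebroid.tangent 𝓘(ℝ, ℝ) J) A₀ P ∧
      (∃ Θ, LieAlgebroid.IsIso P A Θ) ∧
      ∀ Θ, LieAlgebroid.IsIso P A Θ →
        LieAlgebroid.IsLAHomotopy h0 h1 A₀ B P
          (fun m ↦ φ (⟨0, h0⟩, m))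
          (fun m ↦ B.pullbackProj φ hφ (⟨0, h0⟩, m) ∘ₗ (Θ (⟨0, h0⟩, m)).toLinearMap ∘ₗ
            LieAlgebroid.bundleIncl IM _ ⟨0, h0⟩ m)
          (fun m ↦ φ (⟨1, h1⟩, m))
          (fun m ↦ B.pullbackProj φ hφ (⟨1, h1⟩, m) ∘ₗ (Θ (⟨1, h1⟩, m)).toLinearMap ∘ₗ
            LieAlgebroid.bundleIncl IM _ ⟨1, h1⟩ m)
          φ
          (fun p ↦ B.pullbackProj φ hφ p ∘ₗ (Θ p).toLinearMap) := by
  obtain ⟨hφ₀, hr⟩ : ∃ hφ₀ : B.PullbackExists (φ.comp (LieAlgebroid.timeIncl IM ⟨0, h0⟩)) (r - 1),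
      ∀ _ : M, r = r - 1 + 1 := by
    have h (m : M) := (hφ (⟨0, h0⟩, m)).symm.trans
      (B.finrank_pullbackSubmodule_timeIncl φ ⟨0, h0⟩ m
        (Subbundle.incl_mem (B.isSmoothSubbundle_pullback φ hφ) _ (y (⟨0, h0⟩, m))) (_hy _))
    exact ⟨fun m ↦ by rw [h m]; rfl, fun m ↦ by rw [h m]; rfl⟩
  let t₀ : J := ⟨0, h0⟩
  let hV := B.isFibreProduct_pullback φ hφ
  let hV₀ := B.isFibreProduct_pullback (φ.comp (LieAlgebroid.timeIncl IM t₀)) hφ₀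
  let A₀ := hV₀.algebroid
  let hP := A₀.isFibreProduct_prod (I := 𝓘(ℝ, ℝ)) (M := J)
  refine ⟨r - 1, hφ₀, hV.algebroid, A₀, hP.algebroid, B.isPullback_algebroid φ hφ,
    B.isPullback_algebroid _ hφ₀, A₀.isProduct_algebroid, ?_, fun Θ hΘ ↦ ?_⟩
  · choose j hj using fun m : M ↦ hV.exists_lift (x := (t₀, m))
      ((mfderiv IM (𝓘(ℝ, ℝ).prod IM) (LieAlgebroid.timeIncl IM t₀) m).toLinearMap ∘ₗ
        B.pullbackAnchor _ hφ₀ m) (B.pullbackProj _ hφ₀ m)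
      fun v ↦ (LieAlgebroid.mfderiv_comp_timeIncl φ t₀ m _).symm.trans (hV₀.compat m v).symm
    refine LieAlgebroid.exists_isIso_of_timeField A₀.isProduct_algebroid _hJ _hy (t₀ := t₀) rfl
      (hV.isMorphism_lift (LieAlgebroid.timeIncl IM t₀) (A₀ := A₀) hV₀.isMorphism (j := j)
        (fun m v ↦ (hj m v).1) fun m v ↦ (hj m v).2) (fun m ↦ ?_) fun m ↦ ?_
    · refine (injective_iff_map_eq_zero (j m)).2 fun v hv ↦ hV₀.injective m v ?_ ?_
      · have h := (hj m v).1
        rw [hv, map_zero] at h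
        have h' := h.trans (LieAlgebroid.mfderiv_timeIncl t₀ m _)
        exact (congrArg (fun z : ℝ × EM ↦ z.2) h').symm
      · have h := (hj m v).2
        rw [hv, map_zero] at h
        exact h.symm
    · rw [finrank_euclideanSpace_fin, finrank_euclideanSpace_fin]
      exact hr m
  · have hΦ : LieAlgebroid.IsMorphism hP.algebroid B φ
        (fun p ↦ B.pullbackProj φ hφ p ∘ₗ (Θ p).toLinearMap) := hV.isMorphism.comp hΘ.isMorphism
    exact ⟨A₀.isProduct_algebroid, hΦ.comp (A₀.isMorphism_bundleIncl ⟨0, h0⟩),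
      hΦ.comp (A₀.isMorphism_bundleIncl ⟨1, h1⟩), hΦ, fun _ _ ↦ rfl, fun _ _ ↦ rfl⟩
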